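/- **Setting.** Let $Z$ be a random data vector, $X=X(Z)$ a measurable function of it (the covariates), $\Theta\subseteq\mathbb R^d$, $\theta_0\in\Theta$, $\mathcal H$ a set of measurable functions $h$ of $X$ with values in $\mathbb R^\ell$, $h_0\in\mathcal H$, and $m(z,\theta,\gamma)\in\mathbb R^d$ ($\theta\in\mathbb R^d,\gamma\in\mathbb R^\ell$) moment functions, measurable in $z$, with $\mathbb E[m(Z,\theta_0,h_0(X))\mid X]=0$ a.s. Suppose that $\Theta$ is star-shaped about $\theta_0$ in a neighbourhood of $\theta_0$ and that $\mathcal H$ is star-shaped about $h_0$ (e.g. both are convex). The distribution of $Z$ does not depend on $n$. For $\alpha\in\mathbb N^\ell$ put $\|\alpha\|_1=\sum_i\alpha_i$ and $D^\alpha m=\partial_{\gamma_1}^{\alpha_1}\cdots\partial_{\gamma_\ell}^{\alpha_\ell}m$. Let $S\subseteq\mathbb N^\ell$ be non-empty with $k=\max_{\alpha\in S}\|\alpha\|_1<\infty$. **Estimators.** Let $Z_1,Z_2,\dots$ be i.i.d. copies of $Z$, $X_t=X(Z_t)$. *Sample splitting:* $\hat h\in\mathcal H$ is a function of $(Z_t)_{t=n+1}^{2n}$,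 and $\hat\theta_{SS}$, a function of $(Z_t)_{t=1}^{2n}$, lies in $\Theta$ and solves $\frac1n\sum_{t=1}^n m(Z_t,\theta,\hat h(X_t))=0$, with probability tending to one. *$K$-fold cross-fitting* ($K$ fixed, $n\to\infty$ with $K\mid 2n$): $[2n]$ is partitioned into $I_1,\dots,I_K$ of size $2n/K$, $\hat h_j\in\mathcal H$ is a function of $(Z_t)_{t\notin I_j}$, and $\hat\theta_{CF}$, a function of $(Z_t)_{t=1}^{2n}$, lies in $\Theta$ and solves $\frac1{2n}\sum_{j=1}^K\sum_{t\in I_j}m(Z_t,\theta,\hat h_j(X_t))=0$, with probability tending to one. **Conditions on the moments.** 1. ($S$-orthogonality) $\mathbb E[D^\alpha m(Z,\theta_0,h_0(X))\mid X]=0$ a.s. for all $\alpha\in S$. 2. (Identifiability) $\mathbb E[m(Z,\theta,h_0(X))]\ne0$ for $\theta\in\Theta\setminus\{\theta_0\}$. 3. (Non-degeneracy) $J=\mathbb E[\nabla_\theta m(Z,\theta_0,h_0(X))]$ is invertible. 4. (Smoothness) For every $z$, $m(z,\cdot,\cdot)$ is $C^{\max(k,1)}$, the $k$-th derivative of $\gamma\mapsto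 m(z,\theta_0,\gamma)$ is differentiable, and $\nabla_\theta m(z,\theta,\gamma)$ is differentiable in $\gamma$. 5. (Regularity) For some $r>0$, with $\mathcal B_\theta=\{\theta\in\Theta:\|\theta-\theta_0\|_2\le r\}$ and $\mathcal B_h=\{h\in\mathcal H:\mathbb E\prod_i|h_i(X)-h_{0,i}(X)|^{2\alpha_i}\le r\text{ for all }1\le\|\alpha\|_1\le k+1\}$: (a) $\mathbb E[\sup_{\theta\in\mathcal B_\theta}\|\nabla_\theta m(Z,\theta,h_0(X))\|_F]<\infty$; (b) $\sup_{h\in\mathcal B_h}\mathbb E[\sup_{\theta\in\mathcal B_\theta}\|\nabla_\gamma\nabla_\theta m(Z,\theta,h(X))\|^2]<\infty$; (c) $\max_{\|\alpha\|_1\le k+1}\sup_{h\in\mathcal B_h}\mathbb E[\|D^\alpha m(Z,\theta_0,h(X))\|^4]<\infty$; and for all compact $A\subseteq\Theta$ (d) $\mathbb E[\sup_{\theta\in A,h\in\mathcal B_h}\|m(Z,\theta,h(X))\|]<\infty$; (e) $\sup_{\theta\in A,h\in\mathcal B_h}\mathbb E[\|\nabla_\gamma m(Z,\theta,h(X))\|^2]<\infty$.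 **First stage conditions** on a nuisance estimate $\hat h$ ($X$ is independent of $\hat h$, and limits are in probability): 6. $\mathbb E[\prod_i|\hat h_i(X)-h_{0,i}(X)|^{4\alpha_i}\mid\hat h]\to0$ for all $0\ne\alpha\in S$; 7. $n^{1/2}\big(\mathbb E[\prod_i|\hat h_i(X)-h_{0,i}(X)|^{2\alpha_i}\mid\hat h]\big)^{1/2}\to0$ for all $\alpha\notin S$ with $1\le\|\alpha\|_1\le k+1$. **Theorem.** Suppose 1–5, and let $\Sigma=J^{-1}V(J^{-1})^{\mathsf T}$ with $V=\mathrm{Cov}(m(Z,\theta_0,h_0(X)))$. If $\hat h$ satisfies 6 and 7 and $\hat\theta_{SS}$ is consistent for $\theta_0$, then $\sqrt n(\hat\theta_{SS}-\theta_0)\to_d N(0,\Sigma)$. If every $\hat h_j$ ($j=1,\dots,K$) satisfies 6 and 7 and $\hat\theta_{CF}$ is consistent for $\theta_0$, then $\sqrt{2n}(\hat\theta_{CF}-\theta_0)\to_d N(0,\Sigma)$. In particular, for $k$-orthogonal moments, i.e. $S=\{\alpha\in\mathbb N^\ell:\|\alpha\|_1\le k\}$, both conclusions hold with 6 and 7 replaced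 by: for all $i$, $n^{1/(2k+2)}\,\|\hat h_i-h_{0,i}\|_{2k+2}\to0$ and (if $k\ge1$) $\|\hat h_i-h_{0,i}\|_{4k}\to0$ in probability, where $\|\hat h_i-h_{0,i}\|_p=\mathbb E[|\hat h_i(X)-h_{0,i}(X)|^p\mid\hat h]^{1/p}$. -/

import Mathlib

open MeasureTheory ProbabilityTheory Filter Topology
open scoped ENNReal BigOperators

namespace OrthogonalML

/-- `ℝⁿ` with its Euclidean norm. -/
abbrev Vec (n : ℕ) : Type := EuclideanSpace ℝ (Fin n)

/-- The partial derivative of `f` in the `i`-th coordinate. -/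
noncomputable def pderiv {ℓ : ℕ} {F : Type*} [NormedAddCommGroup F] [NormedSpace ℝ F]
    (i : Fin ℓ) (f : Vec ℓ → F) : Vec ℓ → F :=
  fun γ => fderiv ℝ f γ (EuclideanSpace.single i 1)

/-- The higher-order differential `D^α f = ∂₁^{α₁} ∂₂^{α₂} ⋯ ∂_ℓ^{α_ℓ} f`. -/
noncomputable def multiDeriv {ℓ : ℕ} {F : Type*} [NormedAddCommGroup F] [NormedSpace ℝ F]
    (α : Fin ℓ → ℕ) (f : Vec ℓ → F) : Vec ℓ → F :=
  (List.finRange ℓ).foldr (fun i g => (pderiv i)^[α i] g) f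

/-- The order `‖α‖₁` of a multi-index. -/
def order {ℓ : ℕ} (α : Fin ℓ → ℕ) : ℕ := ∑ i, α i

/-- The `k`-orthogonality set `S_k = {α : ‖α‖₁ ≤ k}`. -/
def orthSet (ℓ k : ℕ) : Set (Fin ℓ → ℕ) := {α | order α ≤ k}

/-- `f n → 0` in probability, along the filter `l`, for `[0, ∞]`-valued random variables `f n`. -/
def TendstoZeroInProb {Ω : Type*} [MeasurableSpace Ω] (P : Measure Ω) (l : Filter ℕ)
    (f : ℕ → Ω → ℝ≥0∞) : Prop :=
  ∀ ε : ℝ≥0∞, 0 < ε → Tendsto (fun n => P {ω | ε ≤ f n ω}) l (𝓝 0)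

/-- The semiparametric model: a data vector `Z` with values in `𝒵` and distribution `law`,
covariates `X = X(Z)`, moment functions `m(z, θ, γ)`, a parameter set `Θ ∋ θ₀`, a class `ℋ ∋ h₀` of
nuisance functions, and the conditional moment conditions `E[m(Z, θ₀, h₀(X)) | X] = 0`. -/
structure MomentModel (𝒵 𝒳 : Type*) [MeasurableSpace 𝒵] [MeasurableSpace 𝒳] (d ℓ : ℕ) where
  /-- the distribution of the data vector -/
  law : Measure 𝒵
  isProb : IsProbabilityMeasure law
  /-- the covariates, as a function of the data vector -/
  X : 𝒵 → 𝒳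
  measurable_X : Measurable X
  /-- the moment functions -/
  m : 𝒵 → Vec d → Vec ℓ → Vec d
  measurable_m : ∀ θ γ, Measurable fun z => m z θ γ
  /-- the parameter set -/
  Θ : Set (Vec d)
  /-- the target parameter -/
  θ₀ : Vec d
  θ₀_mem : θ₀ ∈ Θ
  /-- near `θ₀`, segments from `θ₀` to points of `Θ` stay in `Θ`
  (true if `Θ` is convex, and if `θ₀` is an interior point) -/
  starConvex_Θ : ∃ δ > 0, StarConvex ℝ θ₀ (Θ ∩ Metric.closedBall θ₀ δ)
  /-- the class of nuisance functions -/
  ℋ : Set (𝒳 → Vec ℓ)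
  measurable_ℋ : ∀ h ∈ ℋ, Measurable h
  /-- the true nuisance function -/
  h₀ : 𝒳 → Vec ℓ
  h₀_mem : h₀ ∈ ℋ
  /-- convex combinations of `h₀` and members of `ℋ` are in `ℋ` (true if `ℋ` is convex) -/
  starConvex_ℋ : StarConvex ℝ h₀ ℋ
  integrable_moment : Integrable (fun z => m z θ₀ (h₀ (X z))) law
  moment_eq_zero :
    law[fun z => m z θ₀ (h₀ (X z)) | MeasurableSpace.comap X inferInstance] =ᵐ[law] 0

namespace MomentModel

variable {𝒵 𝒳 : Type*} [MeasurableSpace 𝒵] [MeasurableSpace 𝒳] {d ℓ : ℕ}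

/-- The Jacobian `∇_θ m(z, θ, γ)`. -/
noncomputable def gradθ (M : MomentModel 𝒵 𝒳 d ℓ) (z : 𝒵) (θ : Vec d) (γ : Vec ℓ) :
    Matrix (Fin d) (Fin d) ℝ :=
  Matrix.of fun i j => pderiv j (fun θ' => M.m z θ' γ) θ i

/-- The squared Frobenius norm of `∇_θ m(z, θ, γ)`. -/
noncomputable def gradθNormSq (M : MomentModel 𝒵 𝒳 d ℓ) (z : 𝒵) (θ : Vec d) (γ : Vec ℓ) : ℝ≥0∞ :=
  ∑ i, ∑ j, ‖M.gradθ z θ γ i j‖ₑ ^ 2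

/-- The squared Euclidean norm of the Jacobian `∇_γ m(z, θ, γ)`. -/
noncomputable def gradγNormSq (M : MomentModel 𝒵 𝒳 d ℓ) (z : 𝒵) (θ : Vec d) (γ : Vec ℓ) : ℝ≥0∞ :=
  ∑ a : Fin ℓ, ‖pderiv a (M.m z θ) γ‖ₑ ^ 2

/-- The squared Euclidean norm of the array `∇_γ ∇_θ m(z, θ, γ)` of mixed second derivatives. -/
noncomputable def gradγθNormSq (M : MomentModel 𝒵 𝒳 d ℓ) (z : 𝒵) (θ : Vec d) (γ : Vec ℓ) : ℝ≥0∞ :=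
  ∑ a : Fin ℓ, ∑ i, ∑ j, ‖pderiv a (fun γ' => M.gradθ z θ γ' i j) γ‖ₑ ^ 2

/-- `J = E[∇_θ m(Z, θ₀, h₀(X))]`. -/
noncomputable def J (M : MomentModel 𝒵 𝒳 d ℓ) : Matrix (Fin d) (Fin d) ℝ :=
  Matrix.of fun i j => ∫ z, M.gradθ z M.θ₀ (M.h₀ (M.X z)) i j ∂M.law

/-- `V = Cov(m(Z, θ₀, h₀(X)))`. -/
noncomputable def V (M : MomentModel 𝒵 𝒳 d ℓ) : Matrix (Fin d) (Fin d) ℝ :=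
  Matrix.of fun i j =>
    cov[fun z => M.m z M.θ₀ (M.h₀ (M.X z)) i, fun z => M.m z M.θ₀ (M.h₀ (M.X z)) j; M.law]

/-- The sandwich covariance matrix `Σ = J⁻¹ V (J⁻¹)ᵀ`. -/
noncomputable def asympCov (M : MomentModel 𝒵 𝒳 d ℓ) : Matrix (Fin d) (Fin d) ℝ :=
  M.J⁻¹ * M.V * (M.J⁻¹).transpose

/-- The error moment `E[∏ᵢ |hᵢ(X) - h₀ᵢ(X)|^{c αᵢ}]` of a fixed nuisance function `h`. -/
noncomputable def errMoment (M : MomentModel 𝒵 𝒳 d ℓ) (c : ℕ) (α : Fin ℓ → ℕ)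
    (h : 𝒳 → Vec ℓ) : ℝ≥0∞ :=
  ∫⁻ z, ∏ i, ‖h (M.X z) i - M.h₀ (M.X z) i‖ₑ ^ (c * α i) ∂M.law

/-- The norm `‖hᵢ - h₀ᵢ‖_p = E[|hᵢ(X) - h₀ᵢ(X)|^p]^{1/p}` of a fixed nuisance function `h`. -/
noncomputable def errNorm (M : MomentModel 𝒵 𝒳 d ℓ) (p : ℕ) (i : Fin ℓ)
    (h : 𝒳 → Vec ℓ) : ℝ≥0∞ :=
  eLpNorm (fun z => h (M.X z) i - M.h₀ (M.X z) i) (p : ℝ≥0∞) M.law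

/-- The ball `B_{θ₀,r}` in `Θ`. -/
def ballθ (M : MomentModel 𝒵 𝒳 d ℓ) (r : ℝ) : Set (Vec d) :=
  {θ | θ ∈ M.Θ ∧ ‖θ - M.θ₀‖ ≤ r}

/-- The neighbourhood `B_{h₀,r}` in `ℋ`. The multi-index `α = 0`, for which the error moment is
constantly `1`, is left out. -/
def ballh (M : MomentModel 𝒵 𝒳 d ℓ) (k : ℕ) (r : ℝ) : Set (𝒳 → Vec ℓ) :=
  {h | h ∈ M.ℋ ∧ ∀ α : Fin ℓ → ℕ, α ≠ 0 → order α ≤ k + 1 → M.errMoment 2 α h ≤ ENNReal.ofReal r}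

/-- `S`-orthogonality: `E[D^α m(Z, θ₀, h₀(X)) | X] = 0` for all `α ∈ S`. -/
def IsOrthogonal (M : MomentModel 𝒵 𝒳 d ℓ) (S : Set (Fin ℓ → ℕ)) : Prop :=
  ∀ α ∈ S,
    Integrable (fun z => multiDeriv α (M.m z M.θ₀) (M.h₀ (M.X z))) M.law ∧
    M.law[fun z => multiDeriv α (M.m z M.θ₀) (M.h₀ (M.X z)) |
      MeasurableSpace.comap M.X inferInstance] =ᵐ[M.law] 0

/-- Smoothness of the moments: in `(θ, γ)` they are `C^k` (`C¹` if `k = 0`), and the derivatives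
that occur in the regularity conditions (of order `k + 1` in `γ` at `θ₀`, and of order one in `θ`
and one in `γ`) exist. -/
structure IsSmooth (M : MomentModel 𝒵 𝒳 d ℓ) (k : ℕ) : Prop where
  contDiff : ∀ z, ContDiff ℝ (max k 1 : ℕ) fun q : Vec d × Vec ℓ => M.m z q.1 q.2
  differentiable_γ : ∀ z, Differentiable ℝ (iteratedFDeriv ℝ k (M.m z M.θ₀))
  differentiable_θγ : ∀ z θ i j, Differentiable ℝ fun γ => M.gradθ z θ γ i j

/-- Regularity of the moments with radius `r`. -/
structure IsRegular (M : MomentModel 𝒵 𝒳 d ℓ) (k : ℕ) (r : ℝ) : Prop where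
  gradθ_dominated :
    ∫⁻ z, ⨆ θ ∈ M.ballθ r, (M.gradθNormSq z θ (M.h₀ (M.X z))) ^ (1 / 2 : ℝ) ∂M.law < ∞
  gradγθ_bounded :
    ⨆ h ∈ M.ballh k r, ∫⁻ z, ⨆ θ ∈ M.ballθ r, M.gradγθNormSq z θ (h (M.X z)) ∂M.law < ∞
  multiDeriv_bounded :
    ⨆ (α : Fin ℓ → ℕ) (_ : order α ≤ k + 1), ⨆ h ∈ M.ballh k r,
      ∫⁻ z, ‖multiDeriv α (M.m z M.θ₀) (h (M.X z))‖ₑ ^ 4 ∂M.law < ∞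
  moment_dominated : ∀ A ⊆ M.Θ, IsCompact A →
    ∫⁻ z, ⨆ θ ∈ A, ⨆ h ∈ M.ballh k r, ‖M.m z θ (h (M.X z))‖ₑ ∂M.law < ∞
  gradγ_bounded : ∀ A ⊆ M.Θ, IsCompact A →
    ⨆ θ ∈ A, ⨆ h ∈ M.ballh k r, ∫⁻ z, M.gradγNormSq z θ (h (M.X z)) ∂M.law < ∞

/-- The conditions on the moments: `S`-orthogonality, identifiability, non-degeneracy, smoothness
and regularity; `k` is the maximal order of a member of `S`. -/
structure MomentConditions (M : MomentModel 𝒵 𝒳 d ℓ) (S : Set (Fin ℓ → ℕ)) (k : ℕ) : Prop where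
  orthogonal : M.IsOrthogonal S
  identifiable : ∀ θ ∈ M.Θ, θ ≠ M.θ₀ → ∫ z, M.m z θ (M.h₀ (M.X z)) ∂M.law ≠ 0
  nondegenerate : IsUnit M.J
  smooth : M.IsSmooth k
  regular : ∃ r > 0, M.IsRegular k r

/-- Consistency and rate conditions on the first stage estimates, along the filter `l` of sample
sizes. Given `ĥ`, the expectations are over an independent copy of the data vector. The multi-index
`α = 0`, for which the error moment is constantly `1`, is left out. -/
structure FirstStageConditions {Ω : Type*} [MeasurableSpace Ω] (M : MomentModel 𝒵 𝒳 d ℓ)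
    (S : Set (Fin ℓ → ℕ)) (k : ℕ) (P : Measure Ω) (l : Filter ℕ)
    (hhat : ℕ → Ω → 𝒳 → Vec ℓ) : Prop where
  consistent : ∀ α ∈ S, α ≠ 0 →
    TendstoZeroInProb P l fun n ω => M.errMoment 4 α (hhat n ω)
  rate : ∀ α : Fin ℓ → ℕ, α ≠ 0 → order α ≤ k + 1 → α ∉ S →
    TendstoZeroInProb P l fun n ω =>
      (n : ℝ≥0∞) ^ (1 / 2 : ℝ) * (M.errMoment 2 α (hhat n ω)) ^ (1 / 2 : ℝ)

/-- The first stage conditions for `k`-orthogonal moments, in terms of the individual nuisance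
functions: `n^{1/(2k+2)} ‖ĥᵢ - h₀ᵢ‖_{2k+2} → 0` and `‖ĥᵢ - h₀ᵢ‖_{4k} → 0` in probability (for
`k = 0` the second condition is void). -/
structure SimpleFirstStageConditions {Ω : Type*} [MeasurableSpace Ω] (M : MomentModel 𝒵 𝒳 d ℓ)
    (k : ℕ) (P : Measure Ω) (l : Filter ℕ) (hhat : ℕ → Ω → 𝒳 → Vec ℓ) : Prop where
  rate : ∀ i : Fin ℓ,
    TendstoZeroInProb P l fun n ω =>
      (n : ℝ≥0∞) ^ (1 / (2 * (k : ℝ) + 2)) * M.errNorm (2 * k + 2) i (hhat n ω)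
  consistent : ∀ i : Fin ℓ,
    TendstoZeroInProb P l fun n ω => M.errNorm (4 * k) i (hhat n ω)

end MomentModel

/-- `Z₀, Z₁, …` are independent replicates of a random vector with distribution `law`. -/
structure IsIIDSample {𝒵 Ω : Type*} [MeasurableSpace 𝒵] [MeasurableSpace Ω]
    (law : Measure 𝒵) (P : Measure Ω) (Z : ℕ → Ω → 𝒵) : Prop where
  measurable : ∀ t, Measurable (Z t)
  indep : iIndepFun Z P
  map_eq : ∀ t, P.map (Z t) = law

/-- The sample-splitting procedure, as functions of the data: for each `n`, a first stage estimate
computed from the second half of a sample of size `2n`, and a second stage estimate. -/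
structure SampleSplitting {𝒵 𝒳 : Type*} [MeasurableSpace 𝒵] [MeasurableSpace 𝒳] {d ℓ : ℕ}
    (M : MomentModel 𝒵 𝒳 d ℓ) where
  /-- the first stage estimate -/
  hhat : ∀ n : ℕ, (Fin n → 𝒵) → 𝒳 → Vec ℓ
  hhat_mem : ∀ n w, hhat n w ∈ M.ℋ
  measurable_hhat : ∀ n, Measurable fun q : (Fin n → 𝒵) × 𝒳 => hhat n q.1 q.2
  /-- the second stage estimate -/
  θhat : ∀ n : ℕ, (Fin (2 * n) → 𝒵) → Vec d
  measurable_θhat : ∀ n, Measurable (θhat n)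

namespace SampleSplitting

variable {𝒵 𝒳 Ω : Type*} [MeasurableSpace 𝒵] [MeasurableSpace 𝒳] {d ℓ : ℕ}
  {M : MomentModel 𝒵 𝒳 d ℓ}

/-- The first stage estimate, computed from the sample points `n, …, 2n - 1`. -/
def firstStage (E : SampleSplitting M) (Z : ℕ → Ω → 𝒵) (n : ℕ) (ω : Ω) : 𝒳 → Vec ℓ :=
  E.hhat n fun t => Z (n + t) ω

/-- The estimate `θ̂_SS`. -/
def estimate (E : SampleSplitting M) (Z : ℕ → Ω → 𝒵) (n : ℕ) (ω : Ω) : Vec d :=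
  E.θhat n fun t => Z t ω

/-- The empirical moments over the sample points `0, …, n - 1`. -/
noncomputable def empMoment (E : SampleSplitting M) (Z : ℕ → Ω → 𝒵) (n : ℕ) (ω : Ω) (θ : Vec d) :
    Vec d :=
  (n : ℝ)⁻¹ • ∑ t : Fin n, M.m (Z t ω) θ (E.firstStage Z n ω (M.X (Z t ω)))

/-- With probability tending to one, `θ̂_SS ∈ Θ` solves the empirical moment equations. -/
def Solves [MeasurableSpace Ω] (E : SampleSplitting M) (P : Measure Ω) (Z : ℕ → Ω → 𝒵) : Prop :=
  Tendsto (fun n => P {ω | ¬ (E.estimate Z n ω ∈ M.Θ ∧ E.empMoment Z n ω (E.estimate Z n ω) = 0)})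
    atTop (𝓝 0)

/-- `θ̂_SS` is consistent. -/
def Consistent [MeasurableSpace Ω] (E : SampleSplitting M) (P : Measure Ω) (Z : ℕ → Ω → 𝒵) :
    Prop :=
  TendstoInMeasure P (E.estimate Z) atTop fun _ => M.θ₀

end SampleSplitting

/-- The `K`-fold cross-fitting procedure, as functions of the data: for each `n`, a partition of the
sample points `0, …, 2n - 1` into `K` folds (of equal size if `K` divides `2n`), for each fold a
first stage estimate computed from the sample points outside the fold, and a second stage
estimate. -/
structure CrossFitting {𝒵 𝒳 : Type*} [MeasurableSpace 𝒵] [MeasurableSpace 𝒳] {d ℓ : ℕ}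
    (M : MomentModel 𝒵 𝒳 d ℓ) (K : ℕ) where
  /-- the fold that contains a sample point -/
  fold : ∀ n : ℕ, Fin (2 * n) → Fin K
  card_fold : ∀ n, K ∣ 2 * n → ∀ j, (Finset.univ.filter fun t => fold n t = j).card = 2 * n / K
  /-- the first stage estimate for a fold -/
  hhat : ∀ (n : ℕ) (j : Fin K), ({t : Fin (2 * n) // fold n t ≠ j} → 𝒵) → 𝒳 → Vec ℓ
  hhat_mem : ∀ n j w, hhat n j w ∈ M.ℋ
  measurable_hhat : ∀ n j,
    Measurable fun q : ({t : Fin (2 * n) // fold n t ≠ j} → 𝒵) × 𝒳 => hhat n j q.1 q.2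
  /-- the second stage estimate -/
  θhat : ∀ n : ℕ, (Fin (2 * n) → 𝒵) → Vec d
  measurable_θhat : ∀ n, Measurable (θhat n)

/-- `n → ∞` along those `n` for which `K` divides `2n`. -/
def foldFilter (K : ℕ) : Filter ℕ := atTop ⊓ 𝓟 {n | K ∣ 2 * n}

namespace CrossFitting

variable {𝒵 𝒳 Ω : Type*} [MeasurableSpace 𝒵] [MeasurableSpace 𝒳] {d ℓ K : ℕ}
  {M : MomentModel 𝒵 𝒳 d ℓ}

/-- The first stage estimate for the fold `j`, computed from the sample points outside it. -/
def firstStage (E : CrossFitting M K) (Z : ℕ → Ω → 𝒵) (j : Fin K) (n : ℕ) (ω : Ω) : 𝒳 → Vec ℓ :=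
  E.hhat n j fun t => Z t.1 ω

/-- The estimate `θ̂_CF`. -/
def estimate (E : CrossFitting M K) (Z : ℕ → Ω → 𝒵) (n : ℕ) (ω : Ω) : Vec d :=
  E.θhat n fun t => Z t ω

/-- The empirical moments over the whole sample, with the first stage estimate of the fold `j`
plugged in at the sample points of the fold `j`. -/
noncomputable def empMoment (E : CrossFitting M K) (Z : ℕ → Ω → 𝒵) (n : ℕ) (ω : Ω) (θ : Vec d) :
    Vec d :=
  (2 * n : ℝ)⁻¹ • ∑ j : Fin K, ∑ t ∈ Finset.univ.filter (fun t => E.fold n t = j),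
    M.m (Z t ω) θ (E.firstStage Z j n ω (M.X (Z t ω)))

/-- With probability tending to one, `θ̂_CF ∈ Θ` solves the empirical moment equations. -/
def Solves [MeasurableSpace Ω] (E : CrossFitting M K) (P : Measure Ω) (Z : ℕ → Ω → 𝒵) : Prop :=
  Tendsto (fun n => P {ω | ¬ (E.estimate Z n ω ∈ M.Θ ∧ E.empMoment Z n ω (E.estimate Z n ω) = 0)})
    (foldFilter K) (𝓝 0)

/-- `θ̂_CF` is consistent. -/
def Consistent [MeasurableSpace Ω] (E : CrossFitting M K) (P : Measure Ω) (Z : ℕ → Ω → 𝒵) :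
    Prop :=
  TendstoInMeasure P (E.estimate Z) (foldFilter K) fun _ => M.θ₀

end CrossFitting

end OrthogonalML

/-! Put N for the number of sample points that enter the moment equation (n or 2n). Linearizing the
equation in θ gives √N(θ̂ - θ₀) = -J⁻¹(score + R) + error. Here the score is the scaled sum of
m(Z_t, θ₀, h₀(X_t)), and R is the effect at θ₀ of replacing h₀ by the first stage estimate. The
central limit theorem handles the score, so the task is to show that R and the error vanish in
probability.

For R, the moments are expanded in γ around h₀ to order k. A term whose multi-index lies in S is a
function of X times a derivative with conditional mean zero. Given the independent first stage data,
its summands are therefore i.i.d. and centred, and the scaled sum has conditional variance of the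
order of the square root of a fourth-type error moment: consistency suffices, without a rate. A term
outside S is bounded in mean by Cauchy–Schwarz, and the rate condition beats the factor √n. The
remainder involves only multi-indices of order k + 1, which are outside S. Carriers:
`enorm_multivariate_taylor_le`, `integral_taylorTerm_eq_zero`, `FoldScheme.tendsto_moment_diff`.

For the error, the Jacobian averaged along the segment from θ₀ to θ̂ differs from J by at most
`linModulus`. That modulus collects the change from h₀ to ĥ, the oscillation near θ₀ and a law of
large numbers. It tends to zero given consistency of θ̂ alone, and absorbing half of the deviation
from the linear approximation then yields the √N rate (`FoldScheme.enorm_sub_linear_le`).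

Both estimators are instances of `FoldScheme`: all that matters is that each fold is independent of
the data behind its own nuisance estimate. The folds are added up by the triangle inequality, so
dependence between them is harmless. Error quantities take values in `ℝ≥0∞`, where bounds need no
integrability side conditions. -/

namespace OrthogonalML

/-! ### Convergence to zero in probability. -/

section TendstoZeroInProb

variable {Ω : Type*} [MeasurableSpace Ω] {P : Measure Ω} {l : Filter ℕ} {f g : ℕ → Ω → ℝ≥0∞}

/-- Serves to restrict attention to events of probability tending to one, such as that of the first
stage estimate lying in `ballh`. The exceptional sets need not be measurable. -/
theorem TendstoZeroInProb.mono_of_event (hg : TendstoZeroInProb P l g) {B : ℕ → Set Ω}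
    (hB : Tendsto (fun n => P (B n)) l (𝓝 0)) (h : ∀ᶠ n in l, ∀ ω ∉ B n, f n ω ≤ g n ω) :
    TendstoZeroInProb P l f := by
  intro ε hε
  have h1 := (hg ε hε).add hB
  rw [add_zero] at h1
  refine tendsto_of_tendsto_of_tendsto_of_le_of_le' tendsto_const_nhds h1
    (Eventually.of_forall fun _ => zero_le) ?_
  filter_upwards [h] with n hn
  refine (measure_mono ?_).trans (measure_union_le _ _)
  intro ω hω
  by_cases hb : ω ∈ B n
  · exact Or.inr hb
  · exact Or.inl (le_trans hω (hn ω hb))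

theorem TendstoZeroInProb.mono (hg : TendstoZeroInProb P l g)
    (h : ∀ᶠ n in l, ∀ ω, f n ω ≤ g n ω) : TendstoZeroInProb P l f :=
  hg.mono_of_event (B := fun _ => ∅) (by simpa using tendsto_const_nhds) (by simpa using h)

theorem TendstoZeroInProb.of_tendsto_zero {a : ℕ → ℝ≥0∞} (ha : Tendsto a l (𝓝 0)) :
    TendstoZeroInProb P l fun n _ => a n := by
  intro ε hε
  have h0 : ∀ᶠ n in l, a n < ε := ha.eventually (gt_mem_nhds hε)
  refine tendsto_const_nhds.congr' ?_
  filter_upwards [h0] with n hn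
  simp [not_le.2 hn]

theorem TendstoZeroInProb.zero : TendstoZeroInProb P l fun _ _ => (0 : ℝ≥0∞) :=
  .of_tendsto_zero (a := fun _ => 0) tendsto_const_nhds

theorem TendstoZeroInProb.add (hf : TendstoZeroInProb P l f) (hg : TendstoZeroInProb P l g) :
    TendstoZeroInProb P l fun n ω => f n ω + g n ω := by
  intro ε hε
  have hε2 : 0 < ε / 2 := ENNReal.half_pos hε.ne'
  have h1 := (hf _ hε2).add (hg _ hε2)
  rw [add_zero] at h1
  refine tendsto_of_tendsto_of_tendsto_of_le_of_le tendsto_const_nhds h1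
    (fun _ => zero_le) fun n => ?_
  refine (measure_mono ?_).trans (measure_union_le _ _)
  intro ω hω
  by_contra hc
  simp only [Set.mem_union, Set.mem_ofPred_eq, not_or, not_le] at hc hω
  have := ENNReal.add_lt_add hc.1 hc.2
  rw [ENNReal.add_halves] at this
  exact absurd hω (not_le.2 this)

theorem TendstoZeroInProb.sum {κ : Type*} (s : Finset κ) {f : κ → ℕ → Ω → ℝ≥0∞}
    (hf : ∀ i ∈ s, TendstoZeroInProb P l (f i)) :
    TendstoZeroInProb P l fun n ω => ∑ i ∈ s, f i n ω := by
  classical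
  induction s using Finset.induction_on with
  | empty => simpa using TendstoZeroInProb.zero
  | insert a s ha ih =>
    simp only [Finset.sum_insert ha]
    exact (hf a (by simp)).add (ih fun i hi => hf i (by simp [hi]))

/-- Continuous mapping at zero. -/
theorem TendstoZeroInProb.comp_tendsto (hf : TendstoZeroInProb P l f) {φ : ℝ≥0∞ → ℝ≥0∞}
    (hφ : Tendsto φ (𝓝 0) (𝓝 0)) : TendstoZeroInProb P l fun n ω => φ (f n ω) := by
  intro ε hε
  have h0 : ∀ᶠ x in 𝓝 (0 : ℝ≥0∞), φ x < ε := hφ.eventually (gt_mem_nhds hε)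
  obtain ⟨δ, hδ, hδε⟩ := ENNReal.nhds_zero_basis.eventually_iff.1 h0
  refine tendsto_of_tendsto_of_tendsto_of_le_of_le tendsto_const_nhds (hf δ hδ)
    (fun _ => zero_le) fun n => measure_mono fun ω hω => ?_
  by_contra hc
  simp only [Set.mem_ofPred_eq, not_le] at hc hω
  exact absurd hω (not_le.2 (hδε hc))

theorem TendstoZeroInProb.const_mul (hf : TendstoZeroInProb P l f) {c : ℝ≥0∞} (hc : c ≠ ∞) :
    TendstoZeroInProb P l fun n ω => c * f n ω := by
  refine hf.comp_tendsto (φ := fun x => c * x) ?_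
  simpa using ENNReal.Tendsto.const_mul (a := c) (b := 0) tendsto_id (Or.inr hc)

theorem TendstoZeroInProb.rpow (hf : TendstoZeroInProb P l f) {p : ℝ} (hp : 0 < p) :
    TendstoZeroInProb P l fun n ω => f n ω ^ p := by
  refine hf.comp_tendsto (φ := fun x => x ^ p) ?_
  have := (ENNReal.continuous_rpow_const (y := p)).tendsto 0
  rwa [ENNReal.zero_rpow_of_pos hp] at this

theorem TendstoZeroInProb.pow (hf : TendstoZeroInProb P l f) {p : ℕ} (hp : p ≠ 0) :
    TendstoZeroInProb P l fun n ω => f n ω ^ p := by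
  refine (hf.rpow (p := p) (by positivity)).mono (Eventually.of_forall fun _ _ => ?_)
  rw [ENNReal.rpow_natCast]

theorem TendstoZeroInProb.tendsto_measure_not (hf : TendstoZeroInProb P l f) {r : ℝ≥0∞}
    (hr : 0 < r) : Tendsto (fun n => P {ω | ¬ f n ω ≤ r}) l (𝓝 0) :=
  tendsto_of_tendsto_of_tendsto_of_le_of_le tendsto_const_nhds (hf r hr)
    (fun _ => zero_le) fun _ => measure_mono fun _ hω => (not_le.1 hω).le

theorem tendsto_measure_biUnion_zero {κ : Type*} (s : Finset κ) {B : κ → ℕ → Set Ω}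
    (hB : ∀ i ∈ s, Tendsto (fun n => P (B i n)) l (𝓝 0)) :
    Tendsto (fun n => P (⋃ i ∈ s, B i n)) l (𝓝 0) := by
  have h : Tendsto (fun n => ∑ i ∈ s, P (B i n)) l (𝓝 0) := by
    simpa using tendsto_finsetSum s hB
  exact tendsto_of_tendsto_of_tendsto_of_le_of_le tendsto_const_nhds h
    (fun _ => zero_le) fun n => measure_biUnion_finset_le _ _

/-- The product with a sequence that is bounded in mean tends to zero. -/
theorem TendstoZeroInProb.mul_of_lintegral_le (hf : TendstoZeroInProb P l f)
    (hgm : ∀ n, AEMeasurable (g n) P) {C : ℝ≥0∞} (hC : C ≠ ∞) (hg : ∀ n, ∫⁻ ω, g n ω ∂P ≤ C) :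
    TendstoZeroInProb P l fun n ω => f n ω * g n ω := by
  intro ε hε
  rw [ENNReal.tendsto_nhds_zero]
  intro η hη
  wlog hηt : η ≠ ∞ generalizing η
  · filter_upwards [this 1 one_pos (by simp)] with n hn
    simp only [ne_eq, not_not] at hηt
    simp [hηt]
  -- Markov's inequality needs a finite threshold; the event for threshold ∞ lies in the event for
  -- threshold 1.
  wlog hεt : ε ≠ ∞ generalizing ε
  · filter_upwards [this 1 one_pos (by simp)] with n hn
    refine (measure_mono fun ω hω => ?_).trans hn
    simp only [ne_eq, not_not] at hεt
    simp only [hεt, Set.mem_ofPred_eq, top_le_iff] at hω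
    simp [hω]
  have hη2 : 0 < η / 2 := ENNReal.half_pos hη.ne'
  have hη2t : η / 2 ≠ ∞ := ENNReal.div_ne_top hηt (by simp)
  -- Markov's inequality bounds the probability of `R ≤ g n` by C / R ≤ η / 2; the summand 1 keeps R
  -- positive when C = 0.
  set R : ℝ≥0∞ := (C + 1) / (η / 2) with hR
  have hC1 : C + 1 ≠ ∞ := by simp [hC]
  have hRt : R ≠ ∞ := ENNReal.div_ne_top hC1 hη2.ne'
  have hR0 : R ≠ 0 := by
    rw [hR, Ne, ENNReal.div_eq_zero_iff]; simp [hη2t]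
  filter_upwards [(ENNReal.tendsto_nhds_zero.1 (hf (ε / R) (ENNReal.div_pos hε.ne' hRt)))
    (η / 2) hη2] with n hn
  calc P {ω | ε ≤ f n ω * g n ω} ≤ P ({ω | ε / R ≤ f n ω} ∪ {ω | R ≤ g n ω}) := by
        refine measure_mono fun ω hω => ?_
        by_contra hc
        simp only [Set.mem_union, Set.mem_ofPred_eq, not_or, not_le] at hc hω
        have h1 : f n ω * g n ω < ε / R * R := ENNReal.mul_lt_mul hc.1 hc.2
        rw [ENNReal.div_mul_cancel hR0 hRt] at h1
        exact absurd hω (not_le.2 h1)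
    _ ≤ P {ω | ε / R ≤ f n ω} + P {ω | R ≤ g n ω} := measure_union_le _ _
    _ ≤ η / 2 + η / 2 := by
        gcongr
        refine (meas_ge_le_lintegral_div (hgm n) hR0 hRt).trans ?_
        refine ENNReal.div_le_of_le_mul ?_
        rw [hR, ENNReal.mul_div_cancel hη2.ne' hη2t]
        exact (hg n).trans (by simp)
    _ = η := ENNReal.add_halves η

/-- Convergence to zero in mean, conditionally on the independent vectors `W n`, implies convergence
to zero in probability. -/
theorem TendstoZeroInProb.of_lintegral_indep [IsProbabilityMeasure P]
    {𝒰 𝒲 : ℕ → Type*} [∀ n, MeasurableSpace (𝒰 n)] [∀ n, MeasurableSpace (𝒲 n)]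
    {U : ∀ n, Ω → 𝒰 n} {W : ∀ n, Ω → 𝒲 n} (hU : ∀ n, Measurable (U n))
    (hW : ∀ n, Measurable (W n)) (hUW : ∀ n, IndepFun (U n) (W n) P)
    {F : ∀ n, 𝒰 n × 𝒲 n → ℝ≥0∞} (hF : ∀ n, Measurable (F n))
    (h : TendstoZeroInProb P l fun n ω => ∫⁻ u, F n (u, W n ω) ∂(P.map (U n))) :
    TendstoZeroInProb P l fun n ω => F n (U n ω, W n ω) := by
  intro ε hε
  rw [ENNReal.tendsto_nhds_zero]
  intro η hη
  wlog hηt : η ≠ ∞ generalizing η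
  · filter_upwards [this 1 one_pos (by simp)] with n hn
    simp only [ne_eq, not_not] at hηt
    simp [hηt]
  wlog hεt : ε ≠ ∞ generalizing ε
  · filter_upwards [this 1 one_pos (by simp)] with n hn
    refine (measure_mono fun ω hω => ?_).trans hn
    simp only [ne_eq, not_not] at hεt
    simp only [hεt, Set.mem_ofPred_eq, top_le_iff] at hω
    simp [hω]
  have hη2 : 0 < η / 2 := ENNReal.half_pos hη.ne'
  -- Chosen so that Markov's inequality at level ε turns a mean of at most δ into a probability of
  -- at most η / 2.
  set δ : ℝ≥0∞ := ε * (η / 2) with hδ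
  have hδ0 : 0 < δ := ENNReal.mul_pos hε.ne' hη2.ne'
  filter_upwards [(ENNReal.tendsto_nhds_zero.1 (h δ hδ0)) (η / 2) hη2] with n hn
  set κ : 𝒲 n → ℝ≥0∞ := fun w => ∫⁻ u, F n (u, w) ∂(P.map (U n)) with hκ
  have : IsProbabilityMeasure (P.map (U n)) :=
    Measure.isProbabilityMeasure_map (hU n).aemeasurable
  have hκm : Measurable κ := (hF n).lintegral_prod_left'
  -- Truncation: F is kept only where its conditional mean is below δ. By Tonelli on the product
  -- law, G has mean at most δ, and F differs from G only on an event of small probability.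
  set G : 𝒰 n × 𝒲 n → ℝ≥0∞ := fun q => {w | κ w < δ}.indicator 1 q.2 * F n q with hG
  have hs : MeasurableSet {w | κ w < δ} := measurableSet_lt hκm measurable_const
  have hGm : Measurable G := ((measurable_one.indicator hs).comp measurable_snd).mul (hF n)
  have hmap : P.map (fun ω => (U n ω, W n ω)) = (P.map (U n)).prod (P.map (W n)) :=
    (indepFun_iff_map_prod_eq_prod_map_map (hU n).aemeasurable (hW n).aemeasurable).1 (hUW n)
  have hint : ∫⁻ ω, G (U n ω, W n ω) ∂P ≤ δ := by
    have : IsProbabilityMeasure (P.map (W n)) :=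
      Measure.isProbabilityMeasure_map (hW n).aemeasurable
    rw [← lintegral_map (f := G) (g := fun ω => (U n ω, W n ω)) hGm ((hU n).prodMk (hW n)), hmap,
      lintegral_prod_symm' _ hGm]
    calc ∫⁻ w, ∫⁻ u, G (u, w) ∂(P.map (U n)) ∂(P.map (W n))
        ≤ ∫⁻ _, δ ∂(P.map (W n)) := by
          refine lintegral_mono fun w => ?_
          simp only [hG]
          by_cases hw : κ w < δ
          · simp only [Set.indicator, Set.mem_ofPred_eq, hw, if_true, Pi.one_apply, one_mul]
            exact hw.le
          · simp [Set.indicator, hw]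
      _ = δ := by simp
  calc P {ω | ε ≤ F n (U n ω, W n ω)}
      ≤ P ({ω | δ ≤ κ (W n ω)} ∪ {ω | ε ≤ G (U n ω, W n ω)}) := by
        refine measure_mono fun ω hω => ?_
        by_cases hc : κ (W n ω) < δ
        · right
          simpa [hG, Set.indicator, hc] using hω
        · left
          exact not_lt.1 hc
    _ ≤ P {ω | δ ≤ κ (W n ω)} + P {ω | ε ≤ G (U n ω, W n ω)} := measure_union_le _ _
    _ ≤ η / 2 + η / 2 := by
        gcongr
        refine (meas_ge_le_lintegral_div
          (hGm.comp ((hU n).prodMk (hW n))).aemeasurable hε.ne' hεt).trans ?_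
        refine ENNReal.div_le_of_le_mul ?_
        rw [mul_comm]
        exact hint
    _ = η := ENNReal.add_halves η

end TendstoZeroInProb
-- Sums over an i.i.d. sample, conditionally on independent data.
section IIDSample

variable {𝒵 Ω : Type*} [MeasurableSpace 𝒵] [MeasurableSpace Ω] {law : Measure 𝒵} {P : Measure Ω}
  {Z : ℕ → Ω → 𝒵}

/-- The part of the sample with indices in `A`. -/
def subsample (Z : ℕ → Ω → 𝒵) (A : Finset ℕ) (ω : Ω) : A → 𝒵 := fun t => Z t ω

theorem IsIIDSample.measurable_subsample (hZ : IsIIDSample law P Z) (A : Finset ℕ) :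
    Measurable (subsample Z A) :=
  measurable_pi_lambda _ fun t => hZ.measurable t

theorem IsIIDSample.indepFun_subsample (hZ : IsIIDSample law P Z) {A B : Finset ℕ}
    (h : Disjoint A B) : IndepFun (subsample Z A) (subsample Z B) P :=
  hZ.indep.indepFun_finset A B h hZ.measurable

theorem IsIIDSample.lintegral_comp (hZ : IsIIDSample law P Z) {f : 𝒵 → ℝ≥0∞} (hf : Measurable f)
    (t : ℕ) : ∫⁻ ω, f (Z t ω) ∂P = ∫⁻ z, f z ∂law := by
  rw [← lintegral_map hf (hZ.measurable t), hZ.map_eq]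

theorem IsIIDSample.integral_comp (hZ : IsIIDSample law P Z) {f : 𝒵 → ℝ} (hf : Measurable f)
    (t : ℕ) : ∫ ω, f (Z t ω) ∂P = ∫ z, f z ∂law := by
  rw [← integral_map (φ := Z t) (f := f) (hZ.measurable t).aemeasurable
    hf.aestronglyMeasurable, hZ.map_eq]

theorem IsIIDSample.memLp_comp (hZ : IsIIDSample law P Z) {E : Type*} [NormedAddCommGroup E]
    {f : 𝒵 → E} {p : ℝ≥0∞} (hf : MemLp f p law) (t : ℕ) : MemLp (fun ω => f (Z t ω)) p P := by
  rw [← hZ.map_eq t] at hf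
  exact hf.comp_of_map (hZ.measurable t).aemeasurable

theorem IsIIDSample.identDistrib_comp (hZ : IsIIDSample law P Z) {E : Type*} [MeasurableSpace E]
    {f : 𝒵 → E} (hf : Measurable f) (t : ℕ) :
    IdentDistrib (fun ω => f (Z t ω)) (fun ω => f (Z 0 ω)) P P := by
  refine ⟨(hf.comp (hZ.measurable t)).aemeasurable, (hf.comp (hZ.measurable 0)).aemeasurable, ?_⟩
  have h (t : ℕ) : P.map (fun ω => f (Z t ω)) = law.map f := by
    rw [← hZ.map_eq t, Measure.map_map hf (hZ.measurable t)]; rfl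
  rw [h, h]

theorem IsIIDSample.lintegral_sum (hZ : IsIIDSample law P Z) {f : 𝒵 → ℝ≥0∞} (hf : Measurable f)
    (A : Finset ℕ) : ∫⁻ ω, ∑ t ∈ A, f (Z t ω) ∂P = A.card * ∫⁻ z, f z ∂law := by
  have h (t : ℕ) : AEMeasurable (fun ω => f (Z t ω)) P := (hf.comp (hZ.measurable t)).aemeasurable
  rw [lintegral_finsetSum' _ fun t _ => h t]
  simp [hZ.lintegral_comp hf]

/-- Second moments of centred variables are variances, and these add up under pairwise independence.
-/
theorem IsIIDSample.lintegral_sum_sq [IsProbabilityMeasure P] (hZ : IsIIDSample law P Z)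
    {f : 𝒵 → ℝ} (hf : Measurable f) (h2 : MemLp f 2 law) (h0 : ∫ z, f z ∂law = 0) (A : Finset ℕ) :
    ∫⁻ ω, ‖∑ t ∈ A, f (Z t ω)‖ₑ ^ 2 ∂P = A.card * ∫⁻ z, ‖f z‖ₑ ^ 2 ∂law := by
  have hL (t : ℕ) : MemLp (fun ω => f (Z t ω)) 2 P := hZ.memLp_comp h2 t
  have hS : MemLp (fun ω => ∑ t ∈ A, f (Z t ω)) 2 P := memLp_finsetSum A fun t _ => hL t
  have hvar (g : Ω → ℝ) (hg : MemLp g 2 P) (hg0 : ∫ ω, g ω ∂P = 0) :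
      ∫⁻ ω, ‖g ω‖ₑ ^ 2 ∂P = ENNReal.ofReal Var[g; P] := by
    rw [hg.ofReal_variance_eq, evariance, hg0]
    simp
  have hm (t : ℕ) : ∫ ω, f (Z t ω) ∂P = 0 := by rw [hZ.integral_comp hf, h0]
  have hsum0 : ∫ ω, ∑ t ∈ A, f (Z t ω) ∂P = 0 := by
    rw [integral_finsetSum _ fun t _ => (hL t).integrable (by norm_num)]
    simp [hm]
  have hind : Set.Pairwise (A : Set ℕ)
      fun s t => IndepFun (fun ω => f (Z s ω)) (fun ω => f (Z t ω)) P :=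
    fun s _ t _ hst => (hZ.indep.indepFun hst).comp hf hf
  have hV := IndepFun.variance_sum (fun t _ => hL t) hind
  rw [hvar _ hS hsum0]
  have he : (∑ t ∈ A, fun ω => f (Z t ω)) = fun ω => ∑ t ∈ A, f (Z t ω) := by
    ext ω; simp
  rw [he] at hV
  rw [hV, ENNReal.ofReal_sum_of_nonneg fun t _ => variance_nonneg _ _]
  have (t : ℕ) : ENNReal.ofReal Var[fun ω => f (Z t ω); P] = ∫⁻ z, ‖f z‖ₑ ^ 2 ∂law := by
    rw [← hvar _ (hL t) (hm t), hZ.lintegral_comp (f := fun z => ‖f z‖ₑ ^ 2) (by fun_prop)]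
  simp [this]

theorem enorm_sq_eq_sum {d : ℕ} (x : Vec d) : ‖x‖ₑ ^ 2 = ∑ i, ‖x i‖ₑ ^ 2 := by
  have h : ‖x‖ ^ 2 = ∑ i, ‖x i‖ ^ 2 := EuclideanSpace.norm_sq_eq x
  simp only [← ofReal_norm, ← ENNReal.ofReal_pow (norm_nonneg _)]
  rw [h, ENNReal.ofReal_sum_of_nonneg fun i _ => by positivity]

theorem measurable_coord {d : ℕ} (i : Fin d) : Measurable fun x : Vec d => x i := by fun_prop

theorem IsIIDSample.lintegral_norm_sum_sq [IsProbabilityMeasure P] (hZ : IsIIDSample law P Z)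
    {d : ℕ} {f : 𝒵 → Vec d} (hf : Measurable f) (h2 : ∫⁻ z, ‖f z‖ₑ ^ 2 ∂law ≠ ∞)
    (h0 : ∫ z, f z ∂law = 0) (A : Finset ℕ) :
    ∫⁻ ω, ‖∑ t ∈ A, f (Z t ω)‖ₑ ^ 2 ∂P = A.card * ∫⁻ z, ‖f z‖ₑ ^ 2 ∂law := by
  have hprob : IsProbabilityMeasure law := by
    rw [← hZ.map_eq 0]; exact Measure.isProbabilityMeasure_map (hZ.measurable 0).aemeasurable
  have hL : MemLp f 2 law := by
    refine ⟨hf.aestronglyMeasurable, ?_⟩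
    rw [eLpNorm_lt_top_iff_lintegral_rpow_enorm_lt_top (by norm_num) (by norm_num)]
    simpa using h2.lt_top
  have hLi (i : Fin d) : MemLp (fun z => f z i) 2 law :=
    hL.of_le ((measurable_coord i).comp hf).aestronglyMeasurable
      (Eventually.of_forall fun z => PiLp.norm_apply_le (f z) i)
  have h0i (i : Fin d) : ∫ z, f z i ∂law = 0 := by
    have := ContinuousLinearMap.integral_comp_comm (EuclideanSpace.proj (𝕜 := ℝ) i)
      (hL.integrable (by norm_num))
    rw [h0] at this
    simpa using this
  simp only [enorm_sq_eq_sum]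
  rw [lintegral_finsetSum' _ fun i _ => ?_, lintegral_finsetSum' _ fun i _ => ?_, Finset.mul_sum]
  · refine Finset.sum_congr rfl fun i _ => ?_
    have := hZ.lintegral_sum_sq ((measurable_coord i).comp hf) (hLi i) (h0i i) A
    simpa only [WithLp.ofLp_sum, Finset.sum_apply, Function.comp_apply] using this
  · have := (measurable_coord i).comp hf
    exact (by fun_prop : Measurable fun z => ‖f z i‖ₑ ^ 2).aemeasurable
  · have h1 (t : ℕ) : Measurable fun ω => f (Z t ω) := hf.comp (hZ.measurable t)
    have : Measurable fun ω => ∑ t ∈ A, f (Z t ω) := Finset.measurable_fun_sum _ fun t _ => h1 t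
    have := (measurable_coord i).comp this
    exact (this.enorm.pow_const 2).aemeasurable

theorem IsIIDSample.lintegral_map_subsample (hZ : IsIIDSample law P Z) (A : Finset ℕ)
    {F : (A → 𝒵) → ℝ≥0∞} (hF : Measurable F) :
    ∫⁻ u, F u ∂(P.map (subsample Z A)) = ∫⁻ ω, F (subsample Z A ω) ∂P :=
  lintegral_map hF (hZ.measurable_subsample A)

variable {l : Filter ℕ} [IsProbabilityMeasure P] {𝒲 : ℕ → Type*} [∀ n, MeasurableSpace (𝒲 n)]
  {W : ∀ n, Ω → 𝒲 n} {A : ℕ → Finset ℕ}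

/-- Sums of a nonnegative function that depends on independent data tend to zero in probability
if their conditional means do. -/
theorem IsIIDSample.tendstoZeroInProb_sum (hZ : IsIIDSample law P Z) (hW : ∀ n, Measurable (W n))
    (hAW : ∀ n, IndepFun (subsample Z (A n)) (W n) P) {F : ∀ n, 𝒵 × 𝒲 n → ℝ≥0∞}
    (hF : ∀ n, Measurable (F n)) {c : ℕ → ℝ≥0∞}
    (h : TendstoZeroInProb P l fun n ω =>
      c n * ((A n).card * ∫⁻ z, F n (z, W n ω) ∂law)) :
    TendstoZeroInProb P l fun n ω => c n * ∑ t ∈ A n, F n (Z t ω, W n ω) := by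
  have hm (n : ℕ) : Measurable fun q : (A n → 𝒵) × 𝒲 n =>
      c n * ∑ t : A n, F n (q.1 t, q.2) := by
    refine Measurable.const_mul (Finset.measurable_fun_sum _ fun t _ => (hF n).comp ?_) _
    exact ((measurable_pi_apply t).comp measurable_fst).prodMk measurable_snd
  have := TendstoZeroInProb.of_lintegral_indep (P := P) (l := l)
    (fun n => hZ.measurable_subsample (A n)) hW hAW hm (h.mono (Eventually.of_forall fun n ω => ?_))
  · refine this.mono (Eventually.of_forall fun n ω => ?_)
    simp only [subsample]
    rw [Finset.sum_coe_sort (A n) (fun t => F n (Z t ω, W n ω))]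
  · have hFw : Measurable fun z => F n (z, W n ω) := (hF n).comp measurable_prodMk_right
    have hm' : Measurable fun u : A n → 𝒵 => c n * ∑ t : A n, F n (u t, W n ω) :=
      (hm n).comp measurable_prodMk_right
    rw [hZ.lintegral_map_subsample (A n) hm']
    simp only [subsample]
    simp_rw [fun η => Finset.sum_coe_sort (A n) (fun t => F n (Z t η, W n ω))]
    rw [lintegral_const_mul, hZ.lintegral_sum hFw]
    exact Finset.measurable_fun_sum _ fun t _ => hFw.comp (hZ.measurable t)

/-- Sums of a function that depends on independent data, and whose conditional mean is zero, tend to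
zero in probability if their conditional variances do. -/
theorem IsIIDSample.tendstoZeroInProb_norm_sum (hZ : IsIIDSample law P Z)
    (hW : ∀ n, Measurable (W n)) (hAW : ∀ n, IndepFun (subsample Z (A n)) (W n) P) {d : ℕ}
    {F : ∀ n, 𝒵 × 𝒲 n → Vec d} (hF : ∀ n, Measurable (F n))
    (h0 : ∀ n w, ∫⁻ z, ‖F n (z, w)‖ₑ ^ 2 ∂law ≠ ∞ → ∫ z, F n (z, w) ∂law = 0) {c : ℕ → ℝ≥0∞}
    (h : TendstoZeroInProb P l fun n ω =>
      c n ^ 2 * ((A n).card * ∫⁻ z, ‖F n (z, W n ω)‖ₑ ^ 2 ∂law)) :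
    TendstoZeroInProb P l fun n ω => c n * ‖∑ t ∈ A n, F n (Z t ω, W n ω)‖ₑ := by
  have hm (n : ℕ) : Measurable fun q : (A n → 𝒵) × 𝒲 n =>
      c n ^ 2 * ‖∑ t : A n, F n (q.1 t, q.2)‖ₑ ^ 2 := by
    refine Measurable.const_mul (Measurable.pow_const (Measurable.enorm
      (Finset.measurable_fun_sum _ fun t _ => (hF n).comp ?_)) 2) _
    exact ((measurable_pi_apply t).comp measurable_fst).prodMk measurable_snd
  have := TendstoZeroInProb.of_lintegral_indep (P := P) (l := l)
    (fun n => hZ.measurable_subsample (A n)) hW hAW hm (h.mono (Eventually.of_forall fun n ω => ?_))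
  · refine (this.rpow (p := (1 / 2 : ℝ)) (by norm_num)).mono (Eventually.of_forall fun n ω => ?_)
    simp only [subsample]
    rw [Finset.sum_coe_sort (A n) (fun t => F n (Z t ω, W n ω)), ← mul_pow]
    generalize c n * ‖∑ t ∈ A n, F n (Z t ω, W n ω)‖ₑ = x
    rw [← ENNReal.rpow_natCast, ← ENNReal.rpow_mul]
    norm_num
  · have hFw : Measurable fun z => F n (z, W n ω) := (hF n).comp measurable_prodMk_right
    have hm' : Measurable fun u : A n → 𝒵 => c n ^ 2 * ‖∑ t : A n, F n (u t, W n ω)‖ₑ ^ 2 :=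
      Measurable.const_mul (Measurable.pow_const (Measurable.enorm
        (Finset.measurable_fun_sum _ fun t _ => hFw.comp (measurable_pi_apply t))) 2) _
    rw [hZ.lintegral_map_subsample (A n) hm']
    simp only [subsample]
    simp_rw [fun η => Finset.sum_coe_sort (A n) (fun t => F n (Z t η, W n ω))]
    have hms : Measurable fun η => ‖∑ t ∈ A n, F n (Z t η, W n ω)‖ₑ ^ 2 :=
      (Finset.measurable_fun_sum _ fun t _ => hFw.comp (hZ.measurable t)).enorm.pow_const 2
    rw [lintegral_const_mul _ hms]
    gcongr
    -- With an infinite second moment the bound is trivial (also for an empty index set), which is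
    -- why a zero mean is only asked for when the second moment is finite.
    by_cases ht : ∫⁻ z, ‖F n (z, W n ω)‖ₑ ^ 2 ∂law = ∞
    · rcases (A n).eq_empty_or_nonempty with hA | hA
      · simp [hA]
      · rw [ht, ENNReal.mul_top (by simpa using hA.ne_empty)]
        exact le_top
    · exact (hZ.lintegral_norm_sum_sq hFw ht (h0 n _ ht) (A n)).le

end IIDSample
-- Taylor's theorem on the unit interval with an integral remainder bound.
section Taylor

variable {F : Type*} [NormedAddCommGroup F] [NormedSpace ℝ F] [CompleteSpace F]

/-- A form of the fundamental theorem of calculus that does not need the derivative to be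
integrable. -/
theorem enorm_sub_le_lintegral_deriv {f f' : ℝ → F} {b : ℝ} (hb0 : 0 ≤ b) (hb1 : b ≤ 1)
    (h : ∀ s, HasDerivAt f (f' s) s) :
    ‖f b - f 0‖ₑ ≤ ∫⁻ s in Set.Icc (0 : ℝ) 1, ‖f' s‖ₑ := by
  have hf' : f' = deriv f := funext fun s => (h s).deriv.symm
  -- Either the right-hand side is infinite, or the derivative, measurable because it is a `deriv`,
  -- is integrable and the usual theorem applies.
  by_cases hint : ∫⁻ s in Set.Icc (0 : ℝ) 1, ‖f' s‖ₑ = ∞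
  · rw [hint]; exact le_top
  have hI1 : IntegrableOn f' (Set.Icc 0 1) := by
    refine ⟨?_, lt_top_iff_ne_top.2 hint⟩
    rw [hf']
    exact aestronglyMeasurable_deriv _ _
  have hI : IntegrableOn f' (Set.Ioc 0 b) :=
    hI1.mono_set (Set.Ioc_subset_Icc_self.trans (Set.Icc_subset_Icc_right hb1))
  have hii : IntervalIntegrable f' volume 0 b := (intervalIntegrable_iff_integrableOn_Ioc_of_le hb0).2 hI
  rw [← intervalIntegral.integral_eq_sub_of_hasDerivAt (fun s _ => h s) hii,
    intervalIntegral.integral_of_le hb0]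
  refine (enorm_integral_le_lintegral_enorm _).trans ?_
  exact lintegral_mono_set (Set.Ioc_subset_Icc_self.trans (Set.Icc_subset_Icc_right hb1))

/-- If `φ 0, …, φ (n+1)` are successive derivatives, and the first `n + 1` of them vanish at zero,
then `φ 0` is bounded by the integral of the last one. -/
theorem enorm_le_lintegral_of_derivs_eq_zero (n : ℕ) : ∀ φ : ℕ → ℝ → F,
    (∀ j ≤ n, ∀ s, HasDerivAt (φ j) (φ (j + 1) s) s) → (∀ j ≤ n, φ j 0 = 0) →
    ∀ b, 0 ≤ b → b ≤ 1 → ‖φ 0 b‖ₑ ≤ ∫⁻ s in Set.Icc (0 : ℝ) 1, ‖φ (n + 1) s‖ₑ := by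
  induction n with
  | zero =>
    intro φ h h0 b hb0 hb1
    have := enorm_sub_le_lintegral_deriv hb0 hb1 (h 0 le_rfl)
    simpa [h0 0 le_rfl] using this
  | succ n ih =>
    intro φ h h0 b hb0 hb1
    -- The shifted sequence bounds `φ 1` uniformly on [0, 1]; integrating over an interval of mass
    -- one preserves the bound. The factorial of the sharp remainder is given up.
    have h1 := ih (fun j => φ (j + 1)) (fun j hj => h (j + 1) (by omega))
      (fun j hj => h0 (j + 1) (by omega))
    have h2 := enorm_sub_le_lintegral_deriv hb0 hb1 (h 0 (by omega))
    rw [h0 0 (by omega), sub_zero] at h2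
    refine h2.trans ?_
    calc ∫⁻ s in Set.Icc (0 : ℝ) 1, ‖φ (0 + 1) s‖ₑ
        ≤ ∫⁻ _ in Set.Icc (0 : ℝ) 1, ∫⁻ s in Set.Icc (0 : ℝ) 1, ‖φ (n + 1 + 1) s‖ₑ :=
          setLIntegral_mono' measurableSet_Icc fun s hs => h1 s hs.1 hs.2
      _ = _ := by simp

/-- Taylor's theorem with an integral bound for the remainder. -/
theorem enorm_taylor_le (n : ℕ) (φ : ℕ → ℝ → F)
    (h : ∀ j ≤ n, ∀ s, HasDerivAt (φ j) (φ (j + 1) s) s) :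
    ‖φ 0 1 - ∑ j ∈ Finset.range (n + 1), ((j.factorial : ℝ)⁻¹) • φ j 0‖ₑ ≤
      ∫⁻ s in Set.Icc (0 : ℝ) 1, ‖φ (n + 1) s‖ₑ := by
  -- `q i` is the i-th derivative of the Taylor polynomial of degree n. Subtracting it makes the
  -- derivatives of order at most n vanish at 0 and leaves the one of order n + 1 unchanged, since
  -- `q (n + 1) = 0`.
  let q : ℕ → ℝ → F := fun i s =>
    ∑ j ∈ Finset.range (n + 1 - i), (s ^ j * (j.factorial : ℝ)⁻¹) • φ (j + i) 0
  have hq0 (i : ℕ) (hi : i ≤ n) : q i 0 = φ i 0 := by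
    obtain ⟨m, hm⟩ : ∃ m, n + 1 - i = m + 1 := ⟨n - i, by omega⟩
    simp [q, hm, Finset.sum_range_succ']
  have hqd (i : ℕ) (hi : i ≤ n) (s : ℝ) : HasDerivAt (q i) (q (i + 1) s) s := by
    obtain ⟨m, hm⟩ : ∃ m, n + 1 - i = m + 1 := ⟨n - i, by omega⟩
    have hm' : n + 1 - (i + 1) = m := by omega
    have hfun : q i = fun s => (∑ j ∈ Finset.range m,
        (s ^ (j + 1) * ((j + 1).factorial : ℝ)⁻¹) • φ (j + (i + 1)) 0) + φ i 0 := by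
      ext s
      simp only [q, hm, Finset.sum_range_succ']
      simp [add_assoc, add_comm 1 i]
    rw [hfun]
    simp only [q, hm']
    refine HasDerivAt.add_const _ (HasDerivAt.fun_sum fun j _ => ?_)
    have h1 := ((hasDerivAt_pow (j + 1) s).mul_const (((j + 1).factorial : ℝ)⁻¹)).smul_const
      (φ (j + (i + 1)) 0)
    convert h1 using 2
    rw [Nat.factorial_succ]
    push_cast
    field_simp
  have hqlast (s : ℝ) : q (n + 1) s = 0 := by simp [q]
  have := enorm_le_lintegral_of_derivs_eq_zero n (fun i s => φ i s - q i s)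
    (fun j hj s => (h j hj s).sub (hqd j hj s))
    (fun j hj => by simp [hq0 j hj]) 1 zero_le_one le_rfl
  simpa [hqlast, q] using this

end Taylor

/-! ### Partial derivatives along words, and the multivariate Taylor expansion. -/

section Words

variable {ℓ : ℕ} {F : Type*} [NormedAddCommGroup F] [NormedSpace ℝ F]

/-- The iterated partial derivative along a list of coordinates. -/
noncomputable def wordDeriv (w : List (Fin ℓ)) (f : Vec ℓ → F) : Vec ℓ → F :=
  w.foldr pderiv f

/-- `f` is `n` times (Fréchet) differentiable. -/
def NDifferentiable : ℕ → (Vec ℓ → F) → Prop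
  | 0, _ => True
  | n + 1, f => Differentiable ℝ f ∧ ∀ i, NDifferentiable n (pderiv i f)

theorem NDifferentiable.mono {n m : ℕ} {f : Vec ℓ → F} (hf : NDifferentiable n f) (hm : m ≤ n) :
    NDifferentiable m f := by
  induction m generalizing n f with
  | zero => trivial
  | succ m ih =>
    obtain ⟨n, rfl⟩ : ∃ n', n = n' + 1 := ⟨n - 1, by omega⟩
    exact ⟨hf.1, fun i => ih (hf.2 i) (by omega)⟩

theorem NDifferentiable.wordDeriv {n : ℕ} {f : Vec ℓ → F} (w : List (Fin ℓ))
    (hf : NDifferentiable (n + w.length) f) : NDifferentiable n (wordDeriv w f) := by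
  induction w generalizing n with
  | nil => exact hf
  | cons i w ih =>
    have := ih (n := n + 1) (by simpa [add_assoc, add_comm 1] using hf)
    exact this.2 i

/-- The derivative of order n + 1 need not be continuous, so `ContDiff` of that order is not
available. The induction peels off the innermost derivative: evaluation at a basis vector is
continuous linear and commutes with `iteratedFDeriv`. -/
theorem nDifferentiable_succ_of_contDiff {n : ℕ} : ∀ {f : Vec ℓ → F}, ContDiff ℝ n f →
    Differentiable ℝ (iteratedFDeriv ℝ n f) → NDifferentiable (n + 1) f := by
  induction n with
  | zero =>
    intro f _ hf
    refine ⟨?_, fun _ => trivial⟩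
    have : f = fun x => iteratedFDeriv ℝ 0 f x ![] := by ext x; simp
    rw [this]
    intro x
    exact (hf x).continuousMultilinear_apply_const _
  | succ n ih =>
    intro f hf hd
    refine ⟨hf.differentiable (by simp), fun i => ih ?_ ?_⟩
    · have := hf.fderiv_right (m := n) (by norm_cast)
      exact this.clm_apply contDiff_const
    · have hfd : ContDiff ℝ n (fderiv ℝ f) := hf.fderiv_right (m := n) (by norm_cast)
      have h1 : iteratedFDeriv ℝ n (pderiv i f) = fun x =>
          ((ContinuousLinearMap.apply ℝ F (EuclideanSpace.single i (1 : ℝ)))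
            ).compContinuousMultilinearMap (iteratedFDeriv ℝ n (fderiv ℝ f) x) := by
        ext1 x
        exact ContinuousLinearMap.iteratedFDeriv_comp_left
          (ContinuousLinearMap.apply ℝ F (EuclideanSpace.single i (1 : ℝ))) hfd.contDiffAt le_rfl
      have h2 : Differentiable ℝ (iteratedFDeriv ℝ n (fderiv ℝ f)) := by
        rw [show iteratedFDeriv ℝ (n + 1) f =
          (continuousMultilinearCurryRightEquiv' ℝ n (Vec ℓ) F).symm ∘
            iteratedFDeriv ℝ n (fderiv ℝ f) from
          funext fun _ => iteratedFDeriv_succ_eq_comp_right] at hd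
        exact (LinearIsometryEquiv.comp_differentiable_iff _).1 hd
      rw [h1]
      exact (ContinuousLinearMap.compContinuousMultilinearMapL ℝ (fun _ : Fin n => Vec ℓ)
        (Vec ℓ →L[ℝ] F) F
        (ContinuousLinearMap.apply ℝ F (EuclideanSpace.single i (1 : ℝ)))).differentiable.comp h2

theorem fderiv_eq_sum_pderiv (f : Vec ℓ → F) (x v : Vec ℓ) :
    fderiv ℝ f x v = ∑ i, v i • pderiv i f x := by
  conv_lhs => rw [← (EuclideanSpace.basisFun (Fin ℓ) ℝ).sum_repr v]
  simp [pderiv, map_sum]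

theorem NDifferentiable.differentiable_fderiv {f : Vec ℓ → F} (hf : NDifferentiable 2 f) :
    Differentiable ℝ (fderiv ℝ f) := by
  have h : fderiv ℝ f = fun x => ∑ i, (EuclideanSpace.proj (𝕜 := ℝ) i).smulRight (pderiv i f x) := by
    ext x v
    rw [fderiv_eq_sum_pderiv]
    simp
  rw [h]
  refine Differentiable.fun_sum fun i _ => ?_
  exact (ContinuousLinearMap.smulRightL ℝ (Vec ℓ) F (EuclideanSpace.proj (𝕜 := ℝ) i)).differentiable.comp
    (hf.2 i).1

/-- Symmetry of the second derivative needs only a differentiable first derivative, not continuity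
of the second. -/
theorem pderiv_comm {f : Vec ℓ → F} (hf : NDifferentiable 2 f) (i j : Fin ℓ) :
    pderiv i (pderiv j f) = pderiv j (pderiv i f) := by
  have hd := hf.differentiable_fderiv
  ext x
  have key (i j : Fin ℓ) : pderiv i (pderiv j f) x =
      fderiv ℝ (fderiv ℝ f) x (EuclideanSpace.single i 1) (EuclideanSpace.single j 1) := by
    have : HasFDerivAt (pderiv j f)
        ((ContinuousLinearMap.apply ℝ F (EuclideanSpace.single j (1 : ℝ))).comp
          (fderiv ℝ (fderiv ℝ f) x)) x :=
      (ContinuousLinearMap.apply ℝ F (EuclideanSpace.single j (1 : ℝ))).hasFDerivAt.comp x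
        (hd x).hasFDerivAt
    rw [pderiv, this.fderiv]
    rfl
  rw [key, key]
  exact second_derivative_symmetric (fun y => (hf.1 y).hasFDerivAt) (hd x).hasFDerivAt _ _

/-- Permutations are generated by swaps of two neighbouring letters, where `pderiv_comm` applies. -/
theorem wordDeriv_perm {w w' : List (Fin ℓ)} (h : w.Perm w') {f : Vec ℓ → F}
    (hf : NDifferentiable w.length f) : wordDeriv w f = wordDeriv w' f := by
  induction h with
  | nil => rfl
  | cons i _ ih =>
    have := ih (hf.mono (by simp))
    simp only [wordDeriv, List.foldr_cons] at this ⊢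
    rw [this]
  | swap i j w =>
    have : NDifferentiable 2 (wordDeriv w f) :=
      NDifferentiable.wordDeriv w (hf.mono (by simp; omega))
    exact pderiv_comm this j i
  | trans h1 _ ih1 ih2 => rw [ih1 hf, ih2 (by rwa [← h1.length_eq])]

/-- The multi-index of a word. -/
def wordIndex {j : ℕ} (w : Fin j → Fin ℓ) : Fin ℓ → ℕ := fun i => (List.ofFn w).count i

theorem order_wordIndex {j : ℕ} (w : Fin j → Fin ℓ) : order (wordIndex w) = j := by
  have := Multiset.sum_count_eq_card (s := Finset.univ) (m := (List.ofFn w : Multiset (Fin ℓ)))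
    (fun _ _ => Finset.mem_univ _)
  simpa [order, wordIndex] using this

theorem multiDeriv_eq_wordDeriv (α : Fin ℓ → ℕ) (f : Vec ℓ → F) :
    multiDeriv α f =
      wordDeriv ((List.finRange ℓ).flatMap fun i => List.replicate (α i) i) f := by
  unfold multiDeriv wordDeriv
  induction List.finRange ℓ with
  | nil => rfl
  | cons i L ih =>
    rw [List.foldr_cons, ih, List.flatMap_cons, List.foldr_append]
    induction α i with
    | zero => rfl
    | succ n ihn => rw [Function.iterate_succ_apply', ihn, List.replicate_succ, List.foldr_cons]

/-- The sorted word that defines `multiDeriv` has the same letter counts as `w`, hence is a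
permutation of it. -/
theorem wordDeriv_ofFn {j : ℕ} (w : Fin j → Fin ℓ) {f : Vec ℓ → F} (hf : NDifferentiable j f) :
    wordDeriv (List.ofFn w) f = multiDeriv (wordIndex w) f := by
  rw [multiDeriv_eq_wordDeriv]
  refine wordDeriv_perm ?_ (by simpa using hf)
  rw [List.perm_iff_count]
  intro i
  rw [List.count_flatMap]
  have : (List.map (fun b => List.count i (List.replicate (wordIndex w b) b)) (List.finRange ℓ)).sum
      = ∑ b, if b = i then wordIndex w b else 0 := by
    rw [← List.sum_ofFn, List.ofFn_eq_map]
    simp [List.count_replicate]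
  rw [Function.comp_def, this]
  simp [wordIndex]

theorem prod_word {M : Type*} [CommMonoid M] {j : ℕ} (w : Fin j → Fin ℓ) (v : Fin ℓ → M) :
    ∏ t, v (w t) = ∏ i, v i ^ wordIndex w i := by
  have h := Finset.prod_multiset_map_count (List.ofFn w : Multiset (Fin ℓ)) v
  rw [Finset.prod_subset (Finset.subset_univ _)] at h
  · simp only [Multiset.map_coe, Multiset.prod_coe, Multiset.coe_count, List.map_ofFn,
      List.prod_ofFn, Function.comp_apply] at h
    exact h
  · intro i _ hi
    rw [Multiset.mem_toFinset, ← Multiset.count_eq_zero] at hi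
    simp [hi]

/-- The terms of order `j` in the Taylor expansion, as sums over words. -/
noncomputable def wordSum (f : Vec ℓ → F) (γ v : Vec ℓ) (j : ℕ) : F :=
  ∑ w : Fin j → Fin ℓ, (∏ t, v (w t)) • wordDeriv (List.ofFn w) f γ

/-- Differentiation along a line prepends one letter to every word. Summing over words instead of
multi-indices thus avoids multinomial coefficients. -/
theorem hasDerivAt_wordSum {f : Vec ℓ → F} {n j : ℕ} (hf : NDifferentiable (n + 1) f) (hj : j ≤ n)
    (γ v : Vec ℓ) (s : ℝ) :
    HasDerivAt (fun s : ℝ => wordSum f (γ + s • v) v j) (wordSum f (γ + s • v) v (j + 1)) s := by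
  have h1 : wordSum f (γ + s • v) v (j + 1) = ∑ w : Fin j → Fin ℓ, (∏ t, v (w t)) •
      ∑ i, v i • pderiv i (wordDeriv (List.ofFn w) f) (γ + s • v) := by
    unfold wordSum
    rw [← (Fin.consEquiv fun _ : Fin (j + 1) => Fin ℓ).sum_comp, Fintype.sum_prod_type,
      Finset.sum_comm]
    refine Finset.sum_congr rfl fun w _ => ?_
    rw [Finset.smul_sum]
    refine Finset.sum_congr rfl fun i _ => ?_
    simp only [Fin.consEquiv, Equiv.coe_fn_mk, Fin.prod_univ_succ, Fin.cons_zero, Fin.cons_succ,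
      List.ofFn_succ, wordDeriv, List.foldr_cons]
    rw [smul_smul, mul_comm]
  rw [h1]
  unfold wordSum
  refine HasDerivAt.fun_sum fun w _ => HasDerivAt.const_smul _ ?_
  have hd : Differentiable ℝ (wordDeriv (List.ofFn w) f) :=
    (NDifferentiable.wordDeriv (n := 1) (List.ofFn w) (hf.mono (by simp; omega))).1
  rw [← fderiv_eq_sum_pderiv]
  have hline : HasDerivAt (fun s : ℝ => γ + s • v) v s := by
    simpa using ((hasDerivAt_id s).smul_const v).const_add γ
  exact (hd _).hasFDerivAt.comp_hasDerivAt s hline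

/-- The multivariate Taylor expansion of order `n` of an `n + 1` times differentiable function,
with an integral bound for the remainder. -/
theorem enorm_multivariate_taylor_le [CompleteSpace F] {f : Vec ℓ → F} {n : ℕ}
    (hf : NDifferentiable (n + 1) f) (γ v : Vec ℓ) :
    ‖f (γ + v) - f γ - ∑ j ∈ Finset.Icc 1 n, ((j.factorial : ℝ)⁻¹) •
        ∑ w : Fin j → Fin ℓ, (∏ t, v (w t)) • multiDeriv (wordIndex w) f γ‖ₑ ≤
      ∫⁻ s in Set.Icc (0 : ℝ) 1, ∑ w : Fin (n + 1) → Fin ℓ,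
        (∏ t, ‖v (w t)‖ₑ) * ‖multiDeriv (wordIndex w) f (γ + s • v)‖ₑ := by
  have h := enorm_taylor_le n (fun j s => wordSum f (γ + s • v) v j)
    (fun j hj s => hasDerivAt_wordSum hf hj γ v s)
  have h0 (x : Vec ℓ) : wordSum f x v 0 = f x := by
    simp [wordSum, wordDeriv]
  have hs : ∑ j ∈ Finset.range (n + 1), ((j.factorial : ℝ)⁻¹) • wordSum f (γ + (0 : ℝ) • v) v j =
      f γ + ∑ j ∈ Finset.Icc 1 n, ((j.factorial : ℝ)⁻¹) •
        ∑ w : Fin j → Fin ℓ, (∏ t, v (w t)) • multiDeriv (wordIndex w) f γ := by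
    rw [Finset.range_eq_Ico, Finset.sum_eq_sum_Ico_succ_bot (by omega)]
    have hI : Finset.Ico (0 + 1) (n + 1) = Finset.Icc 1 n := by ext; simp
    rw [hI]
    simp only [zero_smul, add_zero, h0, Nat.factorial_zero, Nat.cast_one, inv_one, one_smul]
    congr 1
    refine Finset.sum_congr rfl fun j hj => ?_
    rw [Finset.mem_Icc] at hj
    unfold wordSum
    simp_rw [wordDeriv_ofFn _ (hf.mono (by omega : j ≤ n + 1))]
  simp only [h0, one_smul] at h
  rw [hs, ← sub_sub] at h
  refine h.trans (lintegral_mono fun s => ?_)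
  unfold wordSum
  refine (enorm_sum_le _ _).trans (Finset.sum_le_sum fun w _ => ?_)
  rw [enorm_smul, wordDeriv_ofFn _ hf]
  gcongr
  rw [← ofReal_norm, norm_prod, ENNReal.ofReal_prod_of_nonneg fun _ _ => norm_nonneg _]
  exact (Finset.prod_congr rfl fun t _ => ofReal_norm (v (w t))).le

end Words
-- The multivariate central limit theorem and the law of large numbers.
section CentralLimit

open scoped Matrix

variable {𝒵 Ω : Type*} [MeasurableSpace 𝒵] [MeasurableSpace Ω] {law : Measure 𝒵} {P : Measure Ω}
  {Z : ℕ → Ω → 𝒵} {d : ℕ}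

/-- The covariance matrix of a random vector. -/
noncomputable def covMatrix (μ : Measure 𝒵) (f : 𝒵 → Vec d) : Matrix (Fin d) (Fin d) ℝ :=
  Matrix.of fun i j => cov[fun z => f z i, fun z => f z j; μ]

theorem MemLp.coord {f : 𝒵 → Vec d} {p : ℝ≥0∞} (hf : MemLp f p law) (i : Fin d) :
    MemLp (fun z => f z i) p law :=
  (EuclideanSpace.proj (𝕜 := ℝ) i).comp_memLp' hf

theorem variance_linear_comb [IsFiniteMeasure law] {f : 𝒵 → Vec d} (hf : MemLp f 2 law)
    (u : Fin d → ℝ) :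
    Var[fun z => ∑ i, u i * f z i; law] = u ⬝ᵥ covMatrix law f *ᵥ u := by
  have hfi (i : Fin d) : MemLp (fun z => u i * f z i) 2 law := (MemLp.coord hf i).const_mul (u i)
  rw [← covariance_self (memLp_finsetSum _ fun i _ => hfi i).aestronglyMeasurable.aemeasurable,
    covariance_fun_sum_fun_sum hfi hfi]
  simp only [dotProduct, Matrix.mulVec, covMatrix, Matrix.of_apply, Finset.mul_sum]
  refine Finset.sum_congr rfl fun i _ => Finset.sum_congr rfl fun j _ => ?_
  rw [covariance_const_mul_left, covariance_const_mul_right]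
  ring

theorem inner_eq_sum (x t : Vec d) : inner ℝ x t = ∑ i, t i * x i := by
  simp [PiLp.inner_apply]

theorem posSemidef_covMatrix [IsFiniteMeasure law] {f : 𝒵 → Vec d} (hf : MemLp f 2 law) :
    (covMatrix law f).PosSemidef := by
  refine Matrix.PosSemidef.of_dotProduct_mulVec_nonneg ?_ fun u => ?_
  · ext i j
    simp [covMatrix, covariance_comm]
  · have := variance_linear_comb hf u
    simp only [star_trivial]
    rw [← this]
    exact variance_nonneg _ _

/-- The covariance matrix of a linear image. -/
theorem covMatrix_mulVec [IsFiniteMeasure law] {f : 𝒵 → Vec d} (hf : MemLp f 2 law)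
    (B : Matrix (Fin d) (Fin d) ℝ) :
    covMatrix law (fun z => WithLp.toLp 2 (B *ᵥ (f z).ofLp)) = B * covMatrix law f * Bᵀ := by
  ext i j
  have hfi (c : Fin d → ℝ) (i : Fin d) : MemLp (fun z => c i * f z i) 2 law :=
    (MemLp.coord hf i).const_mul (c i)
  simp only [covMatrix, Matrix.of_apply, Matrix.mulVec, dotProduct]
  rw [covariance_fun_sum_fun_sum (hfi (B i)) (hfi (B j))]
  simp only [Matrix.mul_apply, Matrix.of_apply, Matrix.transpose_apply, Finset.sum_mul]
  rw [Finset.sum_comm]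
  refine Finset.sum_congr rfl fun a _ => Finset.sum_congr rfl fun b _ => ?_
  rw [covariance_const_mul_left, covariance_const_mul_right]
  ring

/-- The multivariate central limit theorem. -/
theorem IsIIDSample.tendstoInDistribution_sum [IsProbabilityMeasure P]
    (hZ : IsIIDSample law P Z) {f : 𝒵 → Vec d} (hf : Measurable f) (h2 : MemLp f 2 law)
    (h0 : ∫ z, f z ∂law = 0) {l : Filter ℕ} {N : ℕ → ℕ} (hN : Tendsto N l atTop) :
    TendstoInDistribution (fun (n : ℕ) ω => (√(N n : ℝ))⁻¹ • ∑ t ∈ Finset.range (N n), f (Z t ω)) l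
      id (fun _ => P) (multivariateGaussian 0 (covMatrix law f)) := by
  have hprob : IsProbabilityMeasure law := by
    rw [← hZ.map_eq 0]; exact Measure.isProbabilityMeasure_map (hZ.measurable 0).aemeasurable
  have hmeas (n : ℕ) : Measurable fun ω => (√(n : ℝ))⁻¹ • ∑ t ∈ Finset.range n, f (Z t ω) := by
    have h : Measurable fun ω => ∑ t ∈ Finset.range n, f (Z t ω) :=
      Finset.measurable_fun_sum _ fun t _ => hf.comp (hZ.measurable t)
    exact h.const_smul ((√(n : ℝ))⁻¹)
  suffices h : TendstoInDistribution
      (fun (n : ℕ) ω => (√(n : ℝ))⁻¹ • ∑ t ∈ Finset.range n, f (Z t ω)) atTop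
      id (fun _ => P) (multivariateGaussian 0 (covMatrix law f)) from
    ⟨fun n => (hmeas (N n)).aemeasurable, aemeasurable_id, h.tendsto.comp hN⟩
  refine ⟨fun n => (hmeas n).aemeasurable, aemeasurable_id, ?_⟩
  refine ProbabilityMeasure.tendsto_iff_tendsto_charFun.2 fun t => ?_
  -- Cramér–Wold: the characteristic function of a vector at t is that of its inner product with t,
  -- evaluated at 1.
  set g : 𝒵 → ℝ := fun z => inner ℝ (f z) t with hg
  have hgm : Measurable g := hf.inner measurable_const
  have hgL : MemLp g 2 law := by
    have := memLp_finsetSum (Finset.univ) fun i (_ : i ∈ Finset.univ) =>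
      (MemLp.coord h2 i).const_mul (t i)
    simpa only [hg, inner_eq_sum] using this
  have hg0 : ∫ ω, g (Z 0 ω) ∂P = 0 := by
    rw [hZ.integral_comp hgm]
    have := ContinuousLinearMap.integral_comp_comm (innerSL ℝ t) (h2.integrable (by norm_num))
    rw [h0, map_zero] at this
    simpa [hg, real_inner_comm] using this
  have hgvar : Var[fun ω => g (Z 0 ω); P] = t.ofLp ⬝ᵥ covMatrix law f *ᵥ t.ofLp := by
    rw [← variance_linear_comb h2 t.ofLp, ← hZ.map_eq 0, variance_map]
    · simp only [hg, inner_eq_sum]; rfl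
    · rw [hZ.map_eq 0]
      simpa only [hg, inner_eq_sum] using hgm.aemeasurable
    · exact (hZ.measurable 0).aemeasurable
  have hclt := tendstoInDistribution_inv_sqrt_mul_sum_sub (P := P) (X := fun k ω => g (Z k ω))
    (Y := id) (P' := gaussianReal 0 Var[fun ω => g (Z 0 ω); P].toNNReal)
    HasLaw.id (hZ.memLp_comp hgL 0) (hZ.indep.comp (fun _ => g) fun _ => hgm)
    (fun k => hZ.identDistrib_comp hgm k)
  have h1 := ProbabilityMeasure.tendsto_iff_tendsto_charFun.1 hclt.tendsto 1
  simp only [ProbabilityMeasure.coe_mk, Measure.map_id] at h1 ⊢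
  rw [charFun_multivariateGaussian (posSemidef_covMatrix h2)]
  rw [charFun_gaussianReal] at h1
  have hv : 0 ≤ Var[fun ω => g (Z 0 ω); P] := variance_nonneg _ _
  convert h1 using 2
  · rename_i n
    rw [charFun_apply, charFun_apply_real, integral_map (hmeas n).aemeasurable (by fun_prop),
      integral_map (hclt.forall_aemeasurable n) (by fun_prop)]
    refine integral_congr_ae (Eventually.of_forall fun ω => ?_)
    simp only [hg0]
    simp only [hg, inner_smul_left, sum_inner]
    simp
  · congr 1
    rw [hgvar] at hv
    simp [hgvar, hv]

/-- The weak law of large numbers. -/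
theorem IsIIDSample.tendstoZeroInProb_mean [IsProbabilityMeasure P] (hZ : IsIIDSample law P Z)
    {f : 𝒵 → ℝ} (hf : Measurable f) (hi : Integrable f law) {l : Filter ℕ} {N : ℕ → ℕ}
    (hN : Tendsto N l atTop) :
    TendstoZeroInProb P l fun n ω =>
      ‖(N n : ℝ)⁻¹ * ∑ t ∈ Finset.range (N n), f (Z t ω) - ∫ z, f z ∂law‖ₑ := by
  have hint : Integrable (fun ω => f (Z 0 ω)) P :=
    memLp_one_iff_integrable.1 (hZ.memLp_comp (memLp_one_iff_integrable.2 hi) 0)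
  have h := strong_law_ae_real (fun t ω => f (Z t ω)) hint
    (fun s t hst => (hZ.indep.indepFun hst).comp hf hf) (fun t => hZ.identDistrib_comp hf t)
  rw [hZ.integral_comp hf] at h
  have hm : TendstoInMeasure P (fun (n : ℕ) ω => (∑ t ∈ Finset.range n, f (Z t ω)) / n) atTop
      fun _ => ∫ z, f z ∂law := by
    refine tendstoInMeasure_of_tendsto_ae (fun n => ?_) h
    exact ((Finset.measurable_fun_sum _ fun t _ => hf.comp (hZ.measurable t)).div_const
      _).aestronglyMeasurable
  intro ε hε
  refine ((hm ε hε).comp hN).congr fun n => ?_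
  simp only [Function.comp_apply, edist_eq_enorm_sub, div_eq_inv_mul]

end CentralLimit
-- Joint measurability of derivatives in a parameter.
section Measurability

variable {𝒵 : Type*} [MeasurableSpace 𝒵] {ℓ d : ℕ}

/-- A derivative is a pointwise limit of difference quotients with step 1/n, so it need not be
continuous. Joint measurability is what allows a random nuisance value to be plugged in. -/
theorem measurable_pderiv_param {g : 𝒵 → Vec ℓ → Vec d}
    (hg : Measurable fun q : 𝒵 × Vec ℓ => g q.1 q.2) (hd : ∀ z, Differentiable ℝ (g z))
    (i : Fin ℓ) : Measurable fun q : 𝒵 × Vec ℓ => pderiv i (g q.1) q.2 := by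
  refine measurable_of_tendsto_metrizable (f := fun (n : ℕ) (q : 𝒵 × Vec ℓ) =>
    (n : ℝ) • (g q.1 (q.2 + (n : ℝ)⁻¹ • EuclideanSpace.single i 1) - g q.1 q.2)) (fun n => ?_) ?_
  · have h := hg.comp (f := fun q : 𝒵 × Vec ℓ => (q.1, q.2 + (n : ℝ)⁻¹ • EuclideanSpace.single i 1))
      (measurable_fst.prodMk (measurable_snd.add_const _))
    exact (h.sub hg).const_smul (n : ℝ)
  · refine tendsto_pi_nhds.2 fun q => ?_
    refine (hd q.1 q.2).hasFDerivAt.lim _ ?_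
    simpa using tendsto_natCast_atTop_atTop

theorem measurable_wordDeriv_param {g : 𝒵 → Vec ℓ → Vec d}
    (hg : Measurable fun q : 𝒵 × Vec ℓ => g q.1 q.2) (w : List (Fin ℓ))
    (hd : ∀ z, NDifferentiable w.length (g z)) :
    Measurable fun q : 𝒵 × Vec ℓ => wordDeriv w (g q.1) q.2 := by
  induction w with
  | nil => exact hg
  | cons i w ih =>
    refine measurable_pderiv_param (g := fun z => wordDeriv w (g z)) (ih fun z => (hd z).mono (by simp)) (fun z => ?_) i
    exact (NDifferentiable.wordDeriv (n := 1) w ((hd z).mono (by simp; omega))).1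

theorem length_multiIndexWord (α : Fin ℓ → ℕ) :
    ((List.finRange ℓ).flatMap fun i => List.replicate (α i) i).length = order α := by
  rw [List.length_flatMap]
  simp only [List.length_replicate, order]
  rw [← List.sum_ofFn, List.ofFn_eq_map]

theorem measurable_multiDeriv_param {g : 𝒵 → Vec ℓ → Vec d}
    (hg : Measurable fun q : 𝒵 × Vec ℓ => g q.1 q.2) (α : Fin ℓ → ℕ)
    (hd : ∀ z, NDifferentiable (order α) (g z)) :
    Measurable fun q : 𝒵 × Vec ℓ => multiDeriv α (g q.1) q.2 := by
  simp_rw [multiDeriv_eq_wordDeriv]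
  exact measurable_wordDeriv_param hg _ fun z => (hd z).mono (length_multiIndexWord α).le

end Measurability

/-! ### Cauchy–Schwarz bounds for nonnegative integrals. -/

section CauchySchwarz

variable {𝒵 : Type*} [MeasurableSpace 𝒵] {μ : Measure 𝒵}

theorem lintegral_mul_le_sqrt_mul_sqrt {f g : 𝒵 → ℝ≥0∞} (hf : AEMeasurable f μ)
    (hg : AEMeasurable g μ) :
    ∫⁻ z, f z * g z ∂μ ≤
      (∫⁻ z, f z ^ 2 ∂μ) ^ (1 / 2 : ℝ) * (∫⁻ z, g z ^ 2 ∂μ) ^ (1 / 2 : ℝ) := by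
  simpa using ENNReal.lintegral_mul_le_Lp_mul_Lq μ Real.HolderConjugate.two_two hf hg

theorem lintegral_sq_le_sqrt [IsProbabilityMeasure μ] {f : 𝒵 → ℝ≥0∞} (hf : AEMeasurable f μ) :
    ∫⁻ z, f z ^ 2 ∂μ ≤ (∫⁻ z, f z ^ 4 ∂μ) ^ (1 / 2 : ℝ) := by
  have := lintegral_mul_le_sqrt_mul_sqrt (μ := μ) (hf.pow_const 2)
    (aemeasurable_const (b := (1 : ℝ≥0∞)))
  simpa [← pow_mul] using this

end CauchySchwarz

/-! ### Measurability of the moments, and moment bounds for the Taylor terms. -/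

namespace MomentModel

variable {𝒵 𝒳 : Type*} [MeasurableSpace 𝒵] [MeasurableSpace 𝒳] {d ℓ k : ℕ}
  {M : MomentModel 𝒵 𝒳 d ℓ} {r : ℝ}

instance (M : MomentModel 𝒵 𝒳 d ℓ) : IsProbabilityMeasure M.law := M.isProb

theorem IsSmooth.nDifferentiable (hs : M.IsSmooth k) (z : 𝒵) :
    NDifferentiable (k + 1) (M.m z M.θ₀) := by
  refine nDifferentiable_succ_of_contDiff ?_ (hs.differentiable_γ z)
  have h := ((hs.contDiff z).of_le (m := (k : ℕ)) (by exact_mod_cast le_max_left k 1)).comp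
    (contDiff_const (c := M.θ₀) |>.prodMk contDiff_id)
  exact h

theorem IsSmooth.contDiff_one (hs : M.IsSmooth k) (z : 𝒵) :
    ContDiff ℝ 1 fun q : Vec d × Vec ℓ => M.m z q.1 q.2 :=
  (hs.contDiff z).of_le (by exact_mod_cast le_max_right k 1)

/-- A Carathéodory function, measurable in z and continuous in (θ, γ), is jointly measurable. -/
theorem IsSmooth.measurable_m (hs : M.IsSmooth k) :
    Measurable fun q : (𝒵 × Vec ℓ) × Vec d => M.m q.1.1 q.2 q.1.2 := by
  have := measurable_uncurry_of_continuous_of_measurable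
    (u := fun (p : Vec d × Vec ℓ) z => M.m z p.1 p.2)
    (fun z => (hs.contDiff_one z).continuous) (fun p => M.measurable_m p.1 p.2)
  exact this.comp ((measurable_snd.prodMk (measurable_snd.comp measurable_fst)).prodMk
    (measurable_fst.comp measurable_fst))

theorem IsSmooth.measurable_m_left (hs : M.IsSmooth k) (θ : Vec d) :
    Measurable fun q : 𝒵 × Vec ℓ => M.m q.1 θ q.2 :=
  hs.measurable_m.comp (measurable_id.prodMk measurable_const)

theorem IsSmooth.differentiable_θ (hs : M.IsSmooth k) (z : 𝒵) (γ : Vec ℓ) :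
    Differentiable ℝ fun θ => M.m z θ γ :=
  ((hs.contDiff_one z).comp (contDiff_id.prodMk contDiff_const)).differentiable (by simp)

theorem IsSmooth.measurable_gradθ (hs : M.IsSmooth k) (θ : Vec d) (i j : Fin d) :
    Measurable fun q : 𝒵 × Vec ℓ => M.gradθ q.1 θ q.2 i j := by
  have h := measurable_pderiv_param (g := fun (q : 𝒵 × Vec ℓ) θ' => M.m q.1 θ' q.2)
    hs.measurable_m (fun q => hs.differentiable_θ q.1 q.2) j
  exact (measurable_coord i).comp (h.comp (measurable_id.prodMk measurable_const))

theorem IsSmooth.measurable_pderiv_gradθ (hs : M.IsSmooth k) (θ : Vec d) (i j : Fin d)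
    (a : Fin ℓ) :
    Measurable fun q : 𝒵 × Vec ℓ => pderiv a (fun γ => M.gradθ q.1 θ γ i j) q.2 := by
  refine measurable_of_tendsto_metrizable (f := fun (n : ℕ) (q : 𝒵 × Vec ℓ) =>
    (n : ℝ) • (M.gradθ q.1 θ (q.2 + (n : ℝ)⁻¹ • EuclideanSpace.single a 1) i j -
      M.gradθ q.1 θ q.2 i j)) (fun n => ?_) ?_
  · have h := (hs.measurable_gradθ θ i j).comp
      (f := fun q : 𝒵 × Vec ℓ => (q.1, q.2 + (n : ℝ)⁻¹ • EuclideanSpace.single a 1))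
      (measurable_fst.prodMk (measurable_snd.add_const _))
    exact (h.sub (hs.measurable_gradθ θ i j)).const_smul (n : ℝ)
  · refine tendsto_pi_nhds.2 fun q => ?_
    refine (hs.differentiable_θγ q.1 θ i j q.2).hasFDerivAt.lim _ ?_
    simpa using tendsto_natCast_atTop_atTop

theorem IsSmooth.continuous_gradθ (hs : M.IsSmooth k) (z : 𝒵) (i j : Fin d) :
    Continuous fun q : Vec d × Vec ℓ => M.gradθ z q.1 q.2 i j := by
  have h : ContDiff ℝ 1 (Function.uncurry fun (q : Vec d × Vec ℓ) (θ : Vec d) => M.m z θ q.2) :=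
    (hs.contDiff_one z).comp (contDiff_snd.prodMk (contDiff_snd.comp contDiff_fst))
  have h2 : ContDiff ℝ 0 fun q : Vec d × Vec ℓ =>
      fderiv ℝ (fun θ => M.m z θ q.2) q.1 (EuclideanSpace.single j 1) :=
    (h.fderiv contDiff_fst (by norm_num)).clm_apply contDiff_const
  exact (EuclideanSpace.proj (𝕜 := ℝ) i).continuous.comp h2.continuous

theorem IsSmooth.measurable_multiDeriv (hs : M.IsSmooth k) {α : Fin ℓ → ℕ} (hα : order α ≤ k + 1) :
    Measurable fun q : 𝒵 × Vec ℓ => multiDeriv α (M.m q.1 M.θ₀) q.2 :=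
  measurable_multiDeriv_param (hs.measurable_m_left M.θ₀) α
    fun z => (hs.nDifferentiable z).mono hα

theorem measurable_h₀ (M : MomentModel 𝒵 𝒳 d ℓ) : Measurable M.h₀ := M.measurable_ℋ _ M.h₀_mem

/-- The function `∏ᵢ |hᵢ(X) - h₀ᵢ(X)|^{αᵢ}`. -/
noncomputable def errFun (M : MomentModel 𝒵 𝒳 d ℓ) (α : Fin ℓ → ℕ) (h : 𝒳 → Vec ℓ) (z : 𝒵) :
    ℝ≥0∞ :=
  ∏ i, ‖h (M.X z) i - M.h₀ (M.X z) i‖ₑ ^ α i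

theorem errMoment_eq (M : MomentModel 𝒵 𝒳 d ℓ) (c : ℕ) (α : Fin ℓ → ℕ) (h : 𝒳 → Vec ℓ) :
    M.errMoment c α h = ∫⁻ z, M.errFun α h z ^ c ∂M.law := by
  simp only [errMoment, errFun, ← Finset.prod_pow, ← pow_mul, mul_comm c]

theorem measurable_errFun (M : MomentModel 𝒵 𝒳 d ℓ) (α : Fin ℓ → ℕ) {h : 𝒳 → Vec ℓ}
    (hh : Measurable h) : Measurable (M.errFun α h) := by
  have h1 : Measurable fun z => h (M.X z) := hh.comp M.measurable_X
  have h2 : Measurable fun z => M.h₀ (M.X z) := M.measurable_h₀.comp M.measurable_X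
  have h3 (i : Fin ℓ) : Measurable fun z => h (M.X z) i - M.h₀ (M.X z) i :=
    (measurable_coord i).comp (h1.sub h2)
  exact Finset.measurable_fun_prod _ fun i _ => (h3 i).enorm.pow_const _

theorem errMoment_two_le (M : MomentModel 𝒵 𝒳 d ℓ) (α : Fin ℓ → ℕ) {h : 𝒳 → Vec ℓ}
    (hh : Measurable h) : M.errMoment 2 α h ≤ (M.errMoment 4 α h) ^ (1 / 2 : ℝ) := by
  rw [errMoment_eq, errMoment_eq]
  exact lintegral_sq_le_sqrt (M.measurable_errFun α hh).aemeasurable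

/-- The segment from `h₀` to `h`. -/
def segment (M : MomentModel 𝒵 𝒳 d ℓ) (h : 𝒳 → Vec ℓ) (s : ℝ) (x : 𝒳) : Vec ℓ :=
  M.h₀ x + s • (h x - M.h₀ x)

theorem segment_mem (M : MomentModel 𝒵 𝒳 d ℓ) {h : 𝒳 → Vec ℓ} (hh : h ∈ M.ℋ) {s : ℝ}
    (h0 : 0 ≤ s) (h1 : s ≤ 1) : M.segment h s ∈ M.ℋ := by
  have := M.starConvex_ℋ hh (sub_nonneg.2 h1) h0 (sub_add_cancel 1 s)
  convert this using 1
  ext1 x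
  simp only [segment, Pi.add_apply, Pi.smul_apply]
  module

theorem errMoment_segment_le (M : MomentModel 𝒵 𝒳 d ℓ) (c : ℕ) (α : Fin ℓ → ℕ) (h : 𝒳 → Vec ℓ)
    {s : ℝ} (h0 : 0 ≤ s) (h1 : s ≤ 1) :
    M.errMoment c α (M.segment h s) ≤ M.errMoment c α h := by
  refine lintegral_mono fun z => Finset.prod_le_prod' fun i _ => ?_
  gcongr
  simp only [segment, PiLp.add_apply, PiLp.smul_apply, PiLp.sub_apply, add_sub_cancel_left,
    smul_eq_mul, enorm_mul]
  refine mul_le_of_le_one_left zero_le ?_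
  rw [Real.enorm_eq_ofReal h0]
  exact ENNReal.ofReal_le_one.2 h1

/-- Errors shrink towards `h₀` and `ℋ` is star-shaped, so the regularity bounds also hold at the
intermediate points of the Taylor remainder. -/
theorem segment_mem_ballh {h : 𝒳 → Vec ℓ} (hh : h ∈ M.ballh k r) {s : ℝ} (h0 : 0 ≤ s)
    (h1 : s ≤ 1) : M.segment h s ∈ M.ballh k r :=
  ⟨M.segment_mem hh.1 h0 h1, fun α hα hk =>
    (M.errMoment_segment_le 2 α h h0 h1).trans (hh.2 α hα hk)⟩

/-- A non-zero multi-index contributes a factor that is a positive power of zero. -/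
theorem h₀_mem_ballh (M : MomentModel 𝒵 𝒳 d ℓ) : M.h₀ ∈ M.ballh k r := by
  refine ⟨M.h₀_mem, fun α hα _ => ?_⟩
  obtain ⟨i, hi⟩ := Function.ne_iff.1 hα
  have : M.errMoment 2 α M.h₀ = 0 := by
    unfold errMoment
    convert lintegral_zero with z
    refine Finset.prod_eq_zero (Finset.mem_univ i) ?_
    simpa using hi
  simp [this]

theorem measurable_of_mem_ballh {h : 𝒳 → Vec ℓ} (hh : h ∈ M.ballh k r) : Measurable h :=
  M.measurable_ℋ h hh.1

/-- The bound on the fourth moments of the higher-order differentials. -/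
noncomputable def multiDerivBound (M : MomentModel 𝒵 𝒳 d ℓ) (k : ℕ) (r : ℝ) : ℝ≥0∞ :=
  ⨆ (α : Fin ℓ → ℕ) (_ : order α ≤ k + 1), ⨆ h ∈ M.ballh k r,
    ∫⁻ z, ‖multiDeriv α (M.m z M.θ₀) (h (M.X z))‖ₑ ^ 4 ∂M.law

theorem lintegral_multiDeriv_le {α : Fin ℓ → ℕ} (hα : order α ≤ k + 1) {h : 𝒳 → Vec ℓ}
    (hh : h ∈ M.ballh k r) :
    ∫⁻ z, ‖multiDeriv α (M.m z M.θ₀) (h (M.X z))‖ₑ ^ 4 ∂M.law ≤ M.multiDerivBound k r := by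
  unfold multiDerivBound
  refine le_trans ?_ (le_iSup₂_of_le α hα le_rfl)
  exact le_iSup₂_of_le (f := fun h (_ : h ∈ M.ballh k r) =>
    ∫⁻ z, ‖multiDeriv α (M.m z M.θ₀) (h (M.X z))‖ₑ ^ 4 ∂M.law) h hh le_rfl

theorem IsSmooth.measurable_multiDeriv_comp (hs : M.IsSmooth k) {α : Fin ℓ → ℕ}
    (hα : order α ≤ k + 1) {h : 𝒳 → Vec ℓ} (hh : Measurable h) :
    Measurable fun z => multiDeriv α (M.m z M.θ₀) (h (M.X z)) :=
  (hs.measurable_multiDeriv hα).comp (measurable_id.prodMk (hh.comp M.measurable_X))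

theorem lintegral_multiDeriv_sq_le (hs : M.IsSmooth k) {α : Fin ℓ → ℕ} (hα : order α ≤ k + 1)
    {h : 𝒳 → Vec ℓ} (hh : h ∈ M.ballh k r) :
    ∫⁻ z, ‖multiDeriv α (M.m z M.θ₀) (h (M.X z))‖ₑ ^ 2 ∂M.law ≤
      M.multiDerivBound k r ^ (1 / 2 : ℝ) := by
  refine (lintegral_sq_le_sqrt (hs.measurable_multiDeriv_comp hα
    (measurable_of_mem_ballh hh)).enorm.aemeasurable).trans ?_
  gcongr
  exact lintegral_multiDeriv_le hα hh

/-- The first moment of a term of the Taylor expansion. -/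
theorem lintegral_errFun_mul_multiDeriv_le (hs : M.IsSmooth k) {α : Fin ℓ → ℕ}
    (hα : order α ≤ k + 1) {h : 𝒳 → Vec ℓ} (hh : Measurable h) {g : 𝒳 → Vec ℓ}
    (hg : g ∈ M.ballh k r) :
    ∫⁻ z, M.errFun α h z * ‖multiDeriv α (M.m z M.θ₀) (g (M.X z))‖ₑ ∂M.law ≤
      (M.errMoment 2 α h) ^ (1 / 2 : ℝ) * (M.multiDerivBound k r ^ (1 / 2 : ℝ)) ^ (1 / 2 : ℝ) := by
  refine (lintegral_mul_le_sqrt_mul_sqrt (M.measurable_errFun α hh).aemeasurable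
    (hs.measurable_multiDeriv_comp hα (measurable_of_mem_ballh hg)).enorm.aemeasurable).trans ?_
  rw [← errMoment_eq]
  gcongr
  exact lintegral_multiDeriv_sq_le hs hα hg

/-- The second moment of a term of the Taylor expansion. -/
theorem lintegral_errFun_mul_multiDeriv_sq_le (hs : M.IsSmooth k) {α : Fin ℓ → ℕ}
    (hα : order α ≤ k + 1) {h : 𝒳 → Vec ℓ} (hh : Measurable h) {g : 𝒳 → Vec ℓ}
    (hg : g ∈ M.ballh k r) :
    ∫⁻ z, (M.errFun α h z * ‖multiDeriv α (M.m z M.θ₀) (g (M.X z))‖ₑ) ^ 2 ∂M.law ≤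
      (M.errMoment 4 α h) ^ (1 / 2 : ℝ) * M.multiDerivBound k r ^ (1 / 2 : ℝ) := by
  simp only [mul_pow]
  refine (lintegral_mul_le_sqrt_mul_sqrt ((M.measurable_errFun α hh).pow_const 2).aemeasurable
    ((hs.measurable_multiDeriv_comp hα
      (measurable_of_mem_ballh hg)).enorm.pow_const 2).aemeasurable).trans ?_
  simp only [← pow_mul]
  norm_num only
  rw [← errMoment_eq]
  gcongr
  exact lintegral_multiDeriv_le hα hg

/-- A term of the Taylor expansion around `h₀`. -/
noncomputable def taylorTerm (M : MomentModel 𝒵 𝒳 d ℓ) {j : ℕ} (w : Fin j → Fin ℓ)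
    (h : 𝒳 → Vec ℓ) (z : 𝒵) : Vec d :=
  (∏ t, (h (M.X z) - M.h₀ (M.X z)) (w t)) • multiDeriv (wordIndex w) (M.m z M.θ₀) (M.h₀ (M.X z))

theorem prod_enorm_eq_errFun (M : MomentModel 𝒵 𝒳 d ℓ) {j : ℕ} (w : Fin j → Fin ℓ)
    (h : 𝒳 → Vec ℓ) (z : 𝒵) :
    ∏ t, ‖(h (M.X z) - M.h₀ (M.X z)) (w t)‖ₑ = M.errFun (wordIndex w) h z :=
  prod_word w fun i => ‖(h (M.X z) - M.h₀ (M.X z)) i‖ₑ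

theorem enorm_prod_real {ι : Type*} (s : Finset ι) (f : ι → ℝ) : ‖∏ t ∈ s, f t‖ₑ = ∏ t ∈ s, ‖f t‖ₑ := by
  rw [← ofReal_norm, norm_prod, ENNReal.ofReal_prod_of_nonneg fun _ _ => norm_nonneg _]
  exact Finset.prod_congr rfl fun t _ => ofReal_norm (f t)

theorem enorm_taylorTerm (M : MomentModel 𝒵 𝒳 d ℓ) {j : ℕ} (w : Fin j → Fin ℓ) (h : 𝒳 → Vec ℓ)
    (z : 𝒵) : ‖M.taylorTerm w h z‖ₑ = M.errFun (wordIndex w) h z *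
      ‖multiDeriv (wordIndex w) (M.m z M.θ₀) (M.h₀ (M.X z))‖ₑ := by
  rw [taylorTerm, enorm_smul, enorm_prod_real, prod_enorm_eq_errFun]

/-- Terms of the Taylor expansion that belong to `S` have mean zero. -/
theorem integral_taylorTerm_eq_zero {S : Set (Fin ℓ → ℕ)} (hs : M.IsSmooth k)
    (ho : M.IsOrthogonal S) {j : ℕ} (w : Fin j → Fin ℓ) (hj : j ≤ k + 1)
    (hw : wordIndex w ∈ S) {h : 𝒳 → Vec ℓ} (hh : Measurable h)
    (hfin : ∫⁻ z, ‖M.taylorTerm w h z‖ₑ ^ 2 ∂M.law ≠ ∞) :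
    ∫ z, M.taylorTerm w h z ∂M.law = 0 := by
  obtain ⟨hint, hcond⟩ := ho _ hw
  have hord : order (wordIndex w) ≤ k + 1 := by rwa [order_wordIndex]
  set D : 𝒵 → Vec d := fun z => multiDeriv (wordIndex w) (M.m z M.θ₀) (M.h₀ (M.X z)) with hD
  set p : 𝒵 → ℝ := fun z => ∏ t, (h (M.X z) - M.h₀ (M.X z)) (w t) with hp
  have hpX : Measurable fun x => ∏ t, (h x - M.h₀ x) (w t) := by
    have := M.measurable_h₀
    fun_prop
  have hpm : Measurable[MeasurableSpace.comap M.X inferInstance] p :=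
    hpX.comp (comap_measurable M.X)
  have hle : MeasurableSpace.comap M.X inferInstance ≤ (inferInstance : MeasurableSpace 𝒵) :=
    M.measurable_X.comap_le
  have hmeas : Measurable (M.taylorTerm w h) :=
    (hpX.comp M.measurable_X).smul (hs.measurable_multiDeriv_comp hord M.measurable_h₀)
  have hL2 : MemLp (M.taylorTerm w h) 2 M.law := by
    refine ⟨hmeas.aestronglyMeasurable, ?_⟩
    rw [eLpNorm_lt_top_iff_lintegral_rpow_enorm_lt_top (by norm_num) (by norm_num)]
    simpa using hfin.lt_top
  have hI : Integrable (p • D) M.law := hL2.integrable (by norm_num)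
  -- The product of errors depends on X only and can be pulled out of the conditional expectation;
  -- the finite second moment makes the whole term integrable.
  have h1 := condExp_smul_of_aestronglyMeasurable_left
    (m := MeasurableSpace.comap M.X inferInstance) hpm.stronglyMeasurable.aestronglyMeasurable hI
    hint
  have h2 : M.law[p • D | MeasurableSpace.comap M.X inferInstance] =ᵐ[M.law] 0 := by
    filter_upwards [h1, hcond] with z hz1 hz2
    rw [hz1, Pi.smul_apply', hz2]
    simp
  calc ∫ z, M.taylorTerm w h z ∂M.law = ∫ z, (p • D) z ∂M.law := rfl
    _ = ∫ z, (M.law[p • D | MeasurableSpace.comap M.X inferInstance]) z ∂M.law :=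
      (integral_condExp hle).symm
    _ = 0 := by rw [integral_congr_ae h2]; simp

end MomentModel
-- Suprema over countable dense subsets.
section CountableDense

variable {E : Type*} [PseudoMetricSpace E] [SecondCountableTopology E]

/-- A countable dense subset of `s`. -/
noncomputable def countableDense (s : Set E) : Set E :=
  (TopologicalSpace.IsSeparable.of_separableSpace s).exists_countable_dense_subset.choose

theorem countableDense_spec (s : Set E) :
    countableDense s ⊆ s ∧ (countableDense s).Countable ∧ s ⊆ closure (countableDense s) :=
  (TopologicalSpace.IsSeparable.of_separableSpace s).exists_countable_dense_subset.choose_spec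

/-- For a function continuous in θ a countable supremum suffices, and countable suprema remain
measurable in the data. -/
theorem le_biSup_countableDense {s : Set E} {f : E → ℝ≥0∞} (hf : Continuous f) {x : E}
    (hx : x ∈ s) : f x ≤ ⨆ y ∈ countableDense s, f y := by
  have hc : IsClosed {x | f x ≤ ⨆ y ∈ countableDense s, f y} := isClosed_le hf continuous_const
  have hsub : countableDense s ⊆ {x | f x ≤ ⨆ y ∈ countableDense s, f y} :=
    fun y hy => le_iSup₂_of_le (f := fun y (_ : y ∈ countableDense s) => f y) y hy le_rfl
  exact closure_minimal hsub hc ((countableDense_spec s).2.2 hx)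

theorem biSup_countableDense_le {s : Set E} (f : E → ℝ≥0∞) :
    ⨆ y ∈ countableDense s, f y ≤ ⨆ y ∈ s, f y :=
  biSup_mono fun _ hy => (countableDense_spec s).1 hy

theorem biSup_countableDense_mono {s t : Set E} (hst : s ⊆ t) {f : E → ℝ≥0∞} (hf : Continuous f) :
    ⨆ y ∈ countableDense s, f y ≤ ⨆ y ∈ countableDense t, f y :=
  iSup₂_le fun _ hy => le_biSup_countableDense hf (hst ((countableDense_spec s).1 hy))

end CountableDense

/-- Tonelli, then a bound uniform in s over an interval of mass one. This converts pointwise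
remainder bounds into bounds in mean. -/
theorem lintegral_lintegral_Icc_le {𝒵 ι : Type*} [MeasurableSpace 𝒵] {μ : Measure 𝒵} [SFinite μ]
    [Fintype ι] {F : ι → ℝ → 𝒵 → ℝ≥0∞} (hF : ∀ w, Measurable fun q : ℝ × 𝒵 => F w q.1 q.2)
    {B : ι → ℝ≥0∞} (h : ∀ w s, 0 ≤ s → s ≤ 1 → ∫⁻ z, F w s z ∂μ ≤ B w) :
    ∫⁻ z, (∫⁻ s in Set.Icc (0 : ℝ) 1, ∑ w, F w s z) ∂μ ≤ ∑ w, B w := by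
  have hm : Measurable fun q : 𝒵 × ℝ => ∑ w, F w q.2 q.1 :=
    Finset.measurable_fun_sum _ fun w _ => (hF w).comp measurable_swap
  rw [lintegral_lintegral_swap hm.aemeasurable]
  calc ∫⁻ s in Set.Icc (0 : ℝ) 1, (∫⁻ z, ∑ w, F w s z ∂μ)
      ≤ ∫⁻ _ in Set.Icc (0 : ℝ) 1, ∑ w, B w := by
        refine setLIntegral_mono' measurableSet_Icc fun s hs => ?_
        have hms (w : ι) : Measurable fun z => F w s z := (hF w).comp measurable_prodMk_left
        rw [lintegral_finsetSum _ fun w _ => hms w]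
        exact Finset.sum_le_sum fun w _ => h w s hs.1 hs.2
    _ = ∑ w, B w := by simp

/-! ### Operator norms bounded by entries. -/

section MatrixNorm

variable {d : ℕ}

theorem norm_le_sum_coord (x : Vec d) : ‖x‖ ≤ ∑ i, |x i| := by
  conv_lhs => rw [← (EuclideanSpace.basisFun (Fin d) ℝ).sum_repr x]
  refine (norm_sum_le _ _).trans (Finset.sum_le_sum fun i _ => ?_)
  simp [norm_smul]

theorem norm_toEuclideanCLM_le (B : Matrix (Fin d) (Fin d) ℝ) :
    ‖Matrix.toEuclideanCLM (𝕜 := ℝ) B‖ ≤ ∑ i, ∑ j, |B i j| := by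
  refine ContinuousLinearMap.opNorm_le_bound _ (by positivity) fun v => ?_
  refine (norm_le_sum_coord _).trans ?_
  rw [Finset.sum_mul]
  refine Finset.sum_le_sum fun i _ => ?_
  rw [Finset.sum_mul]
  simp only [Matrix.ofLp_toEuclideanCLM, Matrix.mulVec, dotProduct]
  refine (Finset.abs_sum_le_sum_abs _ _).trans (Finset.sum_le_sum fun j _ => ?_)
  rw [abs_mul]
  gcongr
  exact PiLp.norm_apply_le v j

end MatrixNorm

/-! ### The Taylor remainder and the variation of the Jacobian. -/

namespace MomentModel

variable {𝒵 𝒳 : Type*} [MeasurableSpace 𝒵] [MeasurableSpace 𝒳] {d ℓ k : ℕ}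
  {M : MomentModel 𝒵 𝒳 d ℓ} {r : ℝ}

/-- The remainder of the Taylor expansion around `h₀`. -/
noncomputable def taylorRem (M : MomentModel 𝒵 𝒳 d ℓ) (k : ℕ) (h : 𝒳 → Vec ℓ) (z : 𝒵) : Vec d :=
  M.m z M.θ₀ (h (M.X z)) - M.m z M.θ₀ (M.h₀ (M.X z)) -
    ∑ j ∈ Finset.Icc 1 k, ((j.factorial : ℝ)⁻¹) • ∑ w : Fin j → Fin ℓ, M.taylorTerm w h z

theorem measurable_segment_param (M : MomentModel 𝒵 𝒳 d ℓ) {h : 𝒳 → Vec ℓ} (hh : Measurable h) :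
    Measurable fun q : ℝ × 𝒵 => M.segment h q.1 (M.X q.2) := by
  have h1 : Measurable fun q : ℝ × 𝒵 => h (M.X q.2) := hh.comp (M.measurable_X.comp measurable_snd)
  have h2 : Measurable fun q : ℝ × 𝒵 => M.h₀ (M.X q.2) :=
    M.measurable_h₀.comp (M.measurable_X.comp measurable_snd)
  exact h2.add (measurable_fst.smul (h1.sub h2))

theorem enorm_taylorRem_le (hs : M.IsSmooth k) (h : 𝒳 → Vec ℓ) (z : 𝒵) :
    ‖M.taylorRem k h z‖ₑ ≤ ∫⁻ s in Set.Icc (0 : ℝ) 1, ∑ w : Fin (k + 1) → Fin ℓ,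
      M.errFun (wordIndex w) h z *
        ‖multiDeriv (wordIndex w) (M.m z M.θ₀) (M.segment h s (M.X z))‖ₑ := by
  have := enorm_multivariate_taylor_le (hs.nDifferentiable z) (M.h₀ (M.X z))
    (h (M.X z) - M.h₀ (M.X z))
  simp only [add_sub_cancel, prod_enorm_eq_errFun] at this
  exact this

/-- The first moment of the remainder of the Taylor expansion. -/
theorem lintegral_taylorRem_le (hs : M.IsSmooth k) {h : 𝒳 → Vec ℓ} (hh : h ∈ M.ballh k r) :
    ∫⁻ z, ‖M.taylorRem k h z‖ₑ ∂M.law ≤ ∑ w : Fin (k + 1) → Fin ℓ,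
      (M.errMoment 2 (wordIndex w) h) ^ (1 / 2 : ℝ) *
        (M.multiDerivBound k r ^ (1 / 2 : ℝ)) ^ (1 / 2 : ℝ) := by
  have hhm := measurable_of_mem_ballh hh
  have hm (w : Fin (k + 1) → Fin ℓ) : Measurable fun q : ℝ × 𝒵 => M.errFun (wordIndex w) h q.2 *
      ‖multiDeriv (wordIndex w) (M.m q.2 M.θ₀) (M.segment h q.1 (M.X q.2))‖ₑ := by
    refine ((M.measurable_errFun _ hhm).comp measurable_snd).mul (Measurable.enorm ?_)
    exact (hs.measurable_multiDeriv (order_wordIndex w).le).comp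
      (measurable_snd.prodMk (M.measurable_segment_param hhm))
  refine (lintegral_mono fun z => enorm_taylorRem_le hs h z).trans ?_
  exact lintegral_lintegral_Icc_le (F := fun w s z => M.errFun (wordIndex w) h z *
    ‖multiDeriv (wordIndex w) (M.m z M.θ₀) (M.segment h s (M.X z))‖ₑ) hm fun w s h0 h1 =>
      lintegral_errFun_mul_multiDeriv_le hs (order_wordIndex w).le hhm
        (segment_mem_ballh hh h0 h1)

/-- The entrywise distance of Jacobians. -/
noncomputable def gradDist (M : MomentModel 𝒵 𝒳 d ℓ) (z : 𝒵) (θ θ' : Vec d) (γ γ' : Vec ℓ) :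
    ℝ≥0∞ :=
  ∑ i, ∑ j, ‖M.gradθ z θ γ i j - M.gradθ z θ' γ' i j‖ₑ

/-- The change of the Jacobian when `h₀` is replaced by `h`. -/
noncomputable def gradDiff (M : MomentModel 𝒵 𝒳 d ℓ) (r : ℝ) (h : 𝒳 → Vec ℓ) (z : 𝒵) : ℝ≥0∞ :=
  ⨆ θ ∈ countableDense (M.ballθ r), M.gradDist z θ θ (h (M.X z)) (M.h₀ (M.X z))

/-- The modulus of continuity at `θ₀` of the Jacobian. -/
noncomputable def gradModulus (M : MomentModel 𝒵 𝒳 d ℓ) (r : ℝ) (z : 𝒵) : ℝ≥0∞ :=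
  ⨆ θ ∈ countableDense (M.ballθ r), M.gradDist z θ M.θ₀ (M.h₀ (M.X z)) (M.h₀ (M.X z))

theorem IsSmooth.continuous_gradθ_left (hs : M.IsSmooth k) (z : 𝒵) (γ : Vec ℓ) (i j : Fin d) :
    Continuous fun θ => M.gradθ z θ γ i j :=
  (hs.continuous_gradθ z i j).comp (continuous_id.prodMk continuous_const)

theorem IsSmooth.continuous_gradDist_diag (hs : M.IsSmooth k) (z : 𝒵) (γ γ' : Vec ℓ) :
    Continuous fun θ => M.gradDist z θ θ γ γ' :=
  continuous_finsetSum _ fun i _ => continuous_finsetSum _ fun j _ =>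
    ((hs.continuous_gradθ_left z γ i j).sub (hs.continuous_gradθ_left z γ' i j)).enorm

theorem IsSmooth.continuous_gradDist_left (hs : M.IsSmooth k) (z : 𝒵) (θ' : Vec d) (γ γ' : Vec ℓ) :
    Continuous fun θ => M.gradDist z θ θ' γ γ' :=
  continuous_finsetSum _ fun i _ => continuous_finsetSum _ fun j _ =>
    ((hs.continuous_gradθ_left z γ i j).sub continuous_const).enorm

theorem IsSmooth.gradDist_le_gradDiff (hs : M.IsSmooth k) {θ : Vec d} (hθ : θ ∈ M.ballθ r)
    (h : 𝒳 → Vec ℓ) (z : 𝒵) :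
    M.gradDist z θ θ (h (M.X z)) (M.h₀ (M.X z)) ≤ M.gradDiff r h z := by
  unfold gradDiff
  exact le_biSup_countableDense (hs.continuous_gradDist_diag z (h (M.X z)) (M.h₀ (M.X z))) hθ

theorem IsSmooth.gradDist_le_gradModulus (hs : M.IsSmooth k) {θ : Vec d} (hθ : θ ∈ M.ballθ r)
    (z : 𝒵) :
    M.gradDist z θ M.θ₀ (M.h₀ (M.X z)) (M.h₀ (M.X z)) ≤ M.gradModulus r z := by
  unfold gradModulus
  exact le_biSup_countableDense
    (hs.continuous_gradDist_left z M.θ₀ (M.h₀ (M.X z)) (M.h₀ (M.X z))) hθ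

theorem gradDist_triangle (M : MomentModel 𝒵 𝒳 d ℓ) (z : 𝒵) (θ θ' θ'' : Vec d)
    (γ γ' γ'' : Vec ℓ) :
    M.gradDist z θ θ'' γ γ'' ≤ M.gradDist z θ θ' γ γ' + M.gradDist z θ' θ'' γ' γ'' := by
  unfold gradDist
  simp only [← Finset.sum_add_distrib]
  refine Finset.sum_le_sum fun i _ => Finset.sum_le_sum fun j _ => ?_
  rw [← sub_add_sub_cancel _ (M.gradθ z θ' γ' i j)]
  exact enorm_add_le _ _

theorem IsSmooth.measurable_gradDiff (hs : M.IsSmooth k) (r : ℝ) {𝒲 : Type*} [MeasurableSpace 𝒲]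
    {H : 𝒲 → 𝒳 → Vec ℓ} (hH : Measurable fun q : 𝒲 × 𝒳 => H q.1 q.2) :
    Measurable fun q : 𝒵 × 𝒲 => M.gradDiff r (H q.2) q.1 := by
  refine Measurable.biSup _ (countableDense_spec _).2.1 fun θ _ => ?_
  refine Finset.measurable_fun_sum _ fun i _ => Finset.measurable_fun_sum _ fun j _ => ?_
  refine Measurable.enorm (Measurable.sub ?_ ?_)
  · exact (hs.measurable_gradθ θ i j).comp (measurable_fst.prodMk
      (hH.comp (measurable_snd.prodMk (M.measurable_X.comp measurable_fst))))
  · exact (hs.measurable_gradθ θ i j).comp (measurable_fst.prodMk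
      (M.measurable_h₀.comp (M.measurable_X.comp measurable_fst)))

theorem IsSmooth.measurable_gradθ_comp (hs : M.IsSmooth k) (θ : Vec d) (i j : Fin d) :
    Measurable fun z => M.gradθ z θ (M.h₀ (M.X z)) i j :=
  (hs.measurable_gradθ θ i j).comp
    (measurable_id.prodMk (M.measurable_h₀.comp M.measurable_X))

theorem IsSmooth.measurable_gradModulus (hs : M.IsSmooth k) (r : ℝ) :
    Measurable (M.gradModulus r) := by
  refine Measurable.biSup _ (countableDense_spec _).2.1 fun θ _ => ?_
  refine Finset.measurable_fun_sum _ fun i _ => Finset.measurable_fun_sum _ fun j _ => ?_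
  exact ((hs.measurable_gradθ_comp θ i j).sub (hs.measurable_gradθ_comp M.θ₀ i j)).enorm

theorem IsSmooth.gradDist_le (hs : M.IsSmooth k) {θ : Vec d} {ρ : ℝ} (hρ : ρ ≤ r)
    (hθ : θ ∈ M.ballθ ρ) (h : 𝒳 → Vec ℓ) (z : 𝒵) :
    M.gradDist z θ M.θ₀ (h (M.X z)) (M.h₀ (M.X z)) ≤ M.gradDiff r h z + M.gradModulus ρ z := by
  exact (M.gradDist_triangle z θ θ M.θ₀ _ (M.h₀ (M.X z)) _).trans
    (add_le_add (hs.gradDist_le_gradDiff ⟨hθ.1, hθ.2.trans hρ⟩ h z)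
      (hs.gradDist_le_gradModulus hθ z))

theorem IsSmooth.gradModulus_mono (hs : M.IsSmooth k) {ρ ρ' : ℝ} (hρ : ρ ≤ ρ') (z : 𝒵) :
    M.gradModulus ρ z ≤ M.gradModulus ρ' z := by
  have hsub : M.ballθ ρ ⊆ M.ballθ ρ' := fun _ hθ => ⟨hθ.1, hθ.2.trans hρ⟩
  unfold gradModulus
  exact biSup_countableDense_mono hsub
    (hs.continuous_gradDist_left z M.θ₀ (M.h₀ (M.X z)) (M.h₀ (M.X z)))

theorem enorm_gradθ_le (M : MomentModel 𝒵 𝒳 d ℓ) (z : 𝒵) (θ : Vec d) (γ : Vec ℓ) (i j : Fin d) :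
    ‖M.gradθ z θ γ i j‖ₑ ≤ (M.gradθNormSq z θ γ) ^ (1 / 2 : ℝ) := by
  have h : ‖M.gradθ z θ γ i j‖ₑ ^ 2 ≤ M.gradθNormSq z θ γ :=
    (Finset.single_le_sum (f := fun j => ‖M.gradθ z θ γ i j‖ₑ ^ 2)
      (fun _ _ => zero_le) (Finset.mem_univ j)).trans
      (Finset.single_le_sum (f := fun i => ∑ j, ‖M.gradθ z θ γ i j‖ₑ ^ 2)
        (fun _ _ => zero_le) (Finset.mem_univ i))
  calc ‖M.gradθ z θ γ i j‖ₑ = (‖M.gradθ z θ γ i j‖ₑ ^ 2) ^ (1 / 2 : ℝ) := by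
        rw [← ENNReal.rpow_natCast, ← ENNReal.rpow_mul]; norm_num
    _ ≤ _ := by gcongr

theorem enorm_pderiv_gradθ_le (M : MomentModel 𝒵 𝒳 d ℓ) (z : 𝒵) (θ : Vec d) (γ : Vec ℓ)
    (a : Fin ℓ) (i j : Fin d) :
    ‖pderiv a (fun γ' => M.gradθ z θ γ' i j) γ‖ₑ ≤ (M.gradγθNormSq z θ γ) ^ (1 / 2 : ℝ) := by
  have h : ‖pderiv a (fun γ' => M.gradθ z θ γ' i j) γ‖ₑ ^ 2 ≤ M.gradγθNormSq z θ γ :=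
    ((Finset.single_le_sum (f := fun j => ‖pderiv a (fun γ' => M.gradθ z θ γ' i j) γ‖ₑ ^ 2)
      (fun _ _ => zero_le) (Finset.mem_univ j)).trans
      (Finset.single_le_sum (f := fun i => ∑ j, ‖pderiv a (fun γ' => M.gradθ z θ γ' i j) γ‖ₑ ^ 2)
        (fun _ _ => zero_le) (Finset.mem_univ i))).trans
      (Finset.single_le_sum
        (f := fun a => ∑ i, ∑ j, ‖pderiv a (fun γ' => M.gradθ z θ γ' i j) γ‖ₑ ^ 2)
        (fun _ _ => zero_le) (Finset.mem_univ a))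
  calc ‖pderiv a (fun γ' => M.gradθ z θ γ' i j) γ‖ₑ
      = (‖pderiv a (fun γ' => M.gradθ z θ γ' i j) γ‖ₑ ^ 2) ^ (1 / 2 : ℝ) := by
        rw [← ENNReal.rpow_natCast, ← ENNReal.rpow_mul]; norm_num
    _ ≤ _ := by gcongr

/-- The bound on the mixed second derivatives. -/
noncomputable def gradγθBound (M : MomentModel 𝒵 𝒳 d ℓ) (k : ℕ) (r : ℝ) : ℝ≥0∞ :=
  ⨆ h ∈ M.ballh k r, ∫⁻ z, ⨆ θ ∈ M.ballθ r, M.gradγθNormSq z θ (h (M.X z)) ∂M.law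

theorem errFun_single (M : MomentModel 𝒵 𝒳 d ℓ) (a : Fin ℓ) (h : 𝒳 → Vec ℓ) (z : 𝒵) :
    M.errFun (Pi.single a 1) h z = ‖h (M.X z) a - M.h₀ (M.X z) a‖ₑ := by
  unfold errFun
  rw [Finset.prod_eq_single a]
  · simp
  · intro b _ hb
    simp [Pi.single_eq_of_ne hb]
  · simp

/-- Each of the d² entries changes by at most the integral of its γ-derivative along the segment
from `h₀` to `h`. The supremum over θ is taken under the integral, which makes the bound uniform in
θ. -/
theorem gradDiff_le (hs : M.IsSmooth k) (h : 𝒳 → Vec ℓ) (z : 𝒵) :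
    M.gradDiff r h z ≤ (d * d : ℕ) * ∫⁻ s in Set.Icc (0 : ℝ) 1, ∑ a,
      M.errFun (Pi.single a 1) h z *
        (⨆ θ ∈ countableDense (M.ballθ r), M.gradγθNormSq z θ (M.segment h s (M.X z))) ^
          (1 / 2 : ℝ) := by
  refine iSup₂_le fun θ hθ => ?_
  have key (i j : Fin d) : ‖M.gradθ z θ (h (M.X z)) i j - M.gradθ z θ (M.h₀ (M.X z)) i j‖ₑ ≤
      ∫⁻ s in Set.Icc (0 : ℝ) 1, ∑ a, M.errFun (Pi.single a 1) h z *
        (⨆ θ ∈ countableDense (M.ballθ r), M.gradγθNormSq z θ (M.segment h s (M.X z))) ^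
          (1 / 2 : ℝ) := by
    set v := h (M.X z) - M.h₀ (M.X z) with hv
    have hder (s : ℝ) : HasDerivAt (fun s => M.gradθ z θ (M.segment h s (M.X z)) i j)
        (∑ a, v a • pderiv a (fun γ => M.gradθ z θ γ i j) (M.segment h s (M.X z))) s := by
      rw [← fderiv_eq_sum_pderiv]
      have hline : HasDerivAt (fun s : ℝ => M.segment h s (M.X z)) v s := by
        simpa [segment] using ((hasDerivAt_id s).smul_const v).const_add (M.h₀ (M.X z))
      exact (hs.differentiable_θγ z θ i j _).hasFDerivAt.comp_hasDerivAt s hline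
    have h1 := enorm_sub_le_lintegral_deriv zero_le_one le_rfl hder
    simp only [segment, one_smul, zero_smul, add_zero, add_sub_cancel] at h1
    refine h1.trans (lintegral_mono fun s => ?_)
    refine (enorm_sum_le _ _).trans (Finset.sum_le_sum fun a _ => ?_)
    rw [enorm_smul, errFun_single]
    refine mul_le_mul' le_rfl ((M.enorm_pderiv_gradθ_le z θ _ a i j).trans ?_)
    gcongr
    exact le_iSup₂_of_le (f := fun θ (_ : θ ∈ countableDense (M.ballθ r)) =>
      M.gradγθNormSq z θ (M.segment h s (M.X z))) θ hθ le_rfl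
  refine (Finset.sum_le_sum fun i _ => Finset.sum_le_sum fun j _ => key i j).trans ?_
  simp [mul_assoc]

theorem IsSmooth.measurable_gradγθNormSq (hs : M.IsSmooth k) (θ : Vec d) :
    Measurable fun q : 𝒵 × Vec ℓ => M.gradγθNormSq q.1 θ q.2 := by
  unfold gradγθNormSq
  refine Finset.measurable_fun_sum _ fun a _ => Finset.measurable_fun_sum _ fun i _ =>
    Finset.measurable_fun_sum _ fun j _ => ?_
  exact (hs.measurable_pderiv_gradθ θ i j a).enorm.pow_const 2

/-- The mean change of the Jacobian when `h₀` is replaced by `h`. -/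
theorem lintegral_gradDiff_le (hs : M.IsSmooth k) {h : 𝒳 → Vec ℓ} (hh : h ∈ M.ballh k r) :
    ∫⁻ z, M.gradDiff r h z ∂M.law ≤ (d * d : ℕ) * ∑ a : Fin ℓ,
      (M.errMoment 2 (Pi.single a 1) h) ^ (1 / 2 : ℝ) * M.gradγθBound k r ^ (1 / 2 : ℝ) := by
  have hhm := measurable_of_mem_ballh hh
  have hG : Measurable fun q : ℝ × 𝒵 => ⨆ θ ∈ countableDense (M.ballθ r),
      M.gradγθNormSq q.2 θ (M.segment h q.1 (M.X q.2)) := by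
    refine Measurable.biSup _ (countableDense_spec _).2.1 fun θ _ => ?_
    have h1 := (hs.measurable_gradγθNormSq θ).comp
      (measurable_snd.prodMk (M.measurable_segment_param hhm))
    exact h1
  have hm (a : Fin ℓ) : Measurable fun q : ℝ × 𝒵 => M.errFun (Pi.single a 1) h q.2 *
      (⨆ θ ∈ countableDense (M.ballθ r),
        M.gradγθNormSq q.2 θ (M.segment h q.1 (M.X q.2))) ^ (1 / 2 : ℝ) :=
    ((M.measurable_errFun _ hhm).comp measurable_snd).mul (hG.pow_const _)
  refine (lintegral_mono fun z => gradDiff_le (r := r) hs h z).trans ?_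
  rw [lintegral_const_mul' _ _ (ENNReal.natCast_ne_top _)]
  refine mul_le_mul' le_rfl ?_
  refine lintegral_lintegral_Icc_le (F := fun a s z => M.errFun (Pi.single a 1) h z *
    (⨆ θ ∈ countableDense (M.ballθ r), M.gradγθNormSq z θ (M.segment h s (M.X z))) ^ (1 / 2 : ℝ))
    hm fun a s h0 h1 => ?_
  have hGs : Measurable fun z => ⨆ θ ∈ countableDense (M.ballθ r),
      M.gradγθNormSq z θ (M.segment h s (M.X z)) := by
    have h2 := hG.comp (measurable_prodMk_left (x := s))
    exact h2
  refine (lintegral_mul_le_sqrt_mul_sqrt (M.measurable_errFun _ hhm).aemeasurable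
    (hGs.pow_const _).aemeasurable).trans ?_
  rw [← errMoment_eq]
  refine mul_le_mul' le_rfl (ENNReal.rpow_le_rpow ?_ (by norm_num))
  have hsq (x : ℝ≥0∞) : (x ^ (1 / 2 : ℝ)) ^ 2 = x := by
    rw [← ENNReal.rpow_natCast, ← ENNReal.rpow_mul]; norm_num
  simp only [hsq]
  -- The regularity condition bounds the supremum over the whole ball, which dominates the countable
  -- one.
  refine (lintegral_mono fun z => biSup_countableDense_le (s := M.ballθ r)
    fun θ => M.gradγθNormSq z θ (M.segment h s (M.X z))).trans ?_
  unfold gradγθBound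
  exact le_iSup₂_of_le (f := fun h (_ : h ∈ M.ballh k r) =>
    ∫⁻ z, ⨆ θ ∈ M.ballθ r, M.gradγθNormSq z θ (h (M.X z)) ∂M.law)
    (M.segment h s) (segment_mem_ballh hh h0 h1) le_rfl

theorem IsRegular.lintegral_gradθ_lt_top (hr : M.IsRegular k r) :
    ∫⁻ z, ⨆ θ ∈ countableDense (M.ballθ r), (M.gradθNormSq z θ (M.h₀ (M.X z))) ^ (1 / 2 : ℝ) ∂M.law
      < ∞ :=
  (lintegral_mono fun _ => biSup_countableDense_le _).trans_lt hr.gradθ_dominated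

theorem θ₀_mem_ballθ (M : MomentModel 𝒵 𝒳 d ℓ) {r : ℝ} (hr : 0 ≤ r) : M.θ₀ ∈ M.ballθ r :=
  ⟨M.θ₀_mem, by simpa using hr⟩

theorem IsSmooth.continuous_gradθNormSq_rpow (hs : M.IsSmooth k) (z : 𝒵) (γ : Vec ℓ) :
    Continuous fun θ => (M.gradθNormSq z θ γ) ^ (1 / 2 : ℝ) := by
  refine ENNReal.continuous_rpow_const.comp ?_
  refine continuous_finsetSum _ fun i _ => continuous_finsetSum _ fun j _ => ?_
  exact (ENNReal.continuous_pow 2).comp (hs.continuous_gradθ_left z γ i j).enorm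

theorem integrable_gradθ (hs : M.IsSmooth k) (hr : M.IsRegular k r) (hr0 : 0 < r) (i j : Fin d) :
    Integrable (fun z => M.gradθ z M.θ₀ (M.h₀ (M.X z)) i j) M.law := by
  refine ⟨(hs.measurable_gradθ_comp M.θ₀ i j).aestronglyMeasurable, ?_⟩
  refine lt_of_le_of_lt (lintegral_mono fun z => ?_) hr.lintegral_gradθ_lt_top
  exact (M.enorm_gradθ_le z M.θ₀ _ i j).trans
    (le_biSup_countableDense (hs.continuous_gradθNormSq_rpow z _) (M.θ₀_mem_ballθ hr0.le))

/-- The mean modulus of continuity at `θ₀` of the Jacobian vanishes with the radius. -/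
theorem exists_lintegral_gradModulus_le (hs : M.IsSmooth k) (hr : M.IsRegular k r) (hr0 : 0 < r)
    {ε : ℝ≥0∞} (hε : 0 < ε) : ∃ ρ > 0, ρ ≤ r ∧ ∫⁻ z, M.gradModulus ρ z ∂M.law ≤ ε := by
  set ρ : ℕ → ℝ := fun n => r / (n + 1) with hρ
  have hρ0 (n : ℕ) : 0 < ρ n := by positivity
  have hρr (n : ℕ) : ρ n ≤ r := div_le_self hr0.le (by simp)
  have hρlim : Tendsto ρ atTop (𝓝 0) := by
    simpa [hρ, div_eq_mul_inv] using tendsto_one_div_add_atTop_nhds_zero_nat.const_mul r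
  set b : 𝒵 → ℝ≥0∞ := fun z =>
    ⨆ θ ∈ countableDense (M.ballθ r), (M.gradθNormSq z θ (M.h₀ (M.X z))) ^ (1 / 2 : ℝ) with hb
  -- The dominating function: d² entries, each a difference of two Jacobian entries bounded by the
  -- envelope b.
  have hbound (n : ℕ) (z : 𝒵) : M.gradModulus (ρ n) z ≤ (d * d : ℕ) * (2 * b z) := by
    refine iSup₂_le fun θ hθ => ?_
    have hle (θ : Vec d) (hθ : θ ∈ M.ballθ r) (i j : Fin d) :
        ‖M.gradθ z θ (M.h₀ (M.X z)) i j‖ₑ ≤ b z :=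
      (M.enorm_gradθ_le z θ _ i j).trans
        (le_biSup_countableDense (hs.continuous_gradθNormSq_rpow z _) hθ)
    have hθ' : θ ∈ M.ballθ r := by
      have := (countableDense_spec _).1 hθ
      exact ⟨this.1, this.2.trans (hρr n)⟩
    refine (Finset.sum_le_sum fun i _ => Finset.sum_le_sum fun j _ =>
      (enorm_sub_le.trans (add_le_add (hle θ hθ' i j)
        (hle M.θ₀ (M.θ₀_mem_ballθ hr0.le) i j)))).trans ?_
    simp [mul_assoc, ← two_mul]
  have hlim : Tendsto (fun n => ∫⁻ z, M.gradModulus (ρ n) z ∂M.law) atTop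
      (𝓝 (∫⁻ _, 0 ∂M.law)) := by
    refine tendsto_lintegral_of_dominated_convergence (fun z => (d * d : ℕ) * (2 * b z))
      (fun n => hs.measurable_gradModulus _) (fun n => Eventually.of_forall (hbound n)) ?_ ?_
    · rw [lintegral_const_mul' _ _ (ENNReal.natCast_ne_top _),
        lintegral_const_mul' _ _ (by simp)]
      exact ENNReal.mul_ne_top (ENNReal.natCast_ne_top _)
        (ENNReal.mul_ne_top (by simp) hr.lintegral_gradθ_lt_top.ne)
    -- Pointwise convergence is continuity of the Jacobian at `θ₀`.
    · refine Eventually.of_forall fun z => ?_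
      rw [ENNReal.tendsto_nhds_zero]
      intro η hη
      have hc := hs.continuous_gradDist_left z M.θ₀ (M.h₀ (M.X z)) (M.h₀ (M.X z))
      have h0 : M.gradDist z M.θ₀ M.θ₀ (M.h₀ (M.X z)) (M.h₀ (M.X z)) = 0 := by
        simp [gradDist]
      have hev := (hc.tendsto M.θ₀).eventually (gt_mem_nhds (by rw [h0]; exact hη))
      obtain ⟨δ, hδ, hδη⟩ := Metric.eventually_nhds_iff.1 hev
      filter_upwards [hρlim.eventually (gt_mem_nhds hδ)] with n hn
      refine iSup₂_le fun θ hθ => (hδη ?_).le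
      rw [dist_eq_norm]
      exact ((countableDense_spec _).1 hθ).2.trans_lt hn
  rw [lintegral_zero] at hlim
  obtain ⟨n, hn⟩ := ((ENNReal.tendsto_nhds_zero.1 hlim) ε hε).exists
  exact ⟨ρ n, hρ0 n, hρr n, hn⟩

theorem fderiv_eq_toEuclideanCLM (M : MomentModel 𝒵 𝒳 d ℓ) (z : 𝒵) (θ : Vec d) (γ : Vec ℓ) :
    fderiv ℝ (fun θ => M.m z θ γ) θ = Matrix.toEuclideanCLM (𝕜 := ℝ) (M.gradθ z θ γ) := by
  ext v i
  rw [fderiv_eq_sum_pderiv]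
  simp [Matrix.mulVec, dotProduct, gradθ, mul_comm]

/-- A mean value inequality for the moments. -/
theorem IsSmooth.enorm_m_sub_le (hs : M.IsSmooth k) {θ : Vec d} {z : 𝒵} {γ γ' : Vec ℓ} {K : ℝ≥0∞}
    (hK : ∀ θ' ∈ _root_.segment ℝ M.θ₀ θ, M.gradDist z θ' M.θ₀ γ γ' ≤ K) :
    ‖M.m z θ γ - M.m z M.θ₀ γ -
      Matrix.toEuclideanCLM (𝕜 := ℝ) (M.gradθ z M.θ₀ γ') (θ - M.θ₀)‖ₑ ≤ K * ‖θ - M.θ₀‖ₑ := by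
  -- The case θ = θ₀ is separate because ∞ * 0 = 0 in `ℝ≥0∞`; afterwards an infinite K makes the
  -- bound trivial.
  rcases eq_or_ne θ M.θ₀ with rfl | hne
  · simp
  by_cases hKt : K = ∞
  · rw [hKt, ENNReal.top_mul (by simpa [sub_eq_zero] using hne)]
    exact le_top
  have hbound (θ' : Vec d) (hθ' : θ' ∈ _root_.segment ℝ M.θ₀ θ) :
      ‖fderiv ℝ (fun θ => M.m z θ γ) θ' -
        Matrix.toEuclideanCLM (𝕜 := ℝ) (M.gradθ z M.θ₀ γ')‖ ≤ K.toReal := by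
    rw [fderiv_eq_toEuclideanCLM, ← map_sub]
    refine (norm_toEuclideanCLM_le _).trans ?_
    have := ENNReal.toReal_mono hKt (hK θ' hθ')
    refine le_trans (le_of_eq ?_) this
    unfold gradDist
    rw [ENNReal.toReal_sum fun i _ => ENNReal.sum_ne_top.2 fun j _ => enorm_ne_top]
    refine Finset.sum_congr rfl fun i _ => ?_
    rw [ENNReal.toReal_sum fun j _ => enorm_ne_top]
    simp
  have h := (convex_segment M.θ₀ θ).norm_image_sub_le_of_norm_hasFDerivWithin_le'
    (fun θ' _ => ((hs.differentiable_θ z γ) θ').hasFDerivAt.hasFDerivWithinAt) hbound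
    (left_mem_segment ℝ M.θ₀ θ) (right_mem_segment ℝ M.θ₀ θ)
  rw [← ofReal_norm, ← ofReal_norm, ← ENNReal.ofReal_toReal hKt,
    ← ENNReal.ofReal_mul ENNReal.toReal_nonneg]
  exact ENNReal.ofReal_le_ofReal h

/-- The mean value inequality needs Jacobian bounds on the whole segment, and these are only
available inside `Θ`. -/
theorem exists_segment_subset_ballθ (M : MomentModel 𝒵 𝒳 d ℓ) :
    ∃ δ > 0, ∀ θ ∈ M.Θ, ‖θ - M.θ₀‖ ≤ δ →
      ∀ θ' ∈ _root_.segment ℝ M.θ₀ θ, θ' ∈ M.ballθ ‖θ - M.θ₀‖ := by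
  obtain ⟨δ, hδ, hstar⟩ := M.starConvex_Θ
  refine ⟨δ, hδ, fun θ hθ hθδ θ' hθ' => ?_⟩
  have hmem : θ ∈ M.Θ ∩ Metric.closedBall M.θ₀ δ := ⟨hθ, by simpa [dist_eq_norm] using hθδ⟩
  refine ⟨(hstar.segment_subset hmem hθ').1, ?_⟩
  obtain ⟨a, b, ha, hb, hab, rfl⟩ := hθ'
  have : a • M.θ₀ + b • θ - M.θ₀ = b • (θ - M.θ₀) := by
    rw [← eq_sub_iff_add_eq] at hab; subst hab; module
  rw [this, norm_smul, Real.norm_of_nonneg hb]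
  exact mul_le_of_le_one_left (norm_nonneg _) (by linarith)

end MomentModel
-- Fold schemes and consequences of the first stage conditions.
/-- A scheme that divides the sample points `0, …, N n - 1` into folds, with a nuisance estimate for
each fold that is computed from data independent of the fold. -/
structure FoldScheme {𝒵 𝒳 Ω : Type*} [MeasurableSpace 𝒵] [MeasurableSpace 𝒳] [MeasurableSpace Ω]
    {d ℓ : ℕ} (M : MomentModel 𝒵 𝒳 d ℓ) (P : Measure Ω) (Z : ℕ → Ω → 𝒵) (ι : Type) [Fintype ι]
    (𝒲 : ℕ → ι → Type*) [∀ n j, MeasurableSpace (𝒲 n j)] where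
  /-- the number of sample points -/
  N : ℕ → ℕ
  N_le : ∀ n, N n ≤ 2 * n
  /-- the folds -/
  fold : ℕ → ι → Finset ℕ
  disjoint_fold : ∀ n i j, i ≠ j → Disjoint (fold n i) (fold n j)
  biUnion_fold : ∀ n, Finset.univ.biUnion (fold n) = Finset.range (N n)
  /-- the data for the first stage estimates -/
  W : ∀ n j, Ω → 𝒲 n j
  measurable_W : ∀ n j, Measurable (W n j)
  indep : ∀ n j, IndepFun (subsample Z (fold n j)) (W n j) P
  /-- the first stage estimates -/
  H : ∀ n j, 𝒲 n j → 𝒳 → Vec ℓ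
  H_mem : ∀ n j w, H n j w ∈ M.ℋ
  measurable_H : ∀ n j, Measurable fun q : 𝒲 n j × 𝒳 => H n j q.1 q.2

namespace MomentModel

variable {𝒵 𝒳 Ω : Type*} [MeasurableSpace 𝒵] [MeasurableSpace 𝒳] [MeasurableSpace Ω] {d ℓ k : ℕ}
  {M : MomentModel 𝒵 𝒳 d ℓ} {r : ℝ} {P : Measure Ω} {l : Filter ℕ} {S : Set (Fin ℓ → ℕ)}
  {hhat : ℕ → Ω → 𝒳 → Vec ℓ}

/-- For multi-indices in S, fourth-type moments control second-type ones by Cauchy–Schwarz; for the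
others the rate is stronger than consistency, as √n ≥ 1. -/
theorem FirstStageConditions.errMoment_two (h : M.FirstStageConditions S k P l hhat)
    (hl : l ≤ atTop) (hm : ∀ n ω, hhat n ω ∈ M.ℋ) {α : Fin ℓ → ℕ} (hα : α ≠ 0)
    (hk : order α ≤ k + 1) : TendstoZeroInProb P l fun n ω => M.errMoment 2 α (hhat n ω) := by
  by_cases hS : α ∈ S
  · refine ((h.consistent α hS hα).rpow (p := 1 / 2) (by norm_num)).mono
      (Eventually.of_forall fun n ω => ?_)
    exact M.errMoment_two_le α (M.measurable_ℋ _ (hm n ω))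
  · refine ((h.rate α hα hk hS).pow (p := 2) (by norm_num)).mono ?_
    filter_upwards [hl (eventually_ge_atTop 1)] with n hn ω
    rw [mul_pow, ← ENNReal.rpow_natCast, ← ENNReal.rpow_mul, ← ENNReal.rpow_natCast,
      ← ENNReal.rpow_mul]
    norm_num only [ENNReal.rpow_one]
    exact le_mul_of_one_le_left zero_le (by exact_mod_cast hn)

theorem finite_order_le (ℓ k : ℕ) : {α : Fin ℓ → ℕ | order α ≤ k}.Finite := by
  refine (Fintype.piFinset fun _ : Fin ℓ => Finset.range (k + 1)).finite_toSet.subset ?_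
  intro α hα
  simp only [Finset.mem_coe, Fintype.mem_piFinset, Finset.mem_range]
  intro i
  have : α i ≤ order α := Finset.single_le_sum (fun _ _ => Nat.zero_le _) (Finset.mem_univ i)
  have h2 : order α ≤ k := hα
  omega

/-- Membership in the ball amounts to finitely many moment bounds, each of which holds with
probability tending to one. -/
theorem FirstStageConditions.tendsto_not_mem_ballh (h : M.FirstStageConditions S k P l hhat)
    (hl : l ≤ atTop) (hm : ∀ n ω, hhat n ω ∈ M.ℋ) (hr : 0 < r) :
    Tendsto (fun n => P {ω | hhat n ω ∉ M.ballh k r}) l (𝓝 0) := by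
  classical
  set s := (finite_order_le ℓ (k + 1)).toFinset.filter (· ≠ 0) with hs
  have h1 : Tendsto (fun n => P (⋃ α ∈ s, {ω | ¬ M.errMoment 2 α (hhat n ω) ≤ ENNReal.ofReal r}))
      l (𝓝 0) := by
    refine tendsto_measure_biUnion_zero s fun α hα => ?_
    simp only [hs, Finset.mem_filter, Set.Finite.mem_toFinset, Set.mem_ofPred_eq] at hα
    exact (h.errMoment_two hl hm hα.2 hα.1).tendsto_measure_not (ENNReal.ofReal_pos.2 hr)
  refine tendsto_of_tendsto_of_tendsto_of_le_of_le tendsto_const_nhds h1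
    (fun _ => zero_le) fun n => measure_mono fun ω hω => ?_
  by_contra hc
  refine hω ⟨hm n ω, fun α hα hk => ?_⟩
  simp only [Set.mem_iUnion, not_exists, Set.mem_ofPred_eq, not_not] at hc
  exact hc α (by simp [hs, hα, hk])

variable {𝒲 : Type*} [MeasurableSpace 𝒲] {H : 𝒲 → 𝒳 → Vec ℓ}

theorem measurable_comp_X (hH : Measurable fun q : 𝒲 × 𝒳 => H q.1 q.2) :
    Measurable fun q : 𝒵 × 𝒲 => H q.2 (M.X q.1) := by
  have h := hH.comp (f := fun q : 𝒵 × 𝒲 => (q.2, M.X q.1))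
    (measurable_snd.prodMk (M.measurable_X.comp measurable_fst))
  exact h

theorem IsSmooth.measurable_taylorTerm (hs : M.IsSmooth k)
    (hH : Measurable fun q : 𝒲 × 𝒳 => H q.1 q.2) {j : ℕ} (hj : j ≤ k + 1) (w : Fin j → Fin ℓ) :
    Measurable fun q : 𝒵 × 𝒲 => M.taylorTerm w (H q.2) q.1 := by
  have h1 := measurable_comp_X (M := M) hH
  have h0 : Measurable fun q : 𝒵 × 𝒲 => M.h₀ (M.X q.1) :=
    M.measurable_h₀.comp (M.measurable_X.comp measurable_fst)
  have h2 (t : Fin j) : Measurable fun q : 𝒵 × 𝒲 => (H q.2 (M.X q.1) - M.h₀ (M.X q.1)) (w t) :=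
    (measurable_coord (w t)).comp (h1.sub h0)
  have h3 : Measurable fun q : 𝒵 × 𝒲 => ∏ t, (H q.2 (M.X q.1) - M.h₀ (M.X q.1)) (w t) :=
    Finset.measurable_fun_prod _ fun t _ => h2 t
  have h4 := (hs.measurable_multiDeriv_comp ((order_wordIndex w).trans_le hj)
    M.measurable_h₀).comp (measurable_fst : Measurable (Prod.fst : 𝒵 × 𝒲 → 𝒵))
  exact h3.smul h4

theorem IsSmooth.measurable_m_comp (hs : M.IsSmooth k)
    (hH : Measurable fun q : 𝒲 × 𝒳 => H q.1 q.2) :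
    Measurable fun q : 𝒵 × 𝒲 => M.m q.1 M.θ₀ (H q.2 (M.X q.1)) := by
  have h := (hs.measurable_m_left M.θ₀).comp
    (measurable_fst.prodMk (measurable_comp_X (M := M) hH))
  exact h

theorem IsSmooth.measurable_m_h₀ (hs : M.IsSmooth k) :
    Measurable fun z => M.m z M.θ₀ (M.h₀ (M.X z)) := by
  have h := (hs.measurable_m_left M.θ₀).comp
    (measurable_id.prodMk (M.measurable_h₀.comp M.measurable_X))
  exact h

theorem IsSmooth.measurable_taylorRem (hs : M.IsSmooth k)
    (hH : Measurable fun q : 𝒲 × 𝒳 => H q.1 q.2) :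
    Measurable fun q : 𝒵 × 𝒲 => M.taylorRem k (H q.2) q.1 := by
  have h1 := hs.measurable_m_comp hH
  have h2 : Measurable fun q : 𝒵 × 𝒲 => M.m q.1 M.θ₀ (M.h₀ (M.X q.1)) :=
    hs.measurable_m_h₀.comp measurable_fst
  have h3 : Measurable fun q : 𝒵 × 𝒲 => ∑ j ∈ Finset.Icc 1 k, ((j.factorial : ℝ)⁻¹) •
      ∑ w : Fin j → Fin ℓ, M.taylorTerm w (H q.2) q.1 := by
    refine Finset.measurable_fun_sum _ fun j hj => ?_
    have h4 : Measurable fun q : 𝒵 × 𝒲 => ∑ w : Fin j → Fin ℓ, M.taylorTerm w (H q.2) q.1 :=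
      Finset.measurable_fun_sum _ fun w _ =>
        hs.measurable_taylorTerm hH (by rw [Finset.mem_Icc] at hj; omega) w
    exact h4.const_smul ((j.factorial : ℝ)⁻¹)
  exact (h1.sub h2).sub h3

end MomentModel

theorem ofReal_inv_sqrt_sq_mul_le {a N : ℕ} (h : a ≤ N) :
    ENNReal.ofReal (√(N : ℝ))⁻¹ ^ 2 * a ≤ 1 := by
  rw [← ENNReal.ofReal_pow (by positivity), inv_pow, Real.sq_sqrt (by positivity),
    ← ENNReal.ofReal_natCast, ← ENNReal.ofReal_mul (by positivity)]
  refine ENNReal.ofReal_le_one.2 ?_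
  rw [inv_mul_eq_div]
  exact div_le_one_of_le₀ (by exact_mod_cast h) (by positivity)

theorem ofReal_inv_mul_le {a N : ℕ} (h : a ≤ N) : ENNReal.ofReal (N : ℝ)⁻¹ * a ≤ 1 := by
  rw [← ENNReal.ofReal_natCast, ← ENNReal.ofReal_mul (by positivity)]
  refine ENNReal.ofReal_le_one.2 ?_
  rw [inv_mul_eq_div]
  exact div_le_one_of_le₀ (by exact_mod_cast h) (by positivity)

/-- First stage rates are stated in n, whereas N may be 2n; the constant 2 generously covers √2. -/
theorem ofReal_inv_sqrt_mul_le {a N n : ℕ} (h : a ≤ N) (hN : N ≤ 2 * n) :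
    ENNReal.ofReal (√(N : ℝ))⁻¹ * a ≤ 2 * (n : ℝ≥0∞) ^ (1 / 2 : ℝ) := by
  have h1 : (n : ℝ≥0∞) ^ (1 / 2 : ℝ) = ENNReal.ofReal √(n : ℝ) := by
    rw [← ENNReal.ofReal_natCast, ENNReal.ofReal_rpow_of_nonneg (by positivity) (by norm_num),
      Real.sqrt_eq_rpow]
  have h2 : (2 : ℝ≥0∞) = ENNReal.ofReal 2 := by simp
  rw [h1, h2, ← ENNReal.ofReal_natCast, ← ENNReal.ofReal_mul (by positivity),
    ← ENNReal.ofReal_mul (by positivity)]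
  refine ENNReal.ofReal_le_ofReal ?_
  have ha : (a : ℝ) ≤ N := by exact_mod_cast h
  have hn : (N : ℝ) ≤ 2 * n := by exact_mod_cast hN
  calc (√(N : ℝ))⁻¹ * a ≤ (√(N : ℝ))⁻¹ * N := by gcongr
    _ = √(N : ℝ) := by rw [inv_mul_eq_div, Real.div_sqrt]
    _ ≤ √(2 ^ 2 * (n : ℝ)) := Real.sqrt_le_sqrt (by nlinarith [(Nat.cast_nonneg n : (0 : ℝ) ≤ n)])
    _ = 2 * √(n : ℝ) := by rw [Real.sqrt_mul (by norm_num), Real.sqrt_sq (by norm_num)]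

/-! ### Negligibility of the first stage error. -/

namespace FoldScheme

open MomentModel

variable {𝒵 𝒳 Ω : Type*} [MeasurableSpace 𝒵] [MeasurableSpace 𝒳] [MeasurableSpace Ω] {d ℓ k : ℕ}
  {M : MomentModel 𝒵 𝒳 d ℓ} {r : ℝ} {P : Measure Ω} {l : Filter ℕ} {S : Set (Fin ℓ → ℕ)}
  {Z : ℕ → Ω → 𝒵} {ι : Type} [Fintype ι] {𝒲 : ℕ → ι → Type*} [∀ n j, MeasurableSpace (𝒲 n j)]

/-- The first stage estimate for a fold. -/
def hhat (E : FoldScheme M P Z ι 𝒲) (j : ι) (n : ℕ) (ω : Ω) : 𝒳 → Vec ℓ := E.H n j (E.W n j ω)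

theorem hhat_mem (E : FoldScheme M P Z ι 𝒲) (j : ι) (n : ℕ) (ω : Ω) : E.hhat j n ω ∈ M.ℋ :=
  E.H_mem n j _

theorem sum_fold (E : FoldScheme M P Z ι 𝒲) {A : Type*} [AddCommMonoid A] (n : ℕ) (f : ℕ → A) :
    ∑ j, ∑ t ∈ E.fold n j, f t = ∑ t ∈ Finset.range (E.N n), f t := by
  rw [← E.biUnion_fold, Finset.sum_biUnion]
  exact fun i _ j _ hij => E.disjoint_fold n i j hij

theorem card_fold_le (E : FoldScheme M P Z ι 𝒲) (n : ℕ) (j : ι) : (E.fold n j).card ≤ E.N n := by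
  have h : E.fold n j ⊆ Finset.range (E.N n) := by
    rw [← E.biUnion_fold]
    exact Finset.subset_biUnion_of_mem (E.fold n) (Finset.mem_univ j)
  simpa using Finset.card_le_card h

variable [IsProbabilityMeasure P]

/-- The terms of the Taylor expansion that belong to `S`. -/
theorem tendsto_taylorTerm_of_mem (E : FoldScheme M P Z ι 𝒲) (hZ : IsIIDSample M.law P Z)
    (hs : M.IsSmooth k) (hr : M.IsRegular k r) (ho : M.IsOrthogonal S) {j : ι}
    (hF : M.FirstStageConditions S k P l (E.hhat j)) {i : ℕ} (hi : i ≤ k + 1) (hi0 : i ≠ 0)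
    (w : Fin i → Fin ℓ) (hw : wordIndex w ∈ S) :
    TendstoZeroInProb P l fun n ω => ENNReal.ofReal (√(E.N n : ℝ))⁻¹ *
      ‖∑ t ∈ E.fold n j, M.taylorTerm w (E.hhat j n ω) (Z t ω)‖ₑ := by
  have hC : M.multiDerivBound k r ≠ ∞ := hr.multiDeriv_bounded.ne
  have hw0 : wordIndex w ≠ 0 := by
    intro h
    have := order_wordIndex w
    rw [h] at this
    simp only [order, Pi.zero_apply, Finset.sum_const_zero] at this
    exact hi0 this.symm
  -- Orthogonality centres the summands given the first stage data, so the conditional second moment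
  -- of the scaled sum is at most that of one summand.
  refine hZ.tendstoZeroInProb_norm_sum (fun n => E.measurable_W n j) (fun n => E.indep n j)
    (F := fun n q => M.taylorTerm w (E.H n j q.2) q.1)
    (fun n => hs.measurable_taylorTerm (E.measurable_H n j) hi w) (fun n v hfin =>
      integral_taylorTerm_eq_zero hs ho w hi hw (M.measurable_ℋ _ (E.H_mem n j v)) hfin) ?_
  refine (((hF.consistent _ hw hw0).rpow (p := 1 / 2) (by norm_num)).const_mul
    (c := M.multiDerivBound k r ^ (1 / 2 : ℝ)) (by simp [hC])).mono
    (Eventually.of_forall fun n ω => ?_)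
  rw [← mul_assoc]
  refine (mul_le_of_le_one_left zero_le
    (ofReal_inv_sqrt_sq_mul_le (E.card_fold_le n j))).trans ?_
  simp only [enorm_taylorTerm]
  rw [mul_comm]
  exact lintegral_errFun_mul_multiDeriv_sq_le hs ((order_wordIndex w).trans_le hi)
    (M.measurable_ℋ _ (E.H_mem n j _)) M.h₀_mem_ballh

/-- Scaled sums with negligible conditional mean. -/
theorem tendsto_sum_of_rate (E : FoldScheme M P Z ι 𝒲) (hZ : IsIIDSample M.law P Z) {j : ι}
    {F : ∀ n, 𝒵 × 𝒲 n j → ℝ≥0∞} (hF : ∀ n, Measurable (F n))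
    (h : TendstoZeroInProb P l fun n ω =>
      (n : ℝ≥0∞) ^ (1 / 2 : ℝ) * ∫⁻ z, F n (z, E.W n j ω) ∂M.law) :
    TendstoZeroInProb P l fun n ω => ENNReal.ofReal (√(E.N n : ℝ))⁻¹ *
      ∑ t ∈ E.fold n j, F n (Z t ω, E.W n j ω) := by
  refine hZ.tendstoZeroInProb_sum (fun n => E.measurable_W n j) (fun n => E.indep n j) hF ?_
  refine (h.const_mul (c := 2) (by simp)).mono (Eventually.of_forall fun n ω => ?_)
  rw [← mul_assoc, ← mul_assoc]
  exact mul_le_mul' (ofReal_inv_sqrt_mul_le (E.card_fold_le n j) (E.N_le n)) le_rfl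

/-- The terms of the Taylor expansion that do not belong to `S`. -/
theorem tendsto_taylorTerm_of_not_mem (E : FoldScheme M P Z ι 𝒲) (hZ : IsIIDSample M.law P Z)
    (hs : M.IsSmooth k) (hr : M.IsRegular k r) {j : ι}
    (hF : M.FirstStageConditions S k P l (E.hhat j)) {i : ℕ} (hi : i ≤ k + 1) (hi0 : i ≠ 0)
    (w : Fin i → Fin ℓ) (hw : wordIndex w ∉ S) :
    TendstoZeroInProb P l fun n ω => ENNReal.ofReal (√(E.N n : ℝ))⁻¹ *
      ‖∑ t ∈ E.fold n j, M.taylorTerm w (E.hhat j n ω) (Z t ω)‖ₑ := by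
  have hC : M.multiDerivBound k r ≠ ∞ := hr.multiDeriv_bounded.ne
  have hw0 : wordIndex w ≠ 0 := by
    intro h
    have := order_wordIndex w
    rw [h] at this
    simp only [order, Pi.zero_apply, Finset.sum_const_zero] at this
    exact hi0 this.symm
  have hord : order (wordIndex w) ≤ k + 1 := (order_wordIndex w).trans_le hi
  -- Without orthogonality there is no cancellation to exploit: the norms are summed, at the cost of
  -- a factor √n that the rate condition compensates.
  refine (E.tendsto_sum_of_rate hZ (l := l) (j := j)
    (F := fun n q => ‖M.taylorTerm w (E.H n j q.2) q.1‖ₑ)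
    (fun n => (hs.measurable_taylorTerm (E.measurable_H n j) hi w).enorm) ?_).mono
    (Eventually.of_forall fun n ω => mul_le_mul' le_rfl (enorm_sum_le _ _))
  refine ((hF.rate _ hw0 hord hw).const_mul
    (c := (M.multiDerivBound k r ^ (1 / 2 : ℝ)) ^ (1 / 2 : ℝ)) (by simp [hC])).mono
    (Eventually.of_forall fun n ω => ?_)
  rw [mul_left_comm]
  refine mul_le_mul' le_rfl ?_
  simp only [enorm_taylorTerm]
  rw [mul_comm]
  exact lintegral_errFun_mul_multiDeriv_le hs hord
    (M.measurable_ℋ _ (E.H_mem n j _)) M.h₀_mem_ballh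

/-- The remainders of the Taylor expansions. -/
theorem tendsto_taylorRem (E : FoldScheme M P Z ι 𝒲) (hZ : IsIIDSample M.law P Z)
    (hs : M.IsSmooth k) (hr : M.IsRegular k r) (hr0 : 0 < r) (hS : ∀ α ∈ S, order α ≤ k)
    (hl : l ≤ atTop) {j : ι} (hF : M.FirstStageConditions S k P l (E.hhat j)) :
    TendstoZeroInProb P l fun n ω => ENNReal.ofReal (√(E.N n : ℝ))⁻¹ *
      ∑ t ∈ E.fold n j, ‖M.taylorRem k (E.hhat j n ω) (Z t ω)‖ₑ := by
  have hC : M.multiDerivBound k r ≠ ∞ := hr.multiDeriv_bounded.ne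
  refine E.tendsto_sum_of_rate hZ (l := l) (j := j)
    (F := fun n q => ‖M.taylorRem k (E.H n j q.2) q.1‖ₑ)
    (fun n => (hs.measurable_taylorRem (E.measurable_H n j)).enorm) ?_
  have hsum : TendstoZeroInProb P l fun n ω => ∑ w : Fin (k + 1) → Fin ℓ,
      (M.multiDerivBound k r ^ (1 / 2 : ℝ)) ^ (1 / 2 : ℝ) * ((n : ℝ≥0∞) ^ (1 / 2 : ℝ) *
        (M.errMoment 2 (wordIndex w) (E.hhat j n ω)) ^ (1 / 2 : ℝ)) := by
    -- Words of length k + 1 have multi-indices of order above the maximum over S, so the rate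
    -- condition covers them.
    refine TendstoZeroInProb.sum _ fun w _ => (hF.rate _ ?_ (order_wordIndex w).le ?_).const_mul
      (by simp [hC])
    · intro h
      have := order_wordIndex w
      rw [h] at this
      simp [order] at this
    · intro h
      have := hS _ h
      rw [order_wordIndex] at this
      omega
  refine hsum.mono_of_event (hF.tendsto_not_mem_ballh hl (E.hhat_mem j) hr0)
    (Eventually.of_forall fun n ω hω => ?_)
  have hball : E.hhat j n ω ∈ M.ballh k r := by simpa using hω
  refine (mul_le_mul' le_rfl (lintegral_taylorRem_le hs hball)).trans (le_of_eq ?_)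
  rw [Finset.mul_sum]
  refine Finset.sum_congr rfl fun w _ => ?_
  ring

/-- The effect of the first stage estimates on the scaled empirical moments at `θ₀`. -/
theorem tendsto_moment_diff (E : FoldScheme M P Z ι 𝒲) (hZ : IsIIDSample M.law P Z)
    (hs : M.IsSmooth k) (hr : M.IsRegular k r) (hr0 : 0 < r) (ho : M.IsOrthogonal S)
    (hS : ∀ α ∈ S, order α ≤ k) (hl : l ≤ atTop)
    (hF : ∀ j, M.FirstStageConditions S k P l (E.hhat j)) :
    TendstoZeroInProb P l fun n ω => ‖(√(E.N n : ℝ))⁻¹ • ∑ j, ∑ t ∈ E.fold n j,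
      (M.m (Z t ω) M.θ₀ (E.hhat j n ω (M.X (Z t ω))) -
        M.m (Z t ω) M.θ₀ (M.h₀ (M.X (Z t ω))))‖ₑ := by
  have hterm : TendstoZeroInProb P l fun n ω => ∑ j, (ENNReal.ofReal (√(E.N n : ℝ))⁻¹ *
      ∑ t ∈ E.fold n j, ‖M.taylorRem k (E.hhat j n ω) (Z t ω)‖ₑ +
      ∑ i ∈ Finset.Icc 1 k, ∑ w : Fin i → Fin ℓ, ENNReal.ofReal (√(E.N n : ℝ))⁻¹ *
        ‖∑ t ∈ E.fold n j, M.taylorTerm w (E.hhat j n ω) (Z t ω)‖ₑ) := by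
    refine TendstoZeroInProb.sum _ fun j _ =>
      (E.tendsto_taylorRem hZ hs hr hr0 hS hl (hF j)).add
      (TendstoZeroInProb.sum _ fun i hi => TendstoZeroInProb.sum _ fun w _ => ?_)
    rw [Finset.mem_Icc] at hi
    by_cases hw : wordIndex w ∈ S
    · exact E.tendsto_taylorTerm_of_mem hZ hs hr ho (hF j) (by omega) (by omega) w hw
    · exact E.tendsto_taylorTerm_of_not_mem hZ hs hr (hF j) (by omega) (by omega) w hw
  refine hterm.mono (Eventually.of_forall fun n ω => ?_)
  rw [enorm_smul, Real.enorm_eq_ofReal (by positivity)]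
  refine (mul_le_mul' le_rfl (enorm_sum_le _ _)).trans ?_
  rw [Finset.mul_sum]
  refine Finset.sum_le_sum fun j _ => ?_
  -- The sum over t goes inside each Taylor term before norms are taken, because the terms from S
  -- are small only through cancellation.
  have hdec : ∑ t ∈ E.fold n j, (M.m (Z t ω) M.θ₀ (E.hhat j n ω (M.X (Z t ω))) -
        M.m (Z t ω) M.θ₀ (M.h₀ (M.X (Z t ω)))) =
      ∑ t ∈ E.fold n j, M.taylorRem k (E.hhat j n ω) (Z t ω) +
      ∑ i ∈ Finset.Icc 1 k, ∑ w : Fin i → Fin ℓ, ((i.factorial : ℝ)⁻¹) •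
        ∑ t ∈ E.fold n j, M.taylorTerm w (E.hhat j n ω) (Z t ω) := by
    simp only [taylorRem, Finset.sum_sub_distrib, Finset.smul_sum]
    rw [Finset.sum_comm (s := E.fold n j) (t := Finset.Icc 1 k)]
    simp_rw [Finset.sum_comm (s := E.fold n j)]
    abel
  rw [hdec]
  refine (mul_le_mul' le_rfl (enorm_add_le _ _)).trans ?_
  rw [mul_add]
  refine add_le_add (mul_le_mul' le_rfl (enorm_sum_le _ _)) ?_
  refine (mul_le_mul' le_rfl (enorm_sum_le _ _)).trans ?_
  rw [Finset.mul_sum]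
  refine Finset.sum_le_sum fun i _ => ?_
  refine (mul_le_mul' le_rfl (enorm_sum_le _ _)).trans ?_
  rw [Finset.mul_sum]
  refine Finset.sum_le_sum fun w _ => mul_le_mul' le_rfl ?_
  rw [enorm_smul, Real.enorm_eq_ofReal (by positivity)]
  refine mul_le_of_le_one_left zero_le (ENNReal.ofReal_le_one.2 (inv_le_one_of_one_le₀ ?_))
  exact_mod_cast Nat.one_le_iff_ne_zero.2 i.factorial_ne_zero

/-- The effect of the first stage estimates on the empirical Jacobians. -/
theorem tendsto_gradDiff (E : FoldScheme M P Z ι 𝒲) (hZ : IsIIDSample M.law P Z)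
    (hs : M.IsSmooth k) (hr : M.IsRegular k r) (hr0 : 0 < r) (hl : l ≤ atTop)
    (hF : ∀ j, M.FirstStageConditions S k P l (E.hhat j)) :
    TendstoZeroInProb P l fun n ω => ENNReal.ofReal (E.N n : ℝ)⁻¹ *
      ∑ j, ∑ t ∈ E.fold n j, M.gradDiff r (E.hhat j n ω) (Z t ω) := by
  simp_rw [Finset.mul_sum (s := Finset.univ)]
  refine TendstoZeroInProb.sum _ fun j _ => ?_
  refine hZ.tendstoZeroInProb_sum (fun n => E.measurable_W n j) (fun n => E.indep n j)
    (F := fun n q => M.gradDiff r (E.H n j q.2) q.1)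
    (fun n => hs.measurable_gradDiff r (E.measurable_H n j)) ?_
  have hC : M.gradγθBound k r ≠ ∞ := hr.gradγθ_bounded.ne
  have hsum : TendstoZeroInProb P l fun n ω => (d * d : ℕ) * ∑ a : Fin ℓ,
      M.gradγθBound k r ^ (1 / 2 : ℝ) *
        (M.errMoment 2 (Pi.single a 1) (E.hhat j n ω)) ^ (1 / 2 : ℝ) := by
    refine TendstoZeroInProb.const_mul (TendstoZeroInProb.sum _ fun a _ =>
      TendstoZeroInProb.const_mul (TendstoZeroInProb.rpow
        ((hF j).errMoment_two hl (E.hhat_mem j) ?_ ?_) (by norm_num)) (by simp [hC])) (ENNReal.natCast_ne_top _)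
    · exact fun h => by simpa using congrFun h a
    · simp [order]
  refine hsum.mono_of_event ((hF j).tendsto_not_mem_ballh hl (E.hhat_mem j) hr0)
    (Eventually.of_forall fun n ω hω => ?_)
  have hball : E.hhat j n ω ∈ M.ballh k r := by simpa using hω
  rw [← mul_assoc]
  refine (mul_le_of_le_one_left zero_le (ofReal_inv_mul_le (E.card_fold_le n j))).trans ?_
  refine (lintegral_gradDiff_le hs hball).trans (le_of_eq ?_)
  simp_rw [mul_comm (M.gradγθBound k r ^ (1 / 2 : ℝ))]

end FoldScheme
-- Fluctuations of the Jacobian near `θ₀`, and the score.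
namespace MomentModel

variable {𝒵 𝒳 Ω : Type*} [MeasurableSpace 𝒵] [MeasurableSpace 𝒳] [MeasurableSpace Ω] {d ℓ k : ℕ}
  {M : MomentModel 𝒵 𝒳 d ℓ} {r : ℝ} {P : Measure Ω} {l : Filter ℕ} {Z : ℕ → Ω → 𝒵} {N : ℕ → ℕ}
  {θhat : ℕ → Ω → Vec d}

/-- The fluctuation of the empirical Jacobians in a shrinking neighbourhood of `θ₀`. -/
theorem tendsto_gradModulus (hZ : IsIIDSample M.law P Z) (hs : M.IsSmooth k)
    (hr : M.IsRegular k r) (hr0 : 0 < r)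
    (hθ : TendstoZeroInProb P l fun n ω => ‖θhat n ω - M.θ₀‖ₑ) :
    TendstoZeroInProb P l fun n ω => ENNReal.ofReal (N n : ℝ)⁻¹ *
      ∑ t ∈ Finset.range (N n), M.gradModulus ‖θhat n ω - M.θ₀‖ (Z t ω) := by
  intro ε hε
  rw [ENNReal.tendsto_nhds_zero]
  intro η hη
  wlog hηt : η ≠ ∞ generalizing η
  · simp only [ne_eq, not_not] at hηt
    simp [hηt]
  wlog hεt : ε ≠ ∞ generalizing ε
  · filter_upwards [this 1 one_pos (by simp)] with n hn
    refine (measure_mono fun ω hω => ?_).trans hn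
    simp only [ne_eq, not_not] at hεt
    simp only [hεt, Set.mem_ofPred_eq, top_le_iff] at hω
    simp [hω]
  have hη2 : 0 < η / 2 := ENNReal.half_pos hη.ne'
  -- The estimator depends on the same sample, so its random radius is replaced, by monotonicity,
  -- with a deterministic ρ whose mean modulus is at most ε η / 2, as Markov's inequality requires.
  obtain ⟨ρ, hρ, -, hint⟩ := exists_lintegral_gradModulus_le hs hr hr0
    (ENNReal.mul_pos hε.ne' hη2.ne')
  filter_upwards [(ENNReal.tendsto_nhds_zero.1
    (hθ (ENNReal.ofReal ρ) (ENNReal.ofReal_pos.2 hρ))) (η / 2) hη2] with n hn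
  have hm := hs.measurable_gradModulus (M := M) ρ
  have hmsum : Measurable fun ω => ENNReal.ofReal (N n : ℝ)⁻¹ *
      ∑ t ∈ Finset.range (N n), M.gradModulus ρ (Z t ω) :=
    (Finset.measurable_fun_sum _ fun t _ => hm.comp (hZ.measurable t)).const_mul _
  calc P {ω | ε ≤ ENNReal.ofReal (N n : ℝ)⁻¹ *
        ∑ t ∈ Finset.range (N n), M.gradModulus ‖θhat n ω - M.θ₀‖ (Z t ω)}
      ≤ P ({ω | ENNReal.ofReal ρ ≤ ‖θhat n ω - M.θ₀‖ₑ} ∪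
          {ω | ε ≤ ENNReal.ofReal (N n : ℝ)⁻¹ *
            ∑ t ∈ Finset.range (N n), M.gradModulus ρ (Z t ω)}) := by
        refine measure_mono fun ω hω => ?_
        by_cases hc : ENNReal.ofReal ρ ≤ ‖θhat n ω - M.θ₀‖ₑ
        · exact Or.inl hc
        · have hle : ‖θhat n ω - M.θ₀‖ ≤ ρ := by
            rw [← ofReal_norm, not_le, ENNReal.ofReal_lt_ofReal_iff hρ] at hc
            exact hc.le
          have hω' : ε ≤ ENNReal.ofReal (N n : ℝ)⁻¹ *
            ∑ t ∈ Finset.range (N n), M.gradModulus ‖θhat n ω - M.θ₀‖ (Z t ω) := hω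
          exact Or.inr (hω'.trans
            (mul_le_mul' le_rfl (Finset.sum_le_sum fun t _ => hs.gradModulus_mono hle _)))
    _ ≤ _ := measure_union_le _ _
    _ ≤ η / 2 + η / 2 := by
        gcongr
        refine (meas_ge_le_lintegral_div hmsum.aemeasurable hε.ne' hεt).trans ?_
        refine ENNReal.div_le_of_le_mul ?_
        rw [lintegral_const_mul' _ _ ENNReal.ofReal_ne_top, hZ.lintegral_sum hm, ← mul_assoc,
          Finset.card_range, mul_comm (η / 2)]
        exact (mul_le_of_le_one_left zero_le (ofReal_inv_mul_le le_rfl)).trans hint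
    _ = η := ENNReal.add_halves η

/-- The scaled empirical moments at the true parameters. -/
noncomputable def score (M : MomentModel 𝒵 𝒳 d ℓ) (Z : ℕ → Ω → 𝒵) (N : ℕ) (ω : Ω) : Vec d :=
  (√(N : ℝ))⁻¹ • ∑ t ∈ Finset.range N, M.m (Z t ω) M.θ₀ (M.h₀ (M.X (Z t ω)))

theorem measurable_score (hZ : IsIIDSample M.law P Z) (hs : M.IsSmooth k) (N : ℕ) :
    Measurable (M.score Z N) := by
  have h : Measurable fun ω => ∑ t ∈ Finset.range N, M.m (Z t ω) M.θ₀ (M.h₀ (M.X (Z t ω))) :=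
    Finset.measurable_fun_sum _ fun t _ => hs.measurable_m_h₀.comp (hZ.measurable t)
  exact h.const_smul ((√(N : ℝ))⁻¹)

variable [IsProbabilityMeasure P]

/-- The law of large numbers for the Jacobians at the true parameters. -/
theorem tendsto_gradθ_mean (hZ : IsIIDSample M.law P Z) (hs : M.IsSmooth k)
    (hr : M.IsRegular k r) (hr0 : 0 < r) (hN : Tendsto N l atTop) :
    TendstoZeroInProb P l fun n ω => ∑ i, ∑ j, ‖((N n : ℝ)⁻¹ • ∑ t ∈ Finset.range (N n),
      M.gradθ (Z t ω) M.θ₀ (M.h₀ (M.X (Z t ω))) - M.J) i j‖ₑ := by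
  refine TendstoZeroInProb.sum _ fun i _ => TendstoZeroInProb.sum _ fun j _ => ?_
  refine (hZ.tendstoZeroInProb_mean (hs.measurable_gradθ_comp M.θ₀ i j)
    (integrable_gradθ hs hr hr0 i j) hN).mono (Eventually.of_forall fun n ω => le_of_eq ?_)
  simp [J, Matrix.sum_apply]

theorem order_zero : order (0 : Fin ℓ → ℕ) = 0 := by simp [order]

theorem multiDeriv_zero {F : Type*} [NormedAddCommGroup F] [NormedSpace ℝ F] (f : Vec ℓ → F) :
    multiDeriv (0 : Fin ℓ → ℕ) f = f := by
  rw [multiDeriv_eq_wordDeriv]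
  have : ((List.finRange ℓ).flatMap fun i => List.replicate ((0 : Fin ℓ → ℕ) i) i) = [] := by
    simp
  rw [this]
  rfl

/-- The case α = 0 at `h₀` of the fourth moment bound on the derivatives. -/
theorem memLp_moment (hs : M.IsSmooth k) (hr : M.IsRegular k r) :
    MemLp (fun z => M.m z M.θ₀ (M.h₀ (M.X z))) 2 M.law := by
  refine ⟨hs.measurable_m_h₀.aestronglyMeasurable, ?_⟩
  rw [eLpNorm_lt_top_iff_lintegral_rpow_enorm_lt_top (by norm_num) (by norm_num)]
  have h := lintegral_multiDeriv_sq_le (M := M) (r := r) hs (α := 0) (by simp [order_zero])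
    M.h₀_mem_ballh
  simp only [multiDeriv_zero] at h
  have hC : M.multiDerivBound k r ≠ ∞ := hr.multiDeriv_bounded.ne
  simpa using h.trans_lt (ENNReal.rpow_lt_top_of_nonneg (by norm_num) hC)

theorem integral_moment (M : MomentModel 𝒵 𝒳 d ℓ) :
    ∫ z, M.m z M.θ₀ (M.h₀ (M.X z)) ∂M.law = 0 := by
  rw [← integral_condExp (m := MeasurableSpace.comap M.X inferInstance) M.measurable_X.comap_le,
    integral_congr_ae M.moment_eq_zero]
  simp

/-- By x ≤ 1 + x², the variance bound makes the score bounded in mean uniformly in N; a vanishing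
factor times the score then vanishes in probability. -/
theorem lintegral_score_le (hZ : IsIIDSample M.law P Z) (hs : M.IsSmooth k)
    (hr : M.IsRegular k r) (N : ℕ) :
    ∫⁻ ω, ‖M.score Z N ω‖ₑ ∂P ≤ 1 + ∫⁻ z, ‖M.m z M.θ₀ (M.h₀ (M.X z))‖ₑ ^ 2 ∂M.law := by
  have hfin : ∫⁻ z, ‖M.m z M.θ₀ (M.h₀ (M.X z))‖ₑ ^ 2 ∂M.law ≠ ∞ := by
    have := (memLp_moment hs hr).2
    rw [eLpNorm_lt_top_iff_lintegral_rpow_enorm_lt_top (by norm_num) (by norm_num)] at this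
    simpa using this.ne
  have hsq (x : ℝ≥0∞) : x ≤ 1 + x ^ 2 := by
    rcases le_total x 1 with h | h
    · exact h.trans le_self_add
    · calc x = x * 1 := (mul_one x).symm
        _ ≤ x * x := by gcongr
        _ = x ^ 2 := (sq x).symm
        _ ≤ _ := le_add_self
  calc ∫⁻ ω, ‖M.score Z N ω‖ₑ ∂P ≤ ∫⁻ ω, (1 + ‖M.score Z N ω‖ₑ ^ 2) ∂P :=
        lintegral_mono fun ω => hsq _
    _ = 1 + ∫⁻ ω, ‖M.score Z N ω‖ₑ ^ 2 ∂P := by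
        rw [lintegral_add_left measurable_const]; simp
    _ ≤ _ := by
        gcongr
        simp only [score, enorm_smul, mul_pow]
        rw [lintegral_const_mul' _ _ (by simp),
          hZ.lintegral_norm_sum_sq hs.measurable_m_h₀ hfin M.integral_moment, ← mul_assoc,
          Finset.card_range, Real.enorm_eq_ofReal (by positivity)]
        exact mul_le_of_le_one_left zero_le (ofReal_inv_sqrt_sq_mul_le le_rfl)

open scoped Matrix in
/-- The central limit theorem for the linear approximation of the estimator. -/
theorem tendstoInDistribution_score (hZ : IsIIDSample M.law P Z) (hs : M.IsSmooth k)
    (hr : M.IsRegular k r) (hN : Tendsto N l atTop) :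
    TendstoInDistribution
      (fun (n : ℕ) ω => Matrix.toEuclideanCLM (𝕜 := ℝ) (-M.J⁻¹) (M.score Z (N n) ω)) l
      id (fun _ => P) (multivariateGaussian 0 M.asympCov) := by
  have hL := memLp_moment hs hr
  set L := Matrix.toEuclideanCLM (𝕜 := ℝ) (-M.J⁻¹) with hLdef
  have hcov : covMatrix M.law (fun z => L (M.m z M.θ₀ (M.h₀ (M.X z)))) = M.asympCov := by
    have h := covMatrix_mulVec hL (-M.J⁻¹)
    have hV : covMatrix M.law (fun z => M.m z M.θ₀ (M.h₀ (M.X z))) = M.V := rfl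
    rw [hV] at h
    rw [asympCov]
    -- The two signs of -J⁻¹ cancel in the covariance.
    simp only [Matrix.transpose_neg, Matrix.neg_mul, Matrix.mul_neg, neg_neg] at h
    exact h
  have hLm : Measurable fun z => L (M.m z M.θ₀ (M.h₀ (M.X z))) :=
    L.continuous.measurable.comp hs.measurable_m_h₀
  have h := hZ.tendstoInDistribution_sum hLm (L.comp_memLp' hL) (by
    rw [L.integral_comp_comm (hL.integrable (by norm_num)), M.integral_moment, map_zero]) hN
  rw [hcov] at h
  convert h using 3
  rw [score, map_smul, map_sum]

end MomentModel

/-! ### Linearization in θ and asymptotic normality. -/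

namespace FoldScheme

open MomentModel

variable {𝒵 𝒳 Ω : Type*} [MeasurableSpace 𝒵] [MeasurableSpace 𝒳] [MeasurableSpace Ω] {d ℓ k : ℕ}
  {M : MomentModel 𝒵 𝒳 d ℓ} {r : ℝ} {P : Measure Ω} {l : Filter ℕ} {S : Set (Fin ℓ → ℕ)}
  {Z : ℕ → Ω → 𝒵} {ι : Type} [Fintype ι] {𝒲 : ℕ → ι → Type*} [∀ n j, MeasurableSpace (𝒲 n j)]

/-- The sum of the moments over the sample. -/
noncomputable def momentSum (E : FoldScheme M P Z ι 𝒲) (n : ℕ) (ω : Ω) (θ : Vec d) : Vec d :=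
  ∑ j, ∑ t ∈ E.fold n j, M.m (Z t ω) θ (E.hhat j n ω (M.X (Z t ω)))

/-- The random modulus of the linearization in `θ`. -/
noncomputable def linModulus (E : FoldScheme M P Z ι 𝒲) (r ρ : ℝ) (n : ℕ) (ω : Ω) : ℝ≥0∞ :=
  ENNReal.ofReal (E.N n : ℝ)⁻¹ * ∑ j, ∑ t ∈ E.fold n j, M.gradDiff r (E.hhat j n ω) (Z t ω) +
  ENNReal.ofReal (E.N n : ℝ)⁻¹ * ∑ t ∈ Finset.range (E.N n), M.gradModulus ρ (Z t ω) +
  ∑ i, ∑ j, ‖((E.N n : ℝ)⁻¹ • ∑ t ∈ Finset.range (E.N n),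
      M.gradθ (Z t ω) M.θ₀ (M.h₀ (M.X (Z t ω))) - M.J) i j‖ₑ

/-- Linearization of the empirical moments in `θ`. -/
theorem enorm_momentSum_sub_le (E : FoldScheme M P Z ι 𝒲) (hs : M.IsSmooth k) {n : ℕ} {ω : Ω}
    {θ : Vec d} (hseg : ∀ θ' ∈ _root_.segment ℝ M.θ₀ θ, θ' ∈ M.ballθ ‖θ - M.θ₀‖)
    (hθ : ‖θ - M.θ₀‖ ≤ r) :
    ‖(E.N n : ℝ)⁻¹ • (E.momentSum n ω θ - E.momentSum n ω M.θ₀) -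
        Matrix.toEuclideanCLM (𝕜 := ℝ) M.J (θ - M.θ₀)‖ₑ ≤
      E.linModulus r ‖θ - M.θ₀‖ n ω * ‖θ - M.θ₀‖ₑ := by
  set v := θ - M.θ₀ with hv
  set G : ℕ → Matrix (Fin d) (Fin d) ℝ := fun t => M.gradθ (Z t ω) M.θ₀ (M.h₀ (M.X (Z t ω)))
    with hG
  set A : Matrix (Fin d) (Fin d) ℝ :=
    (E.N n : ℝ)⁻¹ • ∑ t ∈ Finset.range (E.N n), G t with hA
  -- Each summand is linearized with its own Jacobian at the true parameters; the average A of these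
  -- Jacobians is then compared with J.
  have h1 : (E.N n : ℝ)⁻¹ • (E.momentSum n ω θ - E.momentSum n ω M.θ₀) -
      Matrix.toEuclideanCLM (𝕜 := ℝ) M.J v =
      (E.N n : ℝ)⁻¹ • (∑ j, ∑ t ∈ E.fold n j,
        (M.m (Z t ω) θ (E.hhat j n ω (M.X (Z t ω))) -
          M.m (Z t ω) M.θ₀ (E.hhat j n ω (M.X (Z t ω))) -
          Matrix.toEuclideanCLM (𝕜 := ℝ) (G t) v)) +
      Matrix.toEuclideanCLM (𝕜 := ℝ) (A - M.J) v := by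
    simp only [Finset.sum_sub_distrib, hA, map_sub, map_smul, map_sum,
      sub_apply, smul_apply, smul_sub,
      momentSum]
    rw [E.sum_fold n fun t => Matrix.toEuclideanCLM (𝕜 := ℝ) (G t) v,
      sum_apply]
    abel
  rw [h1, linModulus, add_mul]
  refine (enorm_add_le _ _).trans (add_le_add ?_ ?_)
  · rw [enorm_smul, Real.enorm_eq_ofReal (by positivity), ← mul_add, mul_assoc]
    refine mul_le_mul' le_rfl ?_
    rw [← E.sum_fold n fun t => M.gradModulus ‖v‖ (Z t ω), ← Finset.sum_add_distrib,
      Finset.sum_mul]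
    refine (enorm_sum_le _ _).trans (Finset.sum_le_sum fun j _ => ?_)
    rw [← Finset.sum_add_distrib, Finset.sum_mul]
    refine (enorm_sum_le _ _).trans (Finset.sum_le_sum fun t _ => ?_)
    exact hs.enorm_m_sub_le fun θ' hθ' => hs.gradDist_le hθ (hseg θ' hθ') _ _
  · refine (ContinuousLinearMap.le_opENorm _ _).trans (mul_le_mul' ?_ le_rfl)
    rw [← ofReal_norm]
    refine (ENNReal.ofReal_le_ofReal (norm_toEuclideanCLM_le _)).trans (le_of_eq ?_)
    rw [ENNReal.ofReal_sum_of_nonneg fun i _ => by positivity]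
    refine Finset.sum_congr rfl fun i _ => ?_
    rw [ENNReal.ofReal_sum_of_nonneg fun i _ => by positivity]
    refine Finset.sum_congr rfl fun j _ => ?_
    rw [← Real.norm_eq_abs, ofReal_norm]

variable [IsProbabilityMeasure P]

theorem tendsto_linModulus (E : FoldScheme M P Z ι 𝒲) (hZ : IsIIDSample M.law P Z)
    (hs : M.IsSmooth k) (hr : M.IsRegular k r) (hr0 : 0 < r) (hl : l ≤ atTop)
    (hN : Tendsto E.N l atTop) (hF : ∀ j, M.FirstStageConditions S k P l (E.hhat j))
    {θhat : ℕ → Ω → Vec d} (hθ : TendstoZeroInProb P l fun n ω => ‖θhat n ω - M.θ₀‖ₑ) :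
    TendstoZeroInProb P l fun n ω => E.linModulus r ‖θhat n ω - M.θ₀‖ n ω :=
  ((E.tendsto_gradDiff hZ hs hr hr0 hl hF).add (tendsto_gradModulus hZ hs hr hr0 hθ)).add
    (tendsto_gradθ_mean hZ hs hr hr0 hN)

/-- The distance of the estimator from its linear approximation, for a fixed sample. -/
theorem enorm_sub_linear_le (E : FoldScheme M P Z ι 𝒲) (hs : M.IsSmooth k) (hJ : IsUnit M.J)
    {n : ℕ} (hn : 0 < E.N n) {ω : Ω} {θ : Vec d}
    (hseg : ∀ θ' ∈ _root_.segment ℝ M.θ₀ θ, θ' ∈ M.ballθ ‖θ - M.θ₀‖) (hθ : ‖θ - M.θ₀‖ ≤ r)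
    (h0 : E.momentSum n ω θ = 0)
    (hq : ‖Matrix.toEuclideanCLM (𝕜 := ℝ) M.J⁻¹‖ₑ * E.linModulus r ‖θ - M.θ₀‖ n ω ≤ 1 / 2) :
    ‖√(E.N n : ℝ) • (θ - M.θ₀) + Matrix.toEuclideanCLM (𝕜 := ℝ) M.J⁻¹ (M.score Z (E.N n) ω)‖ₑ ≤
      2 * (‖Matrix.toEuclideanCLM (𝕜 := ℝ) M.J⁻¹‖ₑ ^ 2 *
        (E.linModulus r ‖θ - M.θ₀‖ n ω * ‖M.score Z (E.N n) ω‖ₑ) +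
        ‖Matrix.toEuclideanCLM (𝕜 := ℝ) M.J⁻¹‖ₑ *
        ‖(√(E.N n : ℝ))⁻¹ • ∑ j, ∑ t ∈ E.fold n j,
          (M.m (Z t ω) M.θ₀ (E.hhat j n ω (M.X (Z t ω))) -
            M.m (Z t ω) M.θ₀ (M.h₀ (M.X (Z t ω))))‖ₑ) := by
  have hlin := E.enorm_momentSum_sub_le hs hseg hθ (n := n) (ω := ω)
  rw [h0, zero_sub] at hlin
  set v := θ - M.θ₀ with hv
  set q := E.linModulus r ‖v‖ n ω with hqdef
  set B := Matrix.toEuclideanCLM (𝕜 := ℝ) M.J⁻¹ with hB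
  set L := Matrix.toEuclideanCLM (𝕜 := ℝ) M.J with hL
  set y := M.score Z (E.N n) ω with hy
  set s := √(E.N n : ℝ) with hs'
  set R := s⁻¹ • ∑ j, ∑ t ∈ E.fold n j, (M.m (Z t ω) M.θ₀ (E.hhat j n ω (M.X (Z t ω))) -
            M.m (Z t ω) M.θ₀ (M.h₀ (M.X (Z t ω)))) with hR
  have hs0 : 0 < s := Real.sqrt_pos.2 (by exact_mod_cast hn)
  have hsN : (E.N n : ℝ) = s * s := (Real.mul_self_sqrt (by positivity)).symm
  have hBL (x : Vec d) : B (L x) = x := by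
    have : B * L = 1 := by
      rw [hB, hL, ← map_mul, Matrix.nonsing_inv_mul _ ((Matrix.isUnit_iff_isUnit_det _).1 hJ),
        map_one]
    exact DFunLike.congr_fun this x
  set e := (E.N n : ℝ)⁻¹ • -E.momentSum n ω M.θ₀ - L v with he
  -- With e the linearization error and `momentSum` zero at θ, one has -(s e) - R = s J v + y
  -- exactly.
  have hid : s • v + B y = B (-(s • e) - R) := by
    have hRy : R = s⁻¹ • E.momentSum n ω M.θ₀ - y := by
      rw [hR, hy, score, momentSum]
      simp only [Finset.sum_sub_distrib, smul_sub]
      rw [E.sum_fold n fun t => M.m (Z t ω) M.θ₀ (M.h₀ (M.X (Z t ω)))]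
    have hse : s • e = -(s⁻¹ • E.momentSum n ω M.θ₀) - s • L v := by
      rw [he, smul_sub, smul_smul, hsN, mul_inv, mul_inv_cancel_left₀ hs0.ne', smul_neg]
    rw [hRy, hse]
    have : -(-(s⁻¹ • E.momentSum n ω M.θ₀) - s • L v) - (s⁻¹ • E.momentSum n ω M.θ₀ - y) =
        s • L v + y := by abel
    rw [this, map_add, map_smul, hBL]
  have hsv : ‖s • v‖ₑ ≤ ‖s • v + B y‖ₑ + ‖B‖ₑ * ‖y‖ₑ := by
    calc ‖s • v‖ₑ = ‖(s • v + B y) - B y‖ₑ := by rw [add_sub_cancel_right]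
      _ ≤ ‖s • v + B y‖ₑ + ‖B y‖ₑ := enorm_sub_le
      _ ≤ _ := by gcongr; exact B.le_opENorm y
  have hmain : ‖s • v + B y‖ₑ ≤ ‖B‖ₑ * (q * ‖s • v‖ₑ + ‖R‖ₑ) := by
    conv_lhs => rw [hid]
    refine (B.le_opENorm _).trans (mul_le_mul' le_rfl ?_)
    refine enorm_sub_le.trans (add_le_add ?_ le_rfl)
    rw [enorm_neg, enorm_smul, enorm_smul, mul_left_comm]
    exact mul_le_mul' le_rfl hlin
  set D := ‖s • v + B y‖ₑ with hD
  have hDt : D ≠ ∞ := enorm_ne_top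
  set x := ‖B‖ₑ ^ 2 * (q * ‖y‖ₑ) + ‖B‖ₑ * ‖R‖ₑ with hx
  -- Bootstrap: the linearization error involves √N(θ - θ₀), which is bounded by D plus a multiple
  -- of the score. Its coefficient on D is at most 1/2 by `hq`, so finiteness of D lets half of D be
  -- absorbed, and no prior rate is needed.
  have h2 : D ≤ D / 2 + x := by
    calc D ≤ ‖B‖ₑ * (q * (D + ‖B‖ₑ * ‖y‖ₑ) + ‖R‖ₑ) := hmain.trans (by gcongr)
      _ = (‖B‖ₑ * q) * D + x := by rw [hx]; ring
      _ ≤ 1 / 2 * D + x := by gcongr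
      _ = D / 2 + x := by rw [one_div, mul_comm, div_eq_mul_inv]
  have h3 : D / 2 ≤ x := by
    have h4 : D / 2 + D / 2 ≤ D / 2 + x := by rwa [ENNReal.add_halves]
    exact (ENNReal.add_le_add_iff_left (ENNReal.div_ne_top hDt (by simp))).1 h4
  calc D = 2 * (D / 2) := (ENNReal.mul_div_cancel (by simp) (by simp)).symm
    _ ≤ 2 * x := by gcongr

/-- Asymptotic normality of the estimator. -/
theorem asymptotic_normality (E : FoldScheme M P Z ι 𝒲) (hZ : IsIIDSample M.law P Z)
    (hM : M.MomentConditions S k) (hS : ∀ α ∈ S, order α ≤ k) [l.IsCountablyGenerated]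
    (hl : l ≤ atTop) (hN : Tendsto E.N l atTop)
    (hF : ∀ j, M.FirstStageConditions S k P l (E.hhat j)) {θhat : ℕ → Ω → Vec d}
    (hθm : ∀ n, Measurable (θhat n))
    (hsolve : Tendsto (fun n => P {ω | ¬ (θhat n ω ∈ M.Θ ∧ E.momentSum n ω (θhat n ω) = 0)}) l
      (𝓝 0))
    (hcons : TendstoInMeasure P θhat l fun _ => M.θ₀) :
    TendstoInDistribution (fun (n : ℕ) ω => √(E.N n : ℝ) • (θhat n ω - M.θ₀)) l
      id (fun _ => P) (multivariateGaussian 0 M.asympCov) := by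
  obtain ⟨r, hr0, hr⟩ := hM.regular
  have hs := hM.smooth
  obtain ⟨δ, hδ, hseg⟩ := M.exists_segment_subset_ballθ
  have hθ : TendstoZeroInProb P l fun n ω => ‖θhat n ω - M.θ₀‖ₑ := by
    intro ε hε
    simpa only [edist_eq_enorm_sub] using hcons ε hε
  set B := Matrix.toEuclideanCLM (𝕜 := ℝ) M.J⁻¹ with hB
  have hq := E.tendsto_linModulus hZ hs hr hr0 hl hN hF hθ
  have hqB := hq.const_mul (c := ‖B‖ₑ) enorm_ne_top
  have hC : 1 + ∫⁻ z, ‖M.m z M.θ₀ (M.h₀ (M.X z))‖ₑ ^ 2 ∂M.law ≠ ∞ := by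
    have := (memLp_moment hs hr).2
    rw [eLpNorm_lt_top_iff_lintegral_rpow_enorm_lt_top (by norm_num) (by norm_num)] at this
    simpa using this.ne
  have hqy := hq.mul_of_lintegral_le (g := fun n ω => ‖M.score Z (E.N n) ω‖ₑ)
    (fun n => (measurable_score hZ hs _).enorm.aemeasurable) hC
    (fun n => lintegral_score_le hZ hs hr _)
  have hR := E.tendsto_moment_diff hZ hs hr hr0 hM.orthogonal hS hl hF
  have hbound := ((hqy.const_mul (c := ‖B‖ₑ ^ 2) (by simp)).add
    (hR.const_mul (c := ‖B‖ₑ) enorm_ne_top)).const_mul (c := 2) (by simp)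
  have hρ : (0 : ℝ≥0∞) < ENNReal.ofReal (min δ r) := ENNReal.ofReal_pos.2 (lt_min hδ hr0)
  -- Outside three unlikely events (equation unsolved, estimate not close, modulus too large) the
  -- deterministic bound applies.
  have hbad : Tendsto (fun n => P ({ω | ¬ (θhat n ω ∈ M.Θ ∧ E.momentSum n ω (θhat n ω) = 0)} ∪
      ({ω | ¬ ‖θhat n ω - M.θ₀‖ₑ ≤ ENNReal.ofReal (min δ r)} ∪
      {ω | ¬ ‖B‖ₑ * E.linModulus r ‖θhat n ω - M.θ₀‖ n ω ≤ 1 / 2}))) l (𝓝 0) := by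
    have h := hsolve.add ((hθ.tendsto_measure_not hρ).add
      (hqB.tendsto_measure_not (r := 1 / 2) (by simp)))
    simp only [add_zero] at h
    exact tendsto_of_tendsto_of_tendsto_of_le_of_le tendsto_const_nhds h
      (fun _ => zero_le) fun n => (measure_union_le _ _).trans
        (add_le_add le_rfl (measure_union_le _ _))
  have hD : TendstoZeroInProb P l fun n ω =>
      ‖√(E.N n : ℝ) • (θhat n ω - M.θ₀) + B (M.score Z (E.N n) ω)‖ₑ := by
    refine hbound.mono_of_event hbad ?_
    filter_upwards [hN (eventually_ge_atTop 1)] with n hn ω hω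
    simp only [Set.mem_union, Set.mem_ofPred_eq, not_or, not_not] at hω
    obtain ⟨⟨hΘ, hzero⟩, hclose, hq2⟩ := hω
    rw [← ofReal_norm, ENNReal.ofReal_le_ofReal_iff (lt_min hδ hr0).le] at hclose
    exact E.enorm_sub_linear_le hs hM.nondegenerate hn
      (hseg _ hΘ (hclose.trans (min_le_left _ _))) (hclose.trans (min_le_right _ _)) hzero hq2
  -- Slutsky: the estimator inherits the limit law of its linear approximation.
  refine tendstoInDistribution_of_tendstoInMeasure_sub _ _
    (tendstoInDistribution_score hZ hs hr hN) ?_ fun n => ?_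
  · intro ε hε
    refine (hD ε hε).congr fun n => ?_
    simp only [edist_eq_enorm_sub, Pi.sub_apply, Pi.zero_apply, sub_zero, map_neg,
      neg_apply, sub_neg_eq_add, hB]
  · exact (((hθm n).sub_const _).const_smul (√(E.N n : ℝ))).aemeasurable

end FoldScheme
-- Simplified first stage conditions for k-orthogonal moments.
-- Every factor is replaced by the largest one. The condition α ≠ 0 excludes ℓ = 0, where the
-- product is 1 and the sum is 0.
theorem prod_pow_le_sum_pow {ℓ : ℕ} (a : Fin ℓ → ℝ≥0∞) (c : ℕ) {α : Fin ℓ → ℕ} (hα : α ≠ 0) :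
    ∏ i, a i ^ (c * α i) ≤ ∑ i, a i ^ (c * order α) := by
  obtain ⟨i₁, -⟩ := Function.ne_iff.1 hα
  obtain ⟨i₀, -, hi₀⟩ := Finset.exists_max_image Finset.univ a ⟨i₁, Finset.mem_univ _⟩
  calc ∏ i, a i ^ (c * α i) ≤ ∏ i, a i₀ ^ (c * α i) :=
        Finset.prod_le_prod' fun i hi => pow_le_pow_left' (hi₀ i hi) _
    _ = a i₀ ^ (c * order α) := by rw [Finset.prod_pow_eq_pow_sum, order, Finset.mul_sum]
    _ ≤ _ := Finset.single_le_sum (f := fun i => a i ^ (c * order α)) (fun _ _ => zero_le)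
        (Finset.mem_univ i₀)

theorem one_le_order {ℓ : ℕ} {α : Fin ℓ → ℕ} (hα : α ≠ 0) : 1 ≤ order α := by
  obtain ⟨i, hi⟩ := Function.ne_iff.1 hα
  have h : α i ≤ order α := Finset.single_le_sum (fun _ _ => Nat.zero_le _) (Finset.mem_univ i)
  exact (Nat.one_le_iff_ne_zero.2 hi).trans h

namespace MomentModel

section SimpleConditions

variable {𝒵 𝒳 Ω : Type*} [MeasurableSpace 𝒵] [MeasurableSpace 𝒳] [MeasurableSpace Ω] {d ℓ k : ℕ}
  {M : MomentModel 𝒵 𝒳 d ℓ} {P : Measure Ω} {l : Filter ℕ} {hhat : ℕ → Ω → 𝒳 → Vec ℓ}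

theorem measurable_err (M : MomentModel 𝒵 𝒳 d ℓ) {h : 𝒳 → Vec ℓ} (hh : Measurable h) (i : Fin ℓ) :
    Measurable fun z => h (M.X z) i - M.h₀ (M.X z) i :=
  ((measurable_coord i).comp (hh.comp M.measurable_X)).sub
    ((measurable_coord i).comp (M.measurable_h₀.comp M.measurable_X))

theorem errNorm_pow (M : MomentModel 𝒵 𝒳 d ℓ) {p : ℕ} (hp : p ≠ 0) (i : Fin ℓ) (h : 𝒳 → Vec ℓ) :
    M.errNorm p i h ^ p = ∫⁻ z, ‖h (M.X z) i - M.h₀ (M.X z) i‖ₑ ^ p ∂M.law := by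
  have h1 := eLpNorm_nnreal_pow_eq_lintegral (μ := M.law) (p := (p : NNReal))
    (f := fun z => h (M.X z) i - M.h₀ (M.X z) i) (by exact_mod_cast hp)
  simpa [errNorm] using h1

theorem errNorm_mono (M : MomentModel 𝒵 𝒳 d ℓ) {p q : ℕ} (hpq : p ≤ q) (i : Fin ℓ) {h : 𝒳 → Vec ℓ}
    (hh : Measurable h) : M.errNorm p i h ≤ M.errNorm q i h :=
  haveI := M.isProb
  eLpNorm_le_eLpNorm_of_exponent_le (by exact_mod_cast hpq)
    (M.measurable_err hh i).aestronglyMeasurable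

theorem errMoment_le_sum_errNorm (M : MomentModel 𝒵 𝒳 d ℓ) {c : ℕ} (hc : c ≠ 0) {α : Fin ℓ → ℕ}
    (hα : α ≠ 0) {h : 𝒳 → Vec ℓ} (hh : Measurable h) :
    M.errMoment c α h ≤ ∑ i, M.errNorm (c * order α) i h ^ (c * order α) := by
  have hne : c * order α ≠ 0 := mul_ne_zero hc (Nat.one_le_iff_ne_zero.1 (one_le_order hα))
  simp only [M.errNorm_pow hne]
  rw [← lintegral_finsetSum _ fun i _ => (M.measurable_err hh i).enorm.pow_const _]
  exact lintegral_mono fun z => prod_pow_le_sum_pow _ c hα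

theorem SimpleFirstStageConditions.firstStageConditions
    (h : M.SimpleFirstStageConditions k P l hhat) (hm : ∀ n ω, hhat n ω ∈ M.ℋ) :
    M.FirstStageConditions (orthSet ℓ k) k P l hhat := by
  refine ⟨fun α hα h0 => ?_, fun α h0 hk hα => ?_⟩
  · have h1 := one_le_order h0
    have h2 : order α ≤ k := hα
    have hs := TendstoZeroInProb.sum Finset.univ fun i _ =>
      (h.consistent i).pow (p := 4 * order α) (by omega)
    refine hs.mono (Eventually.of_forall fun n ω => ?_)
    have hh := M.measurable_ℋ _ (hm n ω)
    refine (M.errMoment_le_sum_errNorm (by norm_num) h0 hh).trans (Finset.sum_le_sum fun i _ => ?_)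
    -- Norms over a probability space increase with the exponent, and 4 · order α ≤ 4k. For k = 0
    -- this case is void, since then 1 ≤ order α ≤ 0.
    exact pow_le_pow_left' (M.errNorm_mono (by omega) i hh) _
  -- Only order k + 1 remains, and the power 2k + 2 turns n^(1/(2k+2)) into n, whose square root is
  -- the required rate.
  · have h1 : order α = k + 1 := le_antisymm hk (Nat.succ_le_of_lt (not_le.1 hα))
    have hs := (TendstoZeroInProb.sum Finset.univ fun i _ =>
      (h.rate i).pow (p := 2 * k + 2) (by omega)).rpow (p := 1 / 2) (by norm_num)
    refine hs.mono (Eventually.of_forall fun n ω => ?_)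
    have hh := M.measurable_ℋ _ (hm n ω)
    rw [← ENNReal.mul_rpow_of_nonneg _ _ (by norm_num : (0 : ℝ) ≤ 1 / 2)]
    refine ENNReal.rpow_le_rpow ?_ (by norm_num)
    have h2 := M.errMoment_le_sum_errNorm (c := 2) (by norm_num) h0 hh
    rw [h1, show 2 * (k + 1) = 2 * k + 2 by ring] at h2
    refine (mul_le_mul_right h2 _).trans ?_
    rw [Finset.mul_sum]
    refine Finset.sum_le_sum fun i _ => ?_
    rw [mul_pow, ← ENNReal.rpow_mul_natCast]
    have h3 : 1 / (2 * (k : ℝ) + 2) * ((2 * k + 2 : ℕ) : ℝ) = 1 := by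
      push_cast
      field_simp
    rw [h3, ENNReal.rpow_one]

end SimpleConditions

end MomentModel

/-! ### The two estimators as fold schemes. -/

theorem foldFilter_le_atTop (K : ℕ) : foldFilter K ≤ atTop := inf_le_left

instance (K : ℕ) : (foldFilter K).IsCountablyGenerated := by
  unfold foldFilter
  infer_instance

theorem tendsto_two_mul_foldFilter (K : ℕ) :
    Tendsto (fun n : ℕ => 2 * n) (foldFilter K) atTop :=
  (tendsto_id.const_mul_atTop' (by norm_num)).mono_left (foldFilter_le_atTop K)

namespace SampleSplitting

variable {𝒵 𝒳 Ω : Type*} [MeasurableSpace 𝒵] [MeasurableSpace 𝒳] [MeasurableSpace Ω] {d ℓ : ℕ}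
  {M : MomentModel 𝒵 𝒳 d ℓ} {P : Measure Ω} {Z : ℕ → Ω → 𝒵}

/-- Sample splitting as a scheme with a single fold, the first half of the sample. -/
def foldScheme (E : SampleSplitting M) (hZ : IsIIDSample M.law P Z) :
    FoldScheme M P Z Unit fun n _ => Fin n → 𝒵 where
  N n := n
  N_le n := by omega
  fold n _ := Finset.range n
  disjoint_fold n i j h := absurd (Subsingleton.elim i j) h
  biUnion_fold n := by simp
  W n _ ω t := Z (n + t) ω
  measurable_W n _ := measurable_pi_lambda _ fun t => hZ.measurable _
  indep n _ := by
    have hd : Disjoint (Finset.range n) (Finset.Ico n (2 * n)) := by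
      rw [Finset.disjoint_left]
      intro t ht h't
      rw [Finset.mem_range] at ht
      rw [Finset.mem_Ico] at h't
      omega
    -- The first stage data are a reindexing of the subsample n, …, 2n - 1, which is disjoint from
    -- the fold.
    have h := (hZ.indepFun_subsample hd).comp measurable_id
      (ψ := fun (w : Finset.Ico n (2 * n) → 𝒵) (t : Fin n) =>
        w ⟨n + t, Finset.mem_Ico.2 ⟨by omega, by omega⟩⟩)
      (measurable_pi_lambda _ fun t => measurable_pi_apply _)
    exact h
  H n _ := E.hhat n
  H_mem n _ := E.hhat_mem n
  measurable_H n _ := E.measurable_hhat n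

theorem measurable_estimate (E : SampleSplitting M) (hZ : IsIIDSample M.law P Z) (n : ℕ) :
    Measurable (E.estimate Z n) := by
  have h := (E.measurable_θhat n).comp
    (measurable_pi_lambda (fun ω (t : Fin (2 * n)) => Z t ω) fun t => hZ.measurable t)
  exact h

theorem empMoment_eq (E : SampleSplitting M) (hZ : IsIIDSample M.law P Z) (n : ℕ) (ω : Ω)
    (θ : Vec d) : E.empMoment Z n ω θ = (n : ℝ)⁻¹ • (E.foldScheme hZ).momentSum n ω θ := by
  rw [empMoment, Fin.sum_univ_eq_sum_range
    (fun t => M.m (Z t ω) θ (E.firstStage Z n ω (M.X (Z t ω)))) n]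
  simp only [FoldScheme.momentSum, Finset.univ_unique, Finset.sum_singleton]
  rfl

theorem asymptotic_normality [IsProbabilityMeasure P] (E : SampleSplitting M)
    (hZ : IsIIDSample M.law P Z) {S : Set (Fin ℓ → ℕ)} {k : ℕ} (hM : M.MomentConditions S k)
    (hS : ∀ α ∈ S, order α ≤ k) (hF : M.FirstStageConditions S k P atTop (E.firstStage Z))
    (hsolve : E.Solves P Z) (hcons : E.Consistent P Z) :
    TendstoInDistribution (fun (n : ℕ) ω => √(n : ℝ) • (E.estimate Z n ω - M.θ₀)) atTop
      id (fun _ => P) (multivariateGaussian 0 M.asympCov) := by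
  refine (E.foldScheme hZ).asymptotic_normality hZ hM hS le_rfl tendsto_id (fun _ => hF)
    (E.measurable_estimate hZ) (hsolve.congr' ?_) hcons
  -- At n = 0 the inverse is 0 by convention, and a vanishing mean would say nothing about the sum.
  filter_upwards [eventually_ne_atTop 0] with n hn
  simp only [E.empMoment_eq hZ, smul_eq_zero, inv_eq_zero, Nat.cast_eq_zero, hn, false_or]

end SampleSplitting

namespace CrossFitting

variable {𝒵 𝒳 Ω : Type*} [MeasurableSpace 𝒵] [MeasurableSpace 𝒳] [MeasurableSpace Ω] {d ℓ K : ℕ}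
  {M : MomentModel 𝒵 𝒳 d ℓ} {P : Measure Ω} {Z : ℕ → Ω → 𝒵}

/-- The fold `j`, as a set of natural numbers. -/
def foldSet (E : CrossFitting M K) (n : ℕ) (j : Fin K) : Finset ℕ :=
  (Finset.univ.filter fun t => E.fold n t = j).map Fin.valEmbedding

theorem mem_foldSet (E : CrossFitting M K) {n : ℕ} {j : Fin K} {t : ℕ} :
    t ∈ E.foldSet n j ↔ ∃ h : t < 2 * n, E.fold n ⟨t, h⟩ = j := by
  simp only [foldSet, Finset.mem_map, Finset.mem_filter, Finset.mem_univ, true_and,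
    Fin.valEmbedding_apply]
  constructor
  · rintro ⟨s, hs, rfl⟩
    exact ⟨s.2, hs⟩
  · rintro ⟨h, hj⟩
    exact ⟨⟨t, h⟩, hj, rfl⟩

/-- Cross-fitting as a scheme with `K` folds. -/
def foldScheme (E : CrossFitting M K) (hZ : IsIIDSample M.law P Z) :
    FoldScheme M P Z (Fin K) fun n j => {t : Fin (2 * n) // E.fold n t ≠ j} → 𝒵 where
  N n := 2 * n
  N_le n := le_rfl
  fold n j := E.foldSet n j
  disjoint_fold n i j h := by
    rw [Finset.disjoint_left]
    intro t ht h't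
    obtain ⟨h1, rfl⟩ := E.mem_foldSet.1 ht
    obtain ⟨h2, h3⟩ := E.mem_foldSet.1 h't
    exact h h3
  biUnion_fold n := by
    ext t
    simp only [Finset.mem_biUnion, Finset.mem_univ, true_and, mem_foldSet, Finset.mem_range]
    exact ⟨fun ⟨_, h, _⟩ => h, fun h => ⟨_, h, rfl⟩⟩
  W n j ω t := Z t.1 ω
  measurable_W n j := measurable_pi_lambda _ fun t => hZ.measurable _
  indep n j := by
    -- The first stage data are a reindexing of the sample points outside the fold.
    have h := (hZ.indepFun_subsample (Finset.disjoint_sdiff (s := E.foldSet n j)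
        (t := Finset.range (2 * n)))).comp measurable_id
      (ψ := fun (w : ↥(Finset.range (2 * n) \ E.foldSet n j) → 𝒵)
          (t : {t : Fin (2 * n) // E.fold n t ≠ j}) =>
        w ⟨t.1, Finset.mem_sdiff.2 ⟨Finset.mem_range.2 t.1.2, fun ht =>
          t.2 (E.mem_foldSet.1 ht).2⟩⟩)
      (measurable_pi_lambda _ fun t => measurable_pi_apply _)
    exact h
  H n j := E.hhat n j
  H_mem n j := E.hhat_mem n j
  measurable_H n j := E.measurable_hhat n j

theorem measurable_estimate (E : CrossFitting M K) (hZ : IsIIDSample M.law P Z) (n : ℕ) :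
    Measurable (E.estimate Z n) := by
  have h := (E.measurable_θhat n).comp
    (measurable_pi_lambda (fun ω (t : Fin (2 * n)) => Z t ω) fun t => hZ.measurable t)
  exact h

theorem empMoment_eq (E : CrossFitting M K) (hZ : IsIIDSample M.law P Z) (n : ℕ) (ω : Ω)
    (θ : Vec d) : E.empMoment Z n ω θ = (2 * n : ℝ)⁻¹ • (E.foldScheme hZ).momentSum n ω θ := by
  rw [empMoment, FoldScheme.momentSum]
  congr 1
  refine Finset.sum_congr rfl fun j _ => ?_
  exact (Finset.sum_map _ Fin.valEmbedding
    (fun t => M.m (Z t ω) θ (E.firstStage Z j n ω (M.X (Z t ω))))).symm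

theorem asymptotic_normality [IsProbabilityMeasure P] (E : CrossFitting M K)
    (hZ : IsIIDSample M.law P Z) {S : Set (Fin ℓ → ℕ)} {k : ℕ} (hM : M.MomentConditions S k)
    (hS : ∀ α ∈ S, order α ≤ k)
    (hF : ∀ j, M.FirstStageConditions S k P (foldFilter K) (E.firstStage Z j))
    (hsolve : E.Solves P Z) (hcons : E.Consistent P Z) :
    TendstoInDistribution (fun (n : ℕ) ω => √(2 * n : ℝ) • (E.estimate Z n ω - M.θ₀))
      (foldFilter K) id (fun _ => P) (multivariateGaussian 0 M.asympCov) := by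
  have h := (E.foldScheme hZ).asymptotic_normality hZ hM hS (foldFilter_le_atTop K)
    (tendsto_two_mul_foldFilter K) hF (E.measurable_estimate hZ) (hsolve.congr' ?_) hcons
  · simpa only [foldScheme, Nat.cast_mul, Nat.cast_ofNat] using h
  · filter_upwards [foldFilter_le_atTop K (eventually_ne_atTop 0)] with n hn
    simp only [E.empMoment_eq hZ, smul_eq_zero, inv_eq_zero, mul_eq_zero, two_ne_zero,
      Nat.cast_eq_zero, hn, false_or]

end CrossFitting

end OrthogonalML

theorem theorem1 {𝒵 𝒳 Ω : Type*} [MeasurableSpace 𝒵] [MeasurableSpace 𝒳] [MeasurableSpace Ω]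
    {d ℓ : ℕ} (M : OrthogonalML.MomentModel 𝒵 𝒳 d ℓ)
    (P : Measure Ω) [IsProbabilityMeasure P] (Z : ℕ → Ω → 𝒵)
    (hZ : OrthogonalML.IsIIDSample M.law P Z)
    (S : Set (Fin ℓ → ℕ)) (k : ℕ) (hk : IsGreatest (OrthogonalML.order '' S) k)
    (hM : M.MomentConditions S k) :
    -- the sample-splitting estimator
    (∀ E : OrthogonalML.SampleSplitting M,
      M.FirstStageConditions S k P atTop (E.firstStage Z) →
      E.Solves P Z → E.Consistent P Z →
      TendstoInDistribution (fun (n : ℕ) ω => √(n : ℝ) • (E.estimate Z n ω - M.θ₀)) atTop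
        id (fun _ => P) (multivariateGaussian 0 M.asympCov)) ∧
    -- the cross-fitting estimator
    (∀ (K : ℕ) (E : OrthogonalML.CrossFitting M K),
      (∀ j, M.FirstStageConditions S k P (OrthogonalML.foldFilter K) (E.firstStage Z j)) →
      E.Solves P Z → E.Consistent P Z →
      TendstoInDistribution (fun (n : ℕ) ω => √(2 * n : ℝ) • (E.estimate Z n ω - M.θ₀))
        (OrthogonalML.foldFilter K) id (fun _ => P) (multivariateGaussian 0 M.asympCov)) ∧
    -- both estimators, for `k`-orthogonal moments
    (S = OrthogonalML.orthSet ℓ k →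
      (∀ E : OrthogonalML.SampleSplitting M,
        M.SimpleFirstStageConditions k P atTop (E.firstStage Z) →
        E.Solves P Z → E.Consistent P Z →
        TendstoInDistribution (fun (n : ℕ) ω => √(n : ℝ) • (E.estimate Z n ω - M.θ₀)) atTop
          id (fun _ => P) (multivariateGaussian 0 M.asympCov)) ∧
      (∀ (K : ℕ) (E : OrthogonalML.CrossFitting M K),
        (∀ j, M.SimpleFirstStageConditions k P (OrthogonalML.foldFilter K) (E.firstStage Z j)) →
        E.Solves P Z → E.Consistent P Z →
        TendstoInDistribution (fun (n : ℕ) ω => √(2 * n : ℝ) • (E.estimate Z n ω - M.θ₀))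
          (OrthogonalML.foldFilter K) id (fun _ => P) (multivariateGaussian 0 M.asympCov))) := by
  have hS : ∀ α ∈ S, OrthogonalML.order α ≤ k := fun α hα => hk.2 ⟨α, hα, rfl⟩
  refine ⟨fun E hF => E.asymptotic_normality hZ hM hS hF,
    fun K E hF => E.asymptotic_normality hZ hM hS hF, fun hSk => ⟨fun E hF => ?_, fun K E hF => ?_⟩⟩
  · refine E.asymptotic_normality hZ hM hS ?_
    rw [hSk]
    exact hF.firstStageConditions (fun n _ => E.hhat_mem n _)
  · refine E.asymptotic_normality hZ hM hS fun j => ?_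
    rw [hSk]
    exact (hF j).firstStageConditions (fun n _ => E.hhat_mem n j _)
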